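/- Let $p$ be an odd prime and let $V$ be a quadratic space over $\mathbb{Q}_p$ of dimension $n\ge 3$, with quadratic form $q$ and non-degenerate symmetric form $(x,y)=q(x+y)-q(x)-q(y)$. Let $\breve{\mathbb{Q}}_p$ be the completion of the maximal unramified extension of $\mathbb{Q}_p$, with Frobenius $\sigma$, and let $G=\mathrm{GSpin}(V)$, a subgroup of the units of the even Clifford algebra of $V$ ($v^2=q(v)$), acting on $V$ by $g\bullet v=gvg^{-1}$. Let $x_1,x_2\in V_{\breve{\mathbb{Q}}_p}$ satisfy $(x_1,x_1)=(x_2,x_2)=0$, $(x_1,x_2)=1$, and let $\mu:\mathbb{G}_m\to G$ be the cocharacter $\mu(t)=t^{-1}x_1x_2+x_2x_1$. Let $b\in G(\breve{\mathbb{Q}}_p)$ be basic (its Newton cocharacter factors through the centre of $G$) with the same Kottwitz invariant as $\mu$ in $\pi_1(G)_\Gamma$; here $\pi_1(G)_\Gamma=\mathbb{Z}$ through the similitude $g\mapsto g^*g$, so that the invariant of $b$ is the valuation of $b^*b$. In other words, $b$ represents the basic class of $B(G,\mu)$. Put $\Phi=b\circ\sigma$ on $V_{\breve{\mathbb{Q}}_p}$,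 that is $\Phi(x)=b\,\sigma(x)\,b^{-1}$. Then the form of $V_{\breve{\mathbb{Q}}_p}$ takes values in $\mathbb{Q}_p$ on $$\mathbb{V}=\{x\in V_{\breve{\mathbb{Q}}_p}:\Phi x=x\},$$ and the quadratic space $\mathbb{V}$ over $\mathbb{Q}_p$ has the same dimension $n$ and the same discriminant $(-1)^{n(n-1)/2}\det((v_i,v_j))\in\mathbb{Q}_p^\times/(\mathbb{Q}_p^\times)^2$ as $V$, and Hasse invariant $\epsilon(\mathbb{V})=-\epsilon(V)$, where $\epsilon=\prod_{i<j}(q(v_i),q(v_j))_{\mathbb{Q}_p}$ for any orthogonal basis $(v_i)$, with Hilbert symbols. Moreover, call a $\mathbb{Z}_p$-lattice $L$ in a quadratic space a vertex lattice of type $t$ if $pL^\vee\subset L\subset L^\vee$ and $\dim_{\mathbb{F}_p}L^\vee/L=t$. For a sign $\chi$ let $H_m^{\chi}$ be the self-dual lattice of rank $m$ (over $\mathbb{Z}_p$) whose discriminant, a $p$-adic unit, has quadratic residue symbol $\chi$, and let $\Lambda_m^{\chi}$ be the lattice whose moment matrix is $p$ times that of $H_m^\chi$. Let $\Lambda_{\max}$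 and $\Lambda_{\min}$ be any vertex lattices in $\mathbb{V}$ of maximal and of minimal type; such lattices exist. Write $V$ as the orthogonal sum of hyperbolic planes and an anisotropic space $V_{\mathrm{an}}$. Up to isometry: 1. If $\dim V_{\mathrm{an}}=0$: $\Lambda_{\max}=\Lambda_{n-2}^-\perp H_2^-$ and $\Lambda_{\min}=H_{n-2}^-\perp \Lambda_2^-$. 2. If $\dim V_{\mathrm{an}}=1$, then for some sign $\chi$ one of the following two conditions on $V$ holds, and for every such $\chi$: if $V=(H_n^\chi)_{\mathbb{Q}_p}$, then $\Lambda_{\max}=\Lambda_{n-1}^-\perp H_1^{-\chi}$ and $\Lambda_{\min}=H_{n-2}^{-\chi}\perp \Lambda_2^-$; if $V=(H_{n-1}^+\perp \Lambda_1^\chi)_{\mathbb{Q}_p}$, then $\Lambda_{\max}=\Lambda_{n-2}^{-\chi}\perp H_2^-$ and $\Lambda_{\min}=H_{n-1}^-\perp \Lambda_1^{-\chi}$. 3. If $\dim V_{\mathrm{an}}=2$, then one of the following three conditions on $V$ holds (for some signs $\chi_1,\chi_2$ in the last one), and: if $V=(H_n^-)_{\mathbb{Q}_p}$, then $\Lambda_{\max}=\Lambda_n^-$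 and $\Lambda_{\min}=H_{n-2}^+\perp \Lambda_2^-$; if $V=(H_{n-2}^+\perp \Lambda_2^-)_{\mathbb{Q}_p}$, then $\Lambda_{\max}=\Lambda_{n-2}^+\perp H_2^-$ and $\Lambda_{\min}=H_n^-$; if $V=(H_{n-1}^{\chi_2}\perp \Lambda_1^{\chi_1})_{\mathbb{Q}_p}$, then $\Lambda_{\max}=\Lambda_{n-1}^{-\chi_1}\perp H_1^{-\chi_2}$ and $\Lambda_{\min}=H_{n-1}^{-\chi_2}\perp \Lambda_1^{-\chi_1}$. 4. If $\dim V_{\mathrm{an}}=3$, then for some sign $\chi$ one of the following two conditions on $V$ holds, and for every such $\chi$: if $V=(H_{n-2}^{-\chi}\perp \Lambda_2^-)_{\mathbb{Q}_p}$, then $\Lambda_{\max}=\Lambda_{n-1}^+\perp H_1^\chi$ and $\Lambda_{\min}=H_n^\chi$; if $V=(H_{n-1}^-\perp \Lambda_1^{-\chi})_{\mathbb{Q}_p}$, then $\Lambda_{\max}=\Lambda_n^\chi$ and $\Lambda_{\min}=H_{n-1}^+\perp \Lambda_1^\chi$. 5. If $\dim V_{\mathrm{an}}=4$: $\Lambda_{\max}=\Lambda_n^+$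 and $\Lambda_{\min}=H_n^+$. Here $\perp $ denotes the orthogonal sum. -/

import Mathlib

open scoped TensorProduct
open Module

noncomputable section

namespace GSpinFixed

/-! ### The field `ℚ̆_p` and its Frobenius -/

section Breve

variable (p : ℕ) [Fact p.Prime]

/-- An algebraic closure of `𝔽_p`. -/
abbrev FpBar : Type := AlgebraicClosure (ZMod p)

/-- `ℤ̆_p = W(𝔽̄_p)`, the ring of integers of `ℚ̆_p`. -/
abbrev BreveZp : Type := WittVector p (FpBar p)

instance : CharP (FpBar p) p :=
  charP_of_injective_algebraMap (algebraMap (ZMod p) (FpBar p)).injective p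

/-- `ℚ̆_p = Frac W(𝔽̄_p)`, the completion of the maximal unramified extension of `ℚ_p`. -/
def BreveQp : Type := FractionRing (BreveZp p)

instance : Field (BreveQp p) := inferInstanceAs (Field (FractionRing (BreveZp p)))

instance : Algebra (BreveZp p) (BreveQp p) :=
  inferInstanceAs (Algebra (BreveZp p) (FractionRing (BreveZp p)))

instance : IsFractionRing (BreveZp p) (BreveQp p) :=
  inferInstanceAs (IsFractionRing (BreveZp p) (FractionRing (BreveZp p)))

/-- The canonical map `ℤ_p = W(𝔽_p) → W(𝔽̄_p)`. -/
def zpToBreveZp : ℤ_[p] →+* BreveZp p :=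
  (WittVector.map (algebraMap (ZMod p) (FpBar p))).comp
    (WittVector.equiv p).symm.toRingHom

theorem zpToBreveZp_injective : Function.Injective (zpToBreveZp p) :=
  (WittVector.map_injective _ (algebraMap (ZMod p) (FpBar p)).injective).comp
    (WittVector.equiv p).symm.injective

theorem zpToBreveQp_injective :
    Function.Injective ((algebraMap (BreveZp p) (BreveQp p)).comp (zpToBreveZp p)) :=
  (IsFractionRing.injective (BreveZp p) (BreveQp p)).comp (zpToBreveZp_injective p)

/-- `ℚ̆_p` is an extension of `ℚ_p`. -/
instance : Algebra ℚ_[p] (BreveQp p) :=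
  (IsFractionRing.lift (K := ℚ_[p]) (zpToBreveQp_injective p)).toAlgebra

/-- The Frobenius automorphism of `ℚ̆_p`, as a ring automorphism. -/
def sigmaRing : BreveQp p ≃+* BreveQp p :=
  IsFractionRing.ringEquivOfRingEquiv (A := BreveZp p) (B := BreveZp p)
    (WittVector.frobeniusEquiv p (FpBar p))

theorem sigmaRing_algebraMap (x : ℚ_[p]) :
    sigmaRing p (algebraMap ℚ_[p] (BreveQp p) x) = algebraMap ℚ_[p] (BreveQp p) x := by
  have h : (sigmaRing p).toRingHom.comp (algebraMap ℚ_[p] (BreveQp p)) =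
      algebraMap ℚ_[p] (BreveQp p) := by
    apply IsLocalization.ringHom_ext (nonZeroDivisors ℤ_[p])
    ext z
    have h1 : algebraMap ℚ_[p] (BreveQp p) (algebraMap ℤ_[p] ℚ_[p] z) =
        algebraMap (BreveZp p) (BreveQp p) (zpToBreveZp p z) :=
      IsFractionRing.lift_algebraMap (K := ℚ_[p]) (zpToBreveQp_injective p) z
    have h2 : WittVector.frobeniusEquiv p (FpBar p) (zpToBreveZp p z) = zpToBreveZp p z := by
      change WittVector.frobenius (WittVector.map _ _) = WittVector.map _ _
      have h3 : ∀ w : WittVector p (ZMod p),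
          WittVector.frobenius (WittVector.map (algebraMap (ZMod p) (FpBar p)) w) =
            WittVector.map (algebraMap (ZMod p) (FpBar p)) w := by
        intro w
        ext n
        rw [WittVector.coeff_frobenius_charP, WittVector.map_coeff, ← map_pow, ZMod.pow_card]
      exact h3 _
    change sigmaRing p (algebraMap ℚ_[p] (BreveQp p) (algebraMap ℤ_[p] ℚ_[p] z)) =
      algebraMap ℚ_[p] (BreveQp p) (algebraMap ℤ_[p] ℚ_[p] z)
    rw [h1, sigmaRing, IsFractionRing.ringEquivOfRingEquiv_algebraMap, h2]
  exact RingHom.congr_fun h x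

/-- The Frobenius `σ ∈ Aut(ℚ̆_p / ℚ_p)`. -/
def sigma : BreveQp p →ₐ[ℚ_[p]] BreveQp p :=
  { (sigmaRing p).toRingHom with commutes' := sigmaRing_algebraMap p }

end Breve

/-! ### The group `GSpin(V)(ℚ̆_p)` inside `C(V) ⊗ ℚ̆_p` -/

section GSpin

variable {p : ℕ} [Fact p.Prime] {V : Type*} [AddCommGroup V] [Module ℚ_[p] V]

/-- `V_{ℚ̆_p}`. -/
abbrev VBreve (p : ℕ) [Fact p.Prime] (V : Type*) [AddCommGroup V] [Module ℚ_[p] V] : Type _ :=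
  BreveQp p ⊗[ℚ_[p]] V

/-- The Clifford algebra `C(V_{ℚ̆_p}) = C(V) ⊗ ℚ̆_p`; here `v * v = Q v` for `v ∈ V`. -/
abbrev CBreve (Q : QuadraticForm ℚ_[p] V) : Type _ := BreveQp p ⊗[ℚ_[p]] CliffordAlgebra Q

variable (Q : QuadraticForm ℚ_[p] V)

/-- The symmetric bilinear form `(x, y) = Q (x + y) - Q x - Q y`, extended to `V_{ℚ̆_p}`. -/
def formBreve : LinearMap.BilinForm (BreveQp p) (VBreve p V) :=
  LinearMap.BilinForm.baseChange (BreveQp p) (QuadraticMap.polarBilin Q)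

/-- The inclusion `V_{ℚ̆_p} ⊆ C(V_{ℚ̆_p})`. -/
def incl : VBreve p V →ₗ[BreveQp p] CBreve Q := (CliffordAlgebra.ι Q).baseChange (BreveQp p)

/-- The Frobenius `σ` of `C(V_{ℚ̆_p})`, acting through the factor `ℚ̆_p`. -/
def sigmaC : CBreve Q →ₐ[ℚ_[p]] CBreve Q :=
  Algebra.TensorProduct.map (sigma p) (AlgHom.id ℚ_[p] (CliffordAlgebra Q))

/-- The anti-involution `g ↦ g^*` of `C(V_{ℚ̆_p})`, `(v₁ ⋯ v_k)^* = v_k ⋯ v₁`. -/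
def rev : CBreve Q →ₗ[BreveQp p] CBreve Q :=
  (CliffordAlgebra.reverse (Q := Q)).baseChange (BreveQp p)

/-- `g ∈ GSpin(V)(ℚ̆_p)`. -/
structure IsGSpin (g : (CBreve Q)ˣ) : Prop where
  even : (g : CBreve Q) ∈ (CliffordAlgebra.evenOdd Q 0).baseChange (BreveQp p)
  conj_mem : ∀ y : CBreve Q,
    (g : CBreve Q) * y * (↑g⁻¹ : CBreve Q) ∈ LinearMap.range (incl Q) ↔
      y ∈ LinearMap.range (incl Q)
  similitude : ∃ r : (BreveQp p)ˣ,
    rev Q g * g = algebraMap (BreveQp p) (CBreve Q) (r : BreveQp p)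

/-- A cocharacter `𝔾_m → GSpin(V)` defined over `ℚ̆_p`: a homomorphism on `ℚ̆_p`-points given by a
Laurent polynomial. -/
structure IsCocharacter (l : (BreveQp p)ˣ →* (CBreve Q)ˣ) : Prop where
  mem : ∀ z, IsGSpin Q (l z)
  algebraic : ∃ c : ℤ →₀ CBreve Q, ∀ z : (BreveQp p)ˣ,
    (l z : CBreve Q) = c.sum fun i a => ((z ^ i : (BreveQp p)ˣ) : BreveQp p) • a

/-- The operator `F = b ∘ σ` of the isocrystal `C(V_{ℚ̆_p})`. -/
def frobC (b : (CBreve Q)ˣ) (x : CBreve Q) : CBreve Q := b * sigmaC Q x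

/-- The part of slope `r / t` of the isocrystal `(C(V_{ℚ̆_p}), F = b ∘ σ)` : as the residue field is
algebraically closed, it is spanned by the solutions of `F^t x = p^r x`. -/
def slopePart (b : (CBreve Q)ˣ) (t : ℕ) (r : ℤ) : Submodule (BreveQp p) (CBreve Q) :=
  Submodule.span (BreveQp p) {x | (frobC Q b)^[t] x = ((p : BreveQp p) ^ r) • x}

/-- `ν_b = l / t` is the Newton cocharacter of `b`: the decomposition of the faithful
representation `C(V)` of `GSpin(V)` (by left multiplication) into weight spaces is the slope
decomposition of the isocrystal `(C(V_{ℚ̆_p}), b ∘ σ)`. -/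
structure IsNewtonCocharacter (b : (CBreve Q)ˣ) (t : ℕ)
    (l : (BreveQp p)ˣ →* (CBreve Q)ˣ) : Prop where
  pos : 0 < t
  isCocharacter : IsCocharacter Q l
  slope : ∀ (r : ℤ) (x : CBreve Q), x ∈ slopePart Q b t r ↔
    ∀ z : (BreveQp p)ˣ, (l z : CBreve Q) * x = ((z ^ r : (BreveQp p)ˣ) : BreveQp p) • x

/-- `b` is basic: its Newton cocharacter factors through the centre of `GSpin(V)`. -/
def IsBasic (b : (CBreve Q)ˣ) : Prop :=
  ∃ (t : ℕ) (l : (BreveQp p)ˣ →* (CBreve Q)ˣ), IsNewtonCocharacter Q b t l ∧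
    ∀ z g, IsGSpin Q g → Commute (l z) g

/-- The Kottwitz invariant of `b ∈ GSpin(V)(ℚ̆_p)` is `m`. For `dim V ≥ 3` the derived group
`Spin(V)` is simply connected and `g ↦ g^* g` identifies `GSpin(V) / Spin(V)` with `𝔾_m`; so
`π₁(GSpin(V))_Γ = ℤ`, and the Kottwitz invariant is the valuation of `b^* b`. -/
def HasKottwitzInvariant (b : (CBreve Q)ˣ) (m : ℤ) : Prop :=
  ∃ u : (BreveZp p)ˣ, rev Q b * b = algebraMap (BreveQp p) (CBreve Q)
    ((p : BreveQp p) ^ m * algebraMap (BreveZp p) (BreveQp p) u)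

/-- The cocharacter `μ(t) = t⁻¹ x₁ x₂ + x₂ x₁`. -/
def muC (x₁ x₂ : VBreve p V) (t : (BreveQp p)ˣ) : CBreve Q :=
  ((t⁻¹ : (BreveQp p)ˣ) : BreveQp p) • (incl Q x₁ * incl Q x₂) + incl Q x₂ * incl Q x₁

/-- The image of `μ` in `π₁(GSpin(V))_Γ = ℤ` is `m`, i.e. the composition of `μ` with
`g ↦ g^* g` is `t ↦ t^m`. -/
def MuHasClass (x₁ x₂ : VBreve p V) (m : ℤ) : Prop :=
  ∀ t : (BreveQp p)ˣ, rev Q (muC Q x₁ x₂ t) * muC Q x₁ x₂ t =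
    algebraMap (BreveQp p) (CBreve Q) ((t ^ m : (BreveQp p)ˣ) : BreveQp p)

/-- `𝕍 = V_{ℚ̆_p}^Φ`, where `Φ x = b σ(x) b⁻¹`, as a `ℚ_p`-vector space. -/
def fixedSpace (b : (CBreve Q)ˣ) : Submodule ℚ_[p] (VBreve p V) where
  carrier := {x | (b : CBreve Q) * sigmaC Q (incl Q x) * (↑b⁻¹ : CBreve Q) = incl Q x}
  add_mem' := by
    intro x y hx hy
    simp only [Set.mem_ofPred_eq, map_add, mul_add, add_mul] at *
    rw [hx, hy]
  zero_mem' := by simp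
  smul_mem' := by
    intro c x hx
    simp only [Set.mem_ofPred_eq] at *
    have h : incl Q (c • x) = c • incl Q x := (incl Q).map_smul_of_tower c x
    rw [h, map_smul, mul_smul_comm, smul_mul_assoc, hx]

/-- The type of elements of `𝕍 = V_{ℚ̆_p}^Φ`. -/
def FixedV (b : (CBreve Q)ˣ) : Type _ := fixedSpace Q b

instance (b : (CBreve Q)ˣ) : AddCommGroup (FixedV Q b) :=
  inferInstanceAs (AddCommGroup (fixedSpace Q b))

instance (b : (CBreve Q)ˣ) : Module ℚ_[p] (FixedV Q b) :=
  inferInstanceAs (Module ℚ_[p] (fixedSpace Q b))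

instance (b : (CBreve Q)ˣ) : Module ℤ_[p] (FixedV Q b) :=
  Module.compHom (FixedV Q b) (algebraMap ℤ_[p] ℚ_[p])

instance (b : (CBreve Q)ˣ) : IsScalarTower ℤ_[p] ℚ_[p] (FixedV Q b) where
  smul_assoc z r x := by
    rw [Algebra.smul_def, mul_smul]
    rfl

/-- The inclusion `𝕍 ⊆ V_{ℚ̆_p}`. -/
def FixedV.incl (b : (CBreve Q)ˣ) : FixedV Q b →ₗ[ℚ_[p]] VBreve p V :=
  (fixedSpace Q b).subtype

end GSpin

/-! ### Invariants of quadratic spaces over `ℚ_p`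

The symmetric form attached to `Q` is `(x, y) = Q (x + y) - Q x - Q y`. -/

section Invariants

variable {F : Type*} [Field F] {W : Type*} [AddCommGroup W] [Module F W]

/-- The discriminant `(-1)^{n(n-1)/2} det ((x_i, x_j)) ∈ F^× / (F^×)²`, as a coset of `(F^×)²`. -/
def discClass (Q : QuadraticForm F W) : Set F :=
  {d | ∃ (x : Basis (Fin (finrank F W)) F W) (c : F), c ≠ 0 ∧
    d = c ^ 2 * ((-1) ^ (finrank F W).choose 2 *
      (Matrix.of fun i j => QuadraticMap.polar Q (x i) (x j)).det)}

open Classical in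
/-- The Hilbert symbol. -/
def hilbertSymbol (a b : F) : ℤˣ :=
  if ∃ x y z : F, (x ≠ 0 ∨ y ≠ 0 ∨ z ≠ 0) ∧ z ^ 2 = a * x ^ 2 + b * y ^ 2 then 1 else -1

/-- An orthogonal basis. -/
def IsOrthogonalBasis (Q : QuadraticForm F W) (v : Basis (Fin (finrank F W)) F W) : Prop :=
  ∀ i j, i ≠ j → QuadraticMap.polar Q (v i) (v j) = 0

/-- `∏_{i < j} (Q v_i, Q v_j)_F`. -/
def hasseProd (Q : QuadraticForm F W) (v : Basis (Fin (finrank F W)) F W) : ℤˣ :=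
  ∏ i, ∏ j ∈ Finset.Ioi i, hilbertSymbol (Q (v i)) (Q (v j))

/-- The Hasse invariant of `(W, Q)` is `e`. -/
def HasHasseInvariant (Q : QuadraticForm F W) (e : ℤˣ) : Prop :=
  (∃ v, IsOrthogonalBasis Q v) ∧ ∀ v, IsOrthogonalBasis Q v → hasseProd Q v = e

/-- `(W, Q)` is the orthogonal sum of hyperbolic planes and an anisotropic space of
dimension `d`. -/
def HasAnisotropicDim (Q : QuadraticForm F W) (d : ℕ) : Prop :=
  ∃ (r : ℕ) (e f : Fin r → W) (A : Submodule F W),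
    (∀ i, Q (e i) = 0) ∧ (∀ i, Q (f i) = 0) ∧
    (∀ i j, QuadraticMap.polar Q (e i) (e j) = 0) ∧
    (∀ i j, QuadraticMap.polar Q (f i) (f j) = 0) ∧
    (∀ i j, QuadraticMap.polar Q (e i) (f j) = if i = j then 1 else 0) ∧
    (∀ i, ∀ a ∈ A, QuadraticMap.polar Q (e i) a = 0 ∧ QuadraticMap.polar Q (f i) a = 0) ∧
    (∀ a ∈ A, Q a = 0 → a = 0) ∧
    Submodule.span F (Set.range e ∪ Set.range f) ⊔ A = ⊤ ∧
    finrank F A = d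

end Invariants

/-! ### Vertex lattices -/

section Lattices

variable {p : ℕ} [Fact p.Prime] {W : Type*} [AddCommGroup W] [Module ℚ_[p] W]
  [Module ℤ_[p] W] [IsScalarTower ℤ_[p] ℚ_[p] W]

/-- The dual lattice. -/
def dualLattice (Q : QuadraticForm ℚ_[p] W) (L : Submodule ℤ_[p] W) : Submodule ℤ_[p] W :=
  LinearMap.BilinForm.dualSubmodule (QuadraticMap.polarBilin Q) L

/-- `L` is a vertex lattice of type `t`: `p L^∨ ⊆ L ⊆ L^∨`, and the `𝔽_p`-vector space `L^∨ / L`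
has dimension `t`, i.e. `p ^ t` elements. -/
structure IsVertexLattice (Q : QuadraticForm ℚ_[p] W) (L : Submodule ℤ_[p] W) (t : ℕ) : Prop where
  isLattice : Submodule.IsLattice ℚ_[p] L
  p_smul_dual_le : ∀ x ∈ dualLattice Q L, (p : ℤ_[p]) • x ∈ L
  le_dual : L ≤ dualLattice Q L
  index : L.toAddSubgroup.relIndex (dualLattice Q L).toAddSubgroup = p ^ t

/-- `L` is a vertex lattice of maximal type. -/
def IsVertexMax (Q : QuadraticForm ℚ_[p] W) (L : Submodule ℤ_[p] W) : Prop :=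
  ∃ t, IsVertexLattice Q L t ∧ ∀ L' t', IsVertexLattice Q L' t' → t' ≤ t

/-- `L` is a vertex lattice of minimal type. -/
def IsVertexMin (Q : QuadraticForm ℚ_[p] W) (L : Submodule ℤ_[p] W) : Prop :=
  ∃ t, IsVertexLattice Q L t ∧ ∀ L' t', IsVertexLattice Q L' t' → t ≤ t'

/-- The quadratic residue symbol of a unit of `ℤ_p`. -/
def chi (u : ℤ_[p]) : ℤ := quadraticChar (ZMod p) (PadicInt.toZMod u)

/-- `A` is the moment matrix of a self-dual lattice of rank `n` whose discriminant has quadratic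
residue symbol `s`, that is, of `H_n^s`. -/
def IsMomentH {n : ℕ} (A : Matrix (Fin n) (Fin n) ℤ_[p]) (s : ℤˣ) : Prop :=
  A.IsSymm ∧ IsUnit A.det ∧ chi ((-1) ^ n.choose 2 * A.det) = s

/-- `L ≅ H_a^s ⦹ Λ_c^s'`, where `H_a^s` is self-dual of rank `a` and `Λ_c^s'` has moment matrix
`p · H_c^s'`. The lattice `H_0^1 = Λ_0^1` is zero. -/
def IsHLambda (Q : QuadraticForm ℚ_[p] W) (L : Submodule ℤ_[p] W)
    (a : ℕ) (s : ℤˣ) (c : ℕ) (s' : ℤˣ) : Prop :=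
  ∃ (x : Basis (Fin a ⊕ Fin c) ℤ_[p] L)
    (A : Matrix (Fin a) (Fin a) ℤ_[p]) (C : Matrix (Fin c) (Fin c) ℤ_[p]),
    IsMomentH A s ∧ IsMomentH C s' ∧
    ∀ i j, QuadraticMap.polar Q (x i : W) (x j : W) =
      ((Matrix.fromBlocks A 0 0 ((p : ℤ_[p]) • C) i j : ℤ_[p]) : ℚ_[p])

/-- `(W, Q) ≅ (H_a^s ⦹ Λ_c^s')_{ℚ_p}`. -/
def SpaceIsHLambda (Q : QuadraticForm ℚ_[p] W) (a : ℕ) (s : ℤˣ) (c : ℕ) (s' : ℤˣ) : Prop :=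
  ∃ L : Submodule ℤ_[p] W, Submodule.IsLattice ℚ_[p] L ∧ IsHLambda Q L a s c s'

/-- `Λ_max ≅ H_a^s ⦹ Λ_c^s'`: vertex lattices of maximal type exist and are all of this form. -/
def MaxIs (Q : QuadraticForm ℚ_[p] W) (a : ℕ) (s : ℤˣ) (c : ℕ) (s' : ℤˣ) : Prop :=
  (∃ L, IsVertexMax Q L) ∧ ∀ L, IsVertexMax Q L → IsHLambda Q L a s c s'

/-- `Λ_min ≅ H_a^s ⦹ Λ_c^s'`: vertex lattices of minimal type exist and are all of this form. -/
def MinIs (Q : QuadraticForm ℚ_[p] W) (a : ℕ) (s : ℤˣ) (c : ℕ) (s' : ℤˣ) : Prop :=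
  (∃ L, IsVertexMin Q L) ∧ ∀ L, IsVertexMin Q L → IsHLambda Q L a s c s'

end Lattices

end GSpinFixed

end

noncomputable section
namespace GSpinFixed

section Field

variable (p : ℕ) [Fact p.Prime]

theorem algebraMap_padicInt (z : ℤ_[p]) :
    algebraMap ℚ_[p] (BreveQp p) z = algebraMap (BreveZp p) (BreveQp p) (zpToBreveZp p z) :=
  IsFractionRing.lift_algebraMap (K := ℚ_[p]) (zpToBreveQp_injective p) z

instance : CharZero (BreveQp p) :=
  charZero_of_injective_algebraMap (algebraMap ℚ_[p] (BreveQp p)).injective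

theorem prime_cast_ne_zero : (p : BreveQp p) ≠ 0 :=
  Nat.cast_ne_zero.mpr (Fact.out : p.Prime).ne_zero

theorem sigma_breveZp (w : BreveZp p) :
    sigma p (algebraMap (BreveZp p) (BreveQp p) w) =
      algebraMap (BreveZp p) (BreveQp p) (WittVector.frobeniusEquiv p (FpBar p) w) :=
  IsFractionRing.ringEquivOfRingEquiv_algebraMap _ _

/-- Nonzero elements of `ℚ̆_p` are `p ^ k` times a unit of `ℤ̆_p`. -/
def HasVal (x : BreveQp p) (k : ℤ) : Prop :=
  ∃ u : (BreveZp p)ˣ, x = (p : BreveQp p) ^ k * algebraMap (BreveZp p) (BreveQp p) u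

variable {p}

theorem exists_hasVal {x : BreveQp p} (hx : x ≠ 0) : ∃ k, HasVal p x k := by
  obtain ⟨a, s, hs, rfl⟩ := IsFractionRing.div_surjective (A := BreveZp p) x
  have hs0 : s ≠ 0 := nonZeroDivisors.ne_zero hs
  have ha0 : a ≠ 0 := by rintro rfl; simp at hx
  obtain ⟨m, u, rfl⟩ := WittVector.exists_eq_pow_p_mul' a ha0
  obtain ⟨m', u', rfl⟩ := WittVector.exists_eq_pow_p_mul' s hs0
  refine ⟨m - m', u * u'⁻¹, ?_⟩
  have h1 : algebraMap (BreveZp p) (BreveQp p) (u'⁻¹ : (BreveZp p)ˣ) =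
      (algebraMap (BreveZp p) (BreveQp p) u')⁻¹ := by
    rw [← map_units_inv]
  have h2 : algebraMap (BreveZp p) (BreveQp p) u' ≠ 0 := by
    simp [FaithfulSMul.algebraMap_eq_zero_iff]
  have h3 := prime_cast_ne_zero p
  rw [zpow_sub₀ h3]
  rw [Units.val_mul, map_mul, map_mul, map_mul, h1]
  simp only [map_pow, map_natCast, zpow_natCast]
  field_simp

theorem HasVal.mul {x y : BreveQp p} {k l : ℤ} (hx : HasVal p x k) (hy : HasVal p y l) :
    HasVal p (x * y) (k + l) := by
  obtain ⟨u, rfl⟩ := hx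
  obtain ⟨w, rfl⟩ := hy
  refine ⟨u * w, ?_⟩
  rw [zpow_add₀ (prime_cast_ne_zero p)]
  rw [Units.val_mul, map_mul]
  ring

theorem HasVal.sigma {x : BreveQp p} {k : ℤ} (hx : HasVal p x k) : HasVal p (sigma p x) k := by
  obtain ⟨u, rfl⟩ := hx
  refine ⟨Units.map (WittVector.frobeniusEquiv p (FpBar p)).toMonoidHom u, ?_⟩
  rw [map_mul, map_zpow₀, map_natCast, sigma_breveZp]
  rfl

theorem HasVal.unique {x : BreveQp p} {k l : ℤ} (hk : HasVal p x k) (hl : HasVal p x l) :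
    k = l := by
  wlog h : k < l generalizing k l
  · rcases lt_trichotomy k l with h' | h' | h'
    · exact this hk hl h'
    · exact h'
    · exact (this hl hk h').symm
  exfalso
  obtain ⟨u, rfl⟩ := hk
  obtain ⟨w, hw⟩ := hl
  have h3 := prime_cast_ne_zero p
  obtain ⟨d, hd⟩ : ∃ d : ℕ, l = k + (d + 1 : ℕ) := ⟨(l - k - 1).toNat, by omega⟩
  rw [hd, zpow_add₀ h3, mul_assoc] at hw
  have hw2 := mul_left_cancel₀ (zpow_ne_zero k h3) hw
  rw [zpow_natCast, ← map_natCast (algebraMap (BreveZp p) (BreveQp p)), ← map_pow, ← map_mul] at hw2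
  have hw3 := IsFractionRing.injective (BreveZp p) (BreveQp p) hw2
  have hirr := WittVector.irreducible p (k := FpBar p)
  apply hirr.not_isUnit
  apply isUnit_of_dvd_unit (y := (u : BreveZp p)) _ u.isUnit
  rw [hw3, pow_succ']
  exact ⟨(p : BreveZp p) ^ d * w, by ring⟩

theorem mem_range_of_pow_eq {x : FpBar p} (hx : x ^ p = x) :
    ∃ y : ZMod p, algebraMap (ZMod p) (FpBar p) y = x := by
  have h := (Subfield.mem_bot_iff_pow_eq_self (F := FpBar p) (p := p)).2 hx
  have h1 : (⊥ : Subfield (FpBar p)) ≤ (algebraMap (ZMod p) (FpBar p)).fieldRange := bot_le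
  exact h1 h

/-- The fixed field of Frobenius on `ℚ̆_p` is `ℚ_p`. -/
theorem exists_of_sigma_eq {x : BreveQp p} (hx : sigma p x = x) :
    ∃ y : ℚ_[p], algebraMap ℚ_[p] (BreveQp p) y = x := by
  rcases eq_or_ne x 0 with rfl | h0
  · exact ⟨0, map_zero _⟩
  obtain ⟨k, u, rfl⟩ := exists_hasVal h0
  have h3 := prime_cast_ne_zero p
  rw [map_mul, map_zpow₀, map_natCast, sigma_breveZp] at hx
  have h4 := IsFractionRing.injective (BreveZp p) (BreveQp p)
    (mul_left_cancel₀ (zpow_ne_zero k h3) hx)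
  have h5 : ∀ n, ∃ y : ZMod p, algebraMap (ZMod p) (FpBar p) y = (u : BreveZp p).coeff n := by
    intro n
    apply mem_range_of_pow_eq
    conv_rhs => rw [← h4]
    rw [WittVector.frobeniusEquiv_apply, WittVector.coeff_frobenius_charP]
  choose y hy using h5
  refine ⟨(p : ℚ_[p]) ^ k * (WittVector.equiv p (WittVector.mk p y) : ℤ_[p]), ?_⟩
  rw [map_mul, map_zpow₀, map_natCast, algebraMap_padicInt]
  congr 2
  ext n
  have : zpToBreveZp p (WittVector.equiv p (WittVector.mk p y)) =
      WittVector.map (algebraMap (ZMod p) (FpBar p)) (WittVector.mk p y) := by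
    simp [zpToBreveZp]
  rw [this, WittVector.map_coeff]
  exact hy n

/-- Independence of the characters `z ↦ z ^ f i` of `ℚ̆_p^×`. -/
theorem eq_zero_of_zpow_sum_eq_zero {C : Type*} [AddCommGroup C] [Module (BreveQp p) C]
    {f : ℤ → ℤ} (hf : Function.Injective f) (s : Finset ℤ) (c : ℤ → C)
    (h : ∀ z : (BreveQp p)ˣ, ∑ i ∈ s, ((z ^ f i : (BreveQp p)ˣ) : BreveQp p) • c i = 0)
    {i : ℤ} (hi : i ∈ s) : c i = 0 := by
  rw [← Module.forall_dual_apply_eq_zero_iff (BreveQp p)]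
  intro φ
  let χ : ℤ → ((BreveQp p)ˣ →* BreveQp p) := fun i =>
    (Units.coeHom (BreveQp p)).comp (zpowGroupHom (f i))
  have hχ : Function.Injective χ := by
    intro i j hij
    have h1 := DFunLike.congr_fun hij (Units.mk0 (p : BreveQp p) (prime_cast_ne_zero p))
    simp only [χ, MonoidHom.comp_apply, zpowGroupHom_apply, Units.coeHom_apply,
      Units.val_zpow_eq_zpow_val, Units.val_mk0] at h1
    exact hf (HasVal.unique (x := (p : BreveQp p) ^ f i) ⟨1, by simp⟩ ⟨1, by simp [h1]⟩)
  have hli := (linearIndependent_monoidHom (BreveQp p)ˣ (BreveQp p)).comp χ hχ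
  rw [linearIndependent_iff'] at hli
  refine hli s (fun i => φ (c i)) ?_ i hi
  ext z
  have := congrArg φ (h z)
  rw [map_sum, map_zero] at this
  rw [Finset.sum_apply, Pi.zero_apply, ← this]
  refine Finset.sum_congr rfl fun i _ => ?_
  simp [χ, mul_comm]

/-- The powers `σ^k`, `0 ≤ k < t`, are linearly independent on the fixed field of `σ^t`. -/
theorem eq_zero_of_sigma_sum_eq_zero {t : ℕ} (c : ℕ → BreveQp p)
    (h : ∀ a : BreveQp p, (sigma p)^[t] a = a →
      ∑ k ∈ Finset.range t, c k * (sigma p)^[k] a = 0) {k : ℕ} (hk : k < t) : c k = 0 := by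
  let G : Submonoid (BreveQp p) :=
    { carrier := {a | (sigma p)^[t] a = a}
      mul_mem' := by
        intro a b ha hb
        simp only [Set.mem_ofPred_eq] at *
        rw [iterate_map_mul, ha, hb]
      one_mem' := by simp only [Set.mem_ofPred_eq, iterate_map_one] }
  have hpp : p.Prime := Fact.out
  have ht : 0 < t := by omega
  have hlt : ∀ k, k < t → p ^ k - 1 < p ^ t - 1 := by
    intro k hk
    have h1 := Nat.pow_lt_pow_right hpp.one_lt hk
    have h2 := Nat.pow_pos (n := k) hpp.pos
    omega
  have hN : NeZero ((p ^ t - 1 : ℕ) : FpBar p) := by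
    constructor
    rw [Nat.cast_sub (Nat.one_le_pow _ _ hpp.pos)]
    simp [ht.ne']
  obtain ⟨ζ, hζ⟩ := HasEnoughRootsOfUnity.exists_primitiveRoot (FpBar p) (p ^ t - 1)
  have hζ0 : ζ ≠ 0 := hζ.ne_zero (by have := hlt 0 ht; omega)
  let a : BreveQp p := algebraMap (BreveZp p) (BreveQp p) (WittVector.teichmuller p ζ)
  have hfr : ∀ x : FpBar p, sigma p (algebraMap (BreveZp p) (BreveQp p) (WittVector.teichmuller p x)) =
      algebraMap (BreveZp p) (BreveQp p) (WittVector.teichmuller p (x ^ p)) := by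
    intro x
    rw [sigma_breveZp, WittVector.frobeniusEquiv_apply, WittVector.frobenius_eq_map_frobenius,
      WittVector.map_teichmuller]
    rfl
  have hit : ∀ k, (sigma p)^[k] a =
      algebraMap (BreveZp p) (BreveQp p) (WittVector.teichmuller p (ζ ^ p ^ k)) := by
    intro k
    induction k with
    | zero => simp [a]
    | succ k ih => rw [Function.iterate_succ_apply', ih, hfr, ← pow_mul, pow_succ]
  have hinj : ∀ x y : FpBar p, algebraMap (BreveZp p) (BreveQp p) (WittVector.teichmuller p x) =
      algebraMap (BreveZp p) (BreveQp p) (WittVector.teichmuller p y) → x = y := by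
    intro x y hxy
    have := congrArg (fun w => WittVector.coeff w 0)
      (IsFractionRing.injective (BreveZp p) (BreveQp p) hxy)
    simpa using this
  have haG : a ∈ G := by
    change (sigma p)^[t] a = a
    rw [hit]
    congr 2
    have : p ^ t = (p ^ t - 1) + 1 := by have := Nat.one_le_pow t p hpp.pos; omega
    rw [this, pow_succ, hζ.pow_eq_one, one_mul]
  let χ : Fin t → (G →* BreveQp p) := fun k =>
    { toFun := fun a => (sigma p)^[k] a
      map_one' := by simp only [OneMemClass.coe_one, iterate_map_one]
      map_mul' := by intro x y; simp only [Submonoid.coe_mul, iterate_map_mul] }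
  have hχ : Function.Injective χ := by
    intro i j hij
    have h1 := DFunLike.congr_fun hij ⟨a, haG⟩
    change (sigma p)^[(i : ℕ)] a = (sigma p)^[(j : ℕ)] a at h1
    rw [hit, hit] at h1
    have h2 := hinj _ _ h1
    by_contra hne
    wlog hlt' : i < j generalizing i j
    · exact this hij.symm h1.symm h2.symm (Ne.symm hne)
        (lt_of_le_of_ne (not_lt.1 hlt') (Ne.symm hne))
    have hdvd : p ^ t - 1 ∣ p ^ (j : ℕ) - p ^ (i : ℕ) := by
      have hle : p ^ (i : ℕ) ≤ p ^ (j : ℕ) := Nat.pow_le_pow_right hpp.pos (le_of_lt hlt')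
      rw [← hζ.pow_eq_one_iff_dvd]
      have h3 : ζ ^ p ^ (j : ℕ) = ζ ^ p ^ (i : ℕ) * ζ ^ (p ^ (j : ℕ) - p ^ (i : ℕ)) := by
        rw [← pow_add]; congr 1; omega
      rw [← h2] at h3
      exact (mul_left_cancel₀ (pow_ne_zero _ hζ0) (by rw [mul_one]; exact h3)).symm
    have h4 := hlt j j.2
    have h5 : p ^ (i : ℕ) < p ^ (j : ℕ) := Nat.pow_lt_pow_right hpp.one_lt hlt'
    have h6 := Nat.pow_pos (n := (i : ℕ)) hpp.pos
    have := Nat.le_of_dvd (by omega) hdvd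
    omega
  have hli := (linearIndependent_monoidHom G (BreveQp p)).comp χ hχ
  rw [Fintype.linearIndependent_iff] at hli
  refine hli (fun k => c k) ?_ ⟨k, hk⟩
  ext x
  have := h x x.2
  rw [Finset.sum_range] at this
  rw [Finset.sum_apply, Pi.zero_apply, ← this]
  rfl

end Field

section Clifford

set_option linter.unusedSectionVars false

/-- A nontrivial quotient of the Clifford algebra of `(U, form)`, with its grade involution and its
reversal. -/
structure CliffordModel (K U C : Type*) [Field K] [AddCommGroup U] [Module K U] [Ring C]
    [Algebra K C] where
  ι : U →ₗ[K] C
  form : LinearMap.BilinForm K U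
  inv : C →ₐ[K] C
  rev : C →ₗ[K] C
  ι_swap : ∀ x y, ι x * ι y + ι y * ι x = algebraMap K C (form x y)
  adjoin_ι : Algebra.adjoin K (Set.range ι) = ⊤
  inv_ι : ∀ x, inv (ι x) = -ι x
  rev_ι : ∀ x, rev (ι x) = ι x
  rev_one : rev 1 = 1
  rev_mul : ∀ x y, rev (x * y) = rev y * rev x

namespace CliffordModel

variable {K U C : Type*} [Field K] [CharZero K] [AddCommGroup U] [Module K U] [Ring C]
  [Algebra K C] [Nontrivial C] (M : CliffordModel K U C)

theorem form_comm (x y : U) : M.form x y = M.form y x := by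
  apply (algebraMap K C).injective
  rw [← M.ι_swap, ← M.ι_swap, add_comm]

theorem rev_algebraMap (r : K) : M.rev (algebraMap K C r) = algebraMap K C r := by
  rw [Algebra.algebraMap_eq_smul_one, map_smul, M.rev_one]

theorem ι_sq (x : U) : M.ι x * M.ι x = algebraMap K C (M.form x x / 2) := by
  have h := M.ι_swap x x
  rw [← two_smul K, ← eq_inv_smul_iff₀ (by norm_num : (2 : K) ≠ 0)] at h
  rw [h, Algebra.smul_def, ← map_mul]
  congr 1
  ring

theorem ι_anticomm {x y : U} (h : M.form x y = 0) : M.ι x * M.ι y = -(M.ι y * M.ι x) := by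
  have := M.ι_swap x y
  rw [h, map_zero] at this
  exact eq_neg_of_add_eq_zero_left this

theorem ι_injective_of_nondegenerate (hM : ∀ x, (∀ y, M.form x y = 0) → x = 0) :
    Function.Injective M.ι := by
  rw [injective_iff_map_eq_zero]
  intro x hx
  apply hM
  intro y
  apply (algebraMap K C).injective
  rw [← M.ι_swap, hx]
  simp

/-- An orthogonal frame: an orthogonal family of anisotropic vectors that spans. -/
structure IsFrame {I : Type*} (e : I → U) : Prop where
  ortho : ∀ i j, i ≠ j → M.form (e i) (e j) = 0
  norm_ne_zero : ∀ i, M.form (e i) (e i) ≠ 0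
  span : Submodule.span K (Set.range e) = ⊤

theorem commute_of_commute_ι {z : C} (h : ∀ u, Commute z (M.ι u)) (x : C) : Commute z x := by
  have hx : x ∈ Algebra.adjoin K (Set.range M.ι) := by rw [M.adjoin_ι]; trivial
  induction hx using Algebra.adjoin_induction with
  | mem x hx => obtain ⟨u, rfl⟩ := hx; exact h u
  | algebraMap r => exact Algebra.commutes' r z |>.symm
  | add x y _ _ hx hy => exact hx.add_right hy
  | mul x y _ _ hx hy => exact hx.mul_right hy

theorem twisted_commute {z : C} (h : ∀ u, z * M.ι u = -(M.ι u * z)) (x : C) :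
    z * x = M.inv x * z := by
  have hx : x ∈ Algebra.adjoin K (Set.range M.ι) := by rw [M.adjoin_ι]; trivial
  induction hx using Algebra.adjoin_induction with
  | mem x hx => obtain ⟨u, rfl⟩ := hx; rw [h, M.inv_ι, neg_mul]
  | algebraMap r => rw [AlgHom.commutes]; exact (Algebra.commutes r z).symm
  | add x y _ _ hx hy => rw [mul_add, hx, hy, map_add, add_mul]
  | mul x y _ _ hx hy => rw [← mul_assoc, hx, mul_assoc, hy, map_mul, mul_assoc]

theorem forall_of_span {I : Type*} {e : I → U} (he : Submodule.span K (Set.range e) = ⊤)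
    {f g : U →ₗ[K] C} (h : ∀ i, f (e i) = g (e i)) (u : U) : f u = g u := by
  have : f = g := LinearMap.ext_on_range he h
  rw [this]

section Center

variable {I : Type*} {e : I → U}

/-- The subalgebra generated by part of a frame. -/
def sub (e : I → U) (S : Set I) : Subalgebra K C :=
  Algebra.adjoin K (Set.image (fun i => M.ι (e i)) S)

variable {M}

theorem inv_mem_sub {S : Set I} {a : C} (ha : a ∈ M.sub e S) : M.inv a ∈ M.sub e S := by
  induction ha using Algebra.adjoin_induction with
  | mem x hx =>
    obtain ⟨j, hj, rfl⟩ := hx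
    simp only [M.inv_ι]
    exact neg_mem (Algebra.subset_adjoin ⟨j, hj, rfl⟩)
  | algebraMap r => rw [AlgHom.commutes]; exact Subalgebra.algebraMap_mem _ _
  | add x y _ _ hx hy => rw [map_add]; exact add_mem hx hy
  | mul x y _ _ hx hy => rw [map_mul]; exact mul_mem hx hy

theorem sub_mul_ι (he : M.IsFrame e) {S : Set I} {i : I} (hi : i ∉ S) {a : C}
    (ha : a ∈ M.sub e S) : a * M.ι (e i) = M.ι (e i) * M.inv a := by
  induction ha using Algebra.adjoin_induction with
  | mem x hx =>
    obtain ⟨j, hj, rfl⟩ := hx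
    have hij : j ≠ i := by rintro rfl; exact hi hj
    simp only [M.inv_ι]
    rw [M.ι_anticomm (he.ortho j i hij), mul_neg]
  | algebraMap r => rw [AlgHom.commutes]; exact (Algebra.commutes r _)
  | add x y _ _ hx hy => rw [map_add, mul_add, add_mul, hx, hy]
  | mul x y _ _ hx hy => rw [map_mul, mul_assoc, hy, ← mul_assoc, hx, mul_assoc]

theorem exists_decomp (he : M.IsFrame e) {S : Set I} {i : I} (hi : i ∉ S) {x : C}
    (hx : x ∈ M.sub e (insert i S)) :
    ∃ a ∈ M.sub e S, ∃ c ∈ M.sub e S, x = a + M.ι (e i) * c := by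
  induction hx using Algebra.adjoin_induction with
  | mem x hx =>
    obtain ⟨j, hj, rfl⟩ := hx
    rcases hj with rfl | hj
    · exact ⟨0, zero_mem _, 1, one_mem _, by simp⟩
    · exact ⟨_, Algebra.subset_adjoin ⟨j, hj, rfl⟩, 0, zero_mem _, by simp⟩
  | algebraMap r => exact ⟨_, Subalgebra.algebraMap_mem _ r, 0, zero_mem _, by simp⟩
  | add x y _ _ hx hy =>
    obtain ⟨a, ha, c, hc, rfl⟩ := hx
    obtain ⟨a', ha', c', hc', rfl⟩ := hy
    exact ⟨_, add_mem ha ha', _, add_mem hc hc', by rw [mul_add]; abel⟩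
  | mul x y _ _ hx hy =>
    obtain ⟨a, ha, c, hc, rfl⟩ := hx
    obtain ⟨a', ha', c', hc', rfl⟩ := hy
    refine ⟨a * a' + algebraMap K C (M.form (e i) (e i) / 2) * (M.inv c * c'),
      add_mem (mul_mem ha ha') (mul_mem (Subalgebra.algebraMap_mem _ _)
        (mul_mem (inv_mem_sub hc) hc')), M.inv a * c' + c * a',
      add_mem (mul_mem (inv_mem_sub ha) hc') (mul_mem hc ha'), ?_⟩
    have h1 : a * (M.ι (e i) * c') = M.ι (e i) * (M.inv a * c') := by
      rw [← mul_assoc, sub_mul_ι he hi ha, mul_assoc]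
    have h2 : M.ι (e i) * c * (M.ι (e i) * c') =
        algebraMap K C (M.form (e i) (e i) / 2) * (M.inv c * c') := by
      rw [← M.ι_sq, mul_assoc, ← mul_assoc c, sub_mul_ι he hi hc]
      simp only [mul_assoc]
    rw [add_mul, mul_add, mul_add, h1, h2, mul_add]
    simp only [mul_assoc]
    abel

theorem mem_sub_of_commute (he : M.IsFrame e) {S : Set I} {i : I} (hi : i ∉ S) {z : C}
    (hz : z ∈ M.sub e (insert i S)) (heven : M.inv z = z) (hcomm : Commute z (M.ι (e i))) :
    z ∈ M.sub e S := by
  obtain ⟨a, ha, c, hc, hx⟩ := exists_decomp he hi hz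
  have h2 : (2 : K) ≠ 0 := by norm_num
  have hinv : ∀ x ∈ M.sub e S, M.inv (M.inv x) = x := by
    intro x hx
    induction hx using Algebra.adjoin_induction with
    | mem x hx => obtain ⟨j, hj, rfl⟩ := hx; simp [M.inv_ι]
    | algebraMap r => simp
    | add x y _ _ hx hy => rw [map_add, map_add, hx, hy]
    | mul x y _ _ hx hy => rw [map_mul, map_mul, hx, hy]
  have hz2 : (2 : K) • z = (a + M.inv a) + M.ι (e i) * (c - M.inv c) := by
    have h3 : z + M.inv z = (2 : K) • z := by rw [heven, two_smul]
    rw [← h3, hx, map_add, map_mul, M.inv_ι, mul_sub]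
    rw [neg_mul]
    abel
  have hE : (a + M.inv a) * M.ι (e i) = M.ι (e i) * (a + M.inv a) := by
    rw [sub_mul_ι he hi (add_mem ha (inv_mem_sub ha)), map_add, hinv a ha, add_comm (M.inv a)]
  have hO : (c - M.inv c) * M.ι (e i) = -(M.ι (e i) * (c - M.inv c)) := by
    rw [sub_mul_ι he hi (sub_mem hc (inv_mem_sub hc)), map_sub, hinv c hc, ← mul_neg, neg_sub]
  have hc2 : ((2 : K) • z) * M.ι (e i) = M.ι (e i) * ((2 : K) • z) := by
    rw [smul_mul_assoc, hcomm.eq, mul_smul_comm]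
  rw [hz2, add_mul, mul_add, hE, mul_assoc, hO, mul_neg] at hc2
  have h5 := add_left_cancel hc2
  have h6 : M.ι (e i) * (M.ι (e i) * (c - M.inv c)) = 0 := by
    have : (2 : K) • (M.ι (e i) * (M.ι (e i) * (c - M.inv c))) = 0 := by
      rw [two_smul]
      nth_rewrite 1 [← h5]
      simp
    exact (smul_eq_zero.1 this).resolve_left h2
  have hd : M.form (e i) (e i) / 2 ≠ 0 := div_ne_zero (he.norm_ne_zero i) h2
  have h7 : c - M.inv c = 0 := by
    rw [← mul_assoc, M.ι_sq, ← Algebra.smul_def] at h6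
    exact (smul_eq_zero.1 h6).resolve_left hd
  rw [h7, mul_zero, add_zero] at hz2
  rw [← inv_smul_smul₀ h2 z, hz2]
  exact Subalgebra.smul_mem _ (add_mem ha (inv_mem_sub ha)) _

/-- The even centre of the Clifford algebra consists of scalars. -/
theorem exists_algebraMap_eq [Finite I] (he : M.IsFrame e) {z : C} (heven : M.inv z = z)
    (hcomm : ∀ i, Commute z (M.ι (e i))) : ∃ r : K, z = algebraMap K C r := by
  classical
  cases nonempty_fintype I
  have key : ∀ S : Finset I, z ∈ M.sub e S → ∃ r : K, z = algebraMap K C r := by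
    intro S
    induction S using Finset.induction_on with
    | empty =>
      intro hz
      rw [sub, Finset.coe_empty, Set.image_empty, Algebra.adjoin_empty, Algebra.mem_bot] at hz
      obtain ⟨r, hr⟩ := hz
      exact ⟨r, hr.symm⟩
    | insert i S hi ih =>
      intro hz
      rw [Finset.coe_insert] at hz
      exact ih (mem_sub_of_commute he (by simpa using hi) hz heven (hcomm i))
  apply key Finset.univ
  have h1 : M.sub e (Finset.univ : Finset I) = ⊤ := by
    rw [eq_top_iff, ← M.adjoin_ι]
    apply Algebra.adjoin_le
    rintro _ ⟨u, rfl⟩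
    have hu : u ∈ Submodule.span K (Set.range e) := by rw [he.span]; trivial
    induction hu using Submodule.span_induction with
    | mem x hx => obtain ⟨j, rfl⟩ := hx; exact Algebra.subset_adjoin ⟨j, by simp, rfl⟩
    | zero => rw [map_zero]; exact zero_mem _
    | add x y _ _ hx hy => rw [map_add]; exact add_mem hx hy
    | smul r x _ hx => rw [map_smul]; exact Subalgebra.smul_mem _ hx r
  rw [h1]
  trivial

end Center

section Versor

/-- The homogeneous elements of the Clifford group. -/
structure IsVersor (h : Cˣ) : Prop where
  parity : M.inv h = h ∨ M.inv h = -h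
  norm : ∃ r : K, r ≠ 0 ∧ M.rev h * h = algebraMap K C r ∧ h * M.rev h = algebraMap K C r
  conj : ∀ u, ∃ u', (h : C) * M.ι u * (↑h⁻¹ : C) = M.ι u'
  conj_inv : ∀ u, ∃ u', (↑h⁻¹ : C) * M.ι u * (h : C) = M.ι u'

theorem isVersor_one : M.IsVersor 1 where
  parity := Or.inl (by simp)
  norm := ⟨1, one_ne_zero, by simp [M.rev_one], by simp [M.rev_one]⟩
  conj u := ⟨u, by simp⟩
  conj_inv u := ⟨u, by simp⟩

variable {M}

theorem IsVersor.mul {g h : Cˣ} (hg : M.IsVersor g) (hh : M.IsVersor h) : M.IsVersor (g * h) where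
  parity := by
    rw [Units.val_mul, map_mul]
    rcases hg.parity with h1 | h1 <;> rcases hh.parity with h2 | h2 <;> simp [h1, h2]
  norm := by
    obtain ⟨r, hr, h1, h2⟩ := hg.norm
    obtain ⟨s, hs, h3, h4⟩ := hh.norm
    refine ⟨r * s, mul_ne_zero hr hs, ?_, ?_⟩
    · rw [Units.val_mul, M.rev_mul, mul_assoc, ← mul_assoc _ (g : C), h1, ← Algebra.smul_def,
        mul_smul_comm, h3, Algebra.smul_def, map_mul]
    · rw [Units.val_mul, M.rev_mul, mul_assoc, ← mul_assoc (h : C), h4, ← Algebra.smul_def,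
        mul_smul_comm, h2, Algebra.smul_def, ← map_mul, mul_comm]
  conj u := by
    obtain ⟨u', h1⟩ := hh.conj u
    obtain ⟨u'', h2⟩ := hg.conj u'
    refine ⟨u'', ?_⟩
    rw [← h2, ← h1, mul_inv_rev, Units.val_mul, Units.val_mul]
    simp only [mul_assoc]
  conj_inv u := by
    obtain ⟨u', h1⟩ := hg.conj_inv u
    obtain ⟨u'', h2⟩ := hh.conj_inv u'
    refine ⟨u'', ?_⟩
    rw [← h2, ← h1, mul_inv_rev, Units.val_mul, Units.val_mul]
    simp only [mul_assoc]

/-- An anisotropic vector as a unit of the Clifford algebra. -/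
def vecUnit {w : U} (hw : M.form w w ≠ 0) : Cˣ where
  val := M.ι w
  inv := (M.form w w / 2)⁻¹ • M.ι w
  val_inv := by
    rw [mul_smul_comm, M.ι_sq, Algebra.smul_def, ← map_mul, inv_mul_cancel₀, map_one]
    exact div_ne_zero hw (by norm_num)
  inv_val := by
    rw [smul_mul_assoc, M.ι_sq, Algebra.smul_def, ← map_mul, inv_mul_cancel₀, map_one]
    exact div_ne_zero hw (by norm_num)

theorem vecUnit_conj {w : U} (hw : M.form w w ≠ 0) (u : U) :
    (vecUnit hw : C) * M.ι u * (↑(vecUnit hw)⁻¹ : C) =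
      M.ι ((M.form w u / (M.form w w / 2)) • w - u) := by
  have h2 : M.form w w / 2 ≠ 0 := div_ne_zero hw (by norm_num)
  change M.ι w * M.ι u * ((M.form w w / 2)⁻¹ • M.ι w) = _
  have h1 : M.ι w * M.ι u = algebraMap K C (M.form w u) - M.ι u * M.ι w :=
    eq_sub_of_add_eq (M.ι_swap w u)
  rw [h1, mul_smul_comm, sub_mul, mul_assoc, M.ι_sq, ← Algebra.commutes, ← Algebra.smul_def,
    ← Algebra.smul_def, smul_sub, smul_smul, smul_smul, inv_mul_cancel₀ h2, one_smul, map_sub,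
    map_smul, div_eq_inv_mul (M.form w u)]

theorem isVersor_vecUnit {w : U} (hw : M.form w w ≠ 0) : M.IsVersor (vecUnit hw) where
  parity := Or.inr (M.inv_ι w)
  norm := by
    refine ⟨M.form w w / 2, div_ne_zero hw (by norm_num), ?_, ?_⟩
    · change M.rev (M.ι w) * M.ι w = _
      rw [M.rev_ι, M.ι_sq]
    · change M.ι w * M.rev (M.ι w) = _
      rw [M.rev_ι, M.ι_sq]
  conj u := ⟨_, vecUnit_conj hw u⟩
  conj_inv u := by
    have h2 : M.form w w / 2 ≠ 0 := div_ne_zero hw (by norm_num)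
    refine ⟨_, Eq.trans ?_ (vecUnit_conj hw u)⟩
    change ((M.form w w / 2)⁻¹ • M.ι w) * M.ι u * M.ι w =
      M.ι w * M.ι u * ((M.form w w / 2)⁻¹ • M.ι w)
    rw [smul_mul_assoc, smul_mul_assoc, mul_smul_comm]

theorem form_eq_of_conj {h : Cˣ} {u u' w w' : U} (h1 : (h : C) * M.ι u * (↑h⁻¹ : C) = M.ι u')
    (h2 : (h : C) * M.ι w * (↑h⁻¹ : C) = M.ι w') : M.form u' w' = M.form u w := by
  apply (algebraMap K C).injective
  rw [← M.ι_swap, ← h1, ← h2]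
  have h3 : ∀ x y : C, (h : C) * x * (↑h⁻¹ : C) * ((h : C) * y * (↑h⁻¹ : C)) =
      (h : C) * (x * y) * (↑h⁻¹ : C) := by
    intro x y
    simp only [mul_assoc, Units.inv_mul_cancel_left]
  rw [h3, h3, ← add_mul, ← mul_add, M.ι_swap, ← Algebra.commutes, mul_assoc, Units.mul_inv, mul_one]

/-- Two orthogonal families with the same norms are conjugate, up to signs, under the Clifford
group. -/
theorem exists_versor_conj {n : ℕ} {x y : Fin n → U}
    (hx : ∀ i j, i ≠ j → M.form (x i) (x j) = 0) (hy : ∀ i j, i ≠ j → M.form (y i) (y j) = 0)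
    (hxy : ∀ i, M.form (x i) (x i) = M.form (y i) (y i)) (h0 : ∀ i, M.form (y i) (y i) ≠ 0) :
    ∃ h : Cˣ, M.IsVersor h ∧ ∀ i, (h : C) * M.ι (x i) * (↑h⁻¹ : C) = M.ι (y i) ∨
      (h : C) * M.ι (x i) * (↑h⁻¹ : C) = -M.ι (y i) := by
  have key : ∀ k : ℕ, k ≤ n → ∃ h : Cˣ, M.IsVersor h ∧ ∀ i : Fin n, (i : ℕ) < k →
      ((h : C) * M.ι (x i) * (↑h⁻¹ : C) = M.ι (y i) ∨
        (h : C) * M.ι (x i) * (↑h⁻¹ : C) = -M.ι (y i)) := by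
    intro k
    induction k with
    | zero => exact fun _ => ⟨1, M.isVersor_one, fun i hi => absurd hi (by omega)⟩
    | succ k ih =>
      intro hk
      obtain ⟨h, hh, hi⟩ := ih (by omega)
      let m : Fin n := ⟨k, by omega⟩
      obtain ⟨x', hx'⟩ := hh.conj (x m)
      have hnorm : M.form x' x' = M.form (y m) (y m) := by
        rw [form_eq_of_conj hx' hx', hxy]
      have horth : ∀ i : Fin n, (i : ℕ) < k → M.form x' (y i) = 0 := by
        intro i hik
        have hne : m ≠ i := by rintro rfl; exact absurd hik (by simp [m])
        rcases hi i hik with h1 | h1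
        · rw [form_eq_of_conj hx' h1, hx m i hne]
        · rw [← map_neg] at h1
          have := form_eq_of_conj hx' h1
          rwa [hx m i hne, map_neg, neg_eq_zero] at this
      have hsum : M.form (x' - y m) (x' - y m) + M.form (x' + y m) (x' + y m) =
          4 * M.form (y m) (y m) := by
        simp only [map_add, map_sub, LinearMap.add_apply, LinearMap.sub_apply, hnorm]
        ring
      have hw : ∃ (w : U) (s : K), (s = 1 ∨ s = -1) ∧ w = x' - s • y m ∧ M.form w w ≠ 0 := by
        by_cases h3 : M.form (x' - y m) (x' - y m) = 0
        · refine ⟨x' + y m, -1, Or.inr rfl, by simp, fun h4 => ?_⟩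
          rw [h3, h4, add_zero] at hsum
          exact mul_ne_zero (by norm_num) (h0 m) hsum.symm
        · exact ⟨x' - y m, 1, Or.inl rfl, by simp, h3⟩
      obtain ⟨w, s, hs, hwe, hw0⟩ := hw
      have hs2 : s * s = 1 := by rcases hs with rfl | rfl <;> ring
      have hconj : ∀ z z' : U, (h : C) * M.ι z * (↑h⁻¹ : C) = M.ι z' →
          ((vecUnit hw0 * h : Cˣ) : C) * M.ι z * (↑(vecUnit hw0 * h)⁻¹ : C) =
            M.ι ((M.form w z' / (M.form w w / 2)) • w - z') := by
        intro z z' hz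
        rw [← vecUnit_conj hw0, ← hz, mul_inv_rev, Units.val_mul, Units.val_mul]
        simp only [mul_assoc]
      refine ⟨vecUnit hw0 * h, (isVersor_vecUnit hw0).mul hh, fun i hik => ?_⟩
      rcases Nat.lt_succ_iff_lt_or_eq.1 hik with hlt | heq
      · have hne : m ≠ i := by rintro rfl; exact absurd hlt (by simp [m])
        have h5 : M.form w (y i) = 0 := by
          rw [hwe, map_sub, LinearMap.sub_apply, horth i hlt, map_smul, LinearMap.smul_apply,
            hy m i hne]
          simp
        rcases hi i hlt with h1 | h1
        · right
          rw [hconj _ _ h1, h5]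
          simp
        · left
          rw [← map_neg] at h1
          rw [hconj _ _ h1, map_neg, h5]
          simp
      · have him : i = m := Fin.ext heq
        subst him
        have h6 : M.form w x' = M.form w w / 2 := by
          have hcm := M.form_comm (y m) x'
          rw [hwe]
          simp only [map_sub, map_smul, LinearMap.sub_apply, LinearMap.smul_apply, smul_eq_mul,
            hcm, ← hnorm]
          linear_combination (-(1 / 2 : K) * M.form x' x') * hs2
        have h7 := hconj _ _ hx'
        rw [h6, div_self (div_ne_zero hw0 (by norm_num)), one_smul] at h7
        have h8 : w - x' = -(s • y m) := by rw [hwe]; abel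
        rw [h7, h8]
        rcases hs with rfl | rfl
        · right; simp
        · left; simp
  obtain ⟨h, hh, hi⟩ := key n le_rfl
  exact ⟨h, hh, fun i => hi i i.2⟩

end Versor

section Volume

variable {I : Type*} (e : I → U)

/-- The product of the vectors of a family, in the order of a list. -/
def vol (l : List I) : C := (l.map fun i => M.ι (e i)).prod

variable {e}

theorem vol_cons (i : I) (l : List I) : M.vol e (i :: l) = M.ι (e i) * M.vol e l := by
  simp [vol]

variable {M}

theorem vol_mul_ι_of_notMem (he : M.IsFrame e) {i : I} {l : List I} (hi : i ∉ l) :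
    M.vol e l * M.ι (e i) = (-1 : K) ^ l.length • (M.ι (e i) * M.vol e l) := by
  induction l with
  | nil => simp [vol]
  | cons j l ih =>
    rw [List.mem_cons, not_or] at hi
    rw [vol_cons, mul_assoc, ih hi.2, mul_smul_comm, ← mul_assoc,
      M.ι_anticomm (he.ortho j i (Ne.symm hi.1)), List.length_cons, pow_succ, mul_smul, neg_smul,
      one_smul, neg_mul, mul_assoc]

theorem vol_mul_ι_of_mem (he : M.IsFrame e) {i : I} {l : List I} (hl : l.Nodup) (hi : i ∈ l) :
    M.vol e l * M.ι (e i) = (-1 : K) ^ (l.length + 1) • (M.ι (e i) * M.vol e l) := by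
  induction l with
  | nil => simp at hi
  | cons j l ih =>
    rw [List.nodup_cons] at hl
    rw [vol_cons, mul_assoc, List.length_cons]
    by_cases hij : i = j
    · subst hij
      rw [vol_mul_ι_of_notMem he hl.1, mul_smul_comm, pow_add, pow_add]
      simp
    · rw [ih hl.2 ((List.mem_cons.1 hi).resolve_left hij), mul_smul_comm, ← mul_assoc,
        M.ι_anticomm (he.ortho j i (Ne.symm hij)), pow_succ _ (l.length + 1), mul_smul, neg_smul,
        one_smul, neg_mul, mul_assoc]

theorem inv_vol (l : List I) : M.inv (M.vol e l) = (-1 : K) ^ l.length • M.vol e l := by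
  induction l with
  | nil => simp [vol]
  | cons j l ih =>
    rw [vol_cons, map_mul, ih, M.inv_ι, List.length_cons, pow_succ, mul_smul, mul_smul_comm]
    simp

theorem rev_vol_mul (l : List I) : M.rev (M.vol e l) * M.vol e l =
    algebraMap K C (l.map fun i => M.form (e i) (e i) / 2).prod := by
  induction l with
  | nil => simp [vol, M.rev_one]
  | cons j l ih =>
    rw [vol_cons, M.rev_mul, M.rev_ι, mul_assoc, ← mul_assoc (M.ι (e j)), M.ι_sq,
      ← Algebra.smul_def, mul_smul_comm, ih, List.map_cons, List.prod_cons, map_mul,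
      Algebra.smul_def]

theorem vol_ne_zero (he : M.IsFrame e) (l : List I) : M.vol e l ≠ 0 := by
  intro h
  have h1 := M.rev_vol_mul (e := e) l
  rw [h, mul_zero] at h1
  have h2 := (algebraMap K C).injective (h1.symm.trans (map_zero _).symm)
  rw [List.prod_eq_zero_iff, List.mem_map] at h2
  obtain ⟨i, -, hi⟩ := h2
  exact div_ne_zero (he.norm_ne_zero i) two_ne_zero hi

end Volume

section TwoVolumes

variable {M} {n : ℕ} {e v : Fin n → U}

theorem volume_mul_ι (he : M.IsFrame e) (u : U) : M.vol e (List.finRange n) * M.ι u =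
    (-1 : K) ^ (n + 1) • (M.ι u * M.vol e (List.finRange n)) := by
  refine forall_of_span he.span (f := (LinearMap.mulLeft K _).comp M.ι)
    (g := (-1 : K) ^ (n + 1) • (LinearMap.mulRight K _).comp M.ι) (fun i => ?_) u
  have := vol_mul_ι_of_mem he (List.nodup_finRange n) (List.mem_finRange i)
  rw [List.length_finRange] at this
  simpa using this

theorem volume_commute (he : M.IsFrame e) {b : C} (hb : M.inv b = b) :
    Commute (M.vol e (List.finRange n)) b := by
  rcases neg_one_pow_eq_or K (n + 1) with h | h
  · apply M.commute_of_commute_ι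
    intro u
    have := volume_mul_ι he u
    rwa [h, one_smul] at this
  · have := M.twisted_commute (z := M.vol e (List.finRange n)) (fun u => by
      have := volume_mul_ι he u
      rwa [h, neg_smul, one_smul] at this) b
    rw [hb] at this
    exact this

theorem exists_volume_mul_volume (he : M.IsFrame e) (hv : M.IsFrame v) :
    ∃ r : K, M.vol e (List.finRange n) * M.vol v (List.finRange n) = algebraMap K C r := by
  have hs : ((-1 : K) ^ n) * ((-1 : K) ^ n) = 1 := by
    rw [← mul_pow]; simp
  have hs' : ((-1 : K) ^ (n + 1)) * ((-1 : K) ^ (n + 1)) = 1 := by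
    rw [← mul_pow]; simp
  apply exists_algebraMap_eq he
  · rw [map_mul, inv_vol, inv_vol, List.length_finRange, smul_mul_smul_comm, hs, one_smul]
  · intro i
    rw [Commute, SemiconjBy, mul_assoc, volume_mul_ι hv, mul_smul_comm, ← mul_assoc, volume_mul_ι he,
      smul_mul_assoc, smul_smul, hs', one_smul, mul_assoc]

/-- The volume elements of two frames are proportional. -/
theorem exists_volume_eq_smul (he : M.IsFrame e) (hv : M.IsFrame v) :
    ∃ r : K, M.vol v (List.finRange n) = r • M.vol e (List.finRange n) := by
  obtain ⟨r, hr⟩ := exists_volume_mul_volume he hv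
  obtain ⟨s, hs⟩ := exists_volume_mul_volume he he
  have hee := M.rev_vol_mul (e := e) (List.finRange n)
  set d := (List.map (fun i => M.form (e i) (e i) / 2) (List.finRange n)).prod with hd
  have hd0 : d ≠ 0 := by
    rw [hd, Ne, List.prod_eq_zero_iff, List.mem_map]
    rintro ⟨i, -, hi⟩
    exact div_ne_zero (he.norm_ne_zero i) two_ne_zero hi
  have h1 : d • M.vol v (List.finRange n) = r • M.rev (M.vol e (List.finRange n)) := by
    rw [Algebra.smul_def, ← hee, mul_assoc, hr, ← Algebra.commutes, ← Algebra.smul_def]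
  have h2 : d • M.vol e (List.finRange n) = s • M.rev (M.vol e (List.finRange n)) := by
    rw [Algebra.smul_def, ← hee, mul_assoc, hs, ← Algebra.commutes, ← Algebra.smul_def]
  have hs0 : s ≠ 0 := by
    rintro rfl
    rw [zero_smul] at h2
    exact vol_ne_zero he _ ((smul_eq_zero.1 h2).resolve_left hd0)
  refine ⟨r / s, ?_⟩
  have h3 : M.rev (M.vol e (List.finRange n)) = s⁻¹ • d • M.vol e (List.finRange n) := by
    rw [h2, inv_smul_smul₀ hs0]
  rw [h3] at h1
  have h4 := congrArg (fun x => d⁻¹ • x) h1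
  simp only [inv_smul_smul₀ hd0] at h4
  rw [h4]
  simp only [smul_smul]
  congr 1
  field_simp

end TwoVolumes

end CliffordModel

end Clifford

section Model

variable {p : ℕ} [Fact p.Prime] {V : Type*} [AddCommGroup V] [Module ℚ_[p] V]
  (Q : QuadraticForm ℚ_[p] V)

theorem incl_tmul (a : BreveQp p) (x : V) :
    incl Q (a ⊗ₜ[ℚ_[p]] x) = a ⊗ₜ[ℚ_[p]] CliffordAlgebra.ι Q x := rfl

theorem formBreve_tmul (a b : BreveQp p) (x y : V) :
    formBreve Q (a ⊗ₜ[ℚ_[p]] x) (b ⊗ₜ[ℚ_[p]] y) =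
      algebraMap ℚ_[p] (BreveQp p) (QuadraticMap.polar Q x y) * (a * b) := by
  rw [formBreve, LinearMap.BilinForm.baseChange_tmul, Algebra.smul_def]
  rfl

/-- The grade involution of `C(V_{ℚ̆_p})`. -/
def gradeInv : CBreve Q →ₐ[BreveQp p] CBreve Q :=
  Algebra.TensorProduct.map (AlgHom.id (BreveQp p) (BreveQp p)) CliffordAlgebra.involute

/-- `C(V_{ℚ̆_p})` as the Clifford algebra of `V_{ℚ̆_p}`. -/
def cliffordModel : CliffordModel (BreveQp p) (VBreve p V) (CBreve Q) where
  ι := incl Q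
  form := formBreve Q
  inv := gradeInv Q
  rev := rev Q
  ι_swap x y := by
    induction x using TensorProduct.induction_on with
    | zero => simp
    | add x x' hx hx' =>
      rw [map_add, map_add, LinearMap.add_apply, map_add, add_mul, mul_add, ← hx, ← hx']
      abel
    | tmul a x =>
      induction y using TensorProduct.induction_on with
      | zero => simp
      | add y y' hy hy' =>
        rw [map_add, map_add, map_add, add_mul, mul_add, ← hy, ← hy']
        abel
      | tmul b y =>
        rw [incl_tmul, incl_tmul, Algebra.TensorProduct.tmul_mul_tmul,
          Algebra.TensorProduct.tmul_mul_tmul, mul_comm b a, ← TensorProduct.tmul_add,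
          CliffordAlgebra.ι_mul_ι_add_swap, formBreve_tmul, Algebra.TensorProduct.algebraMap_apply,
          Algebra.algebraMap_eq_smul_one, TensorProduct.tmul_smul, ← Algebra.smul_def]
        rfl
  adjoin_ι := by
    rw [eq_top_iff]
    rintro x -
    induction x using TensorProduct.induction_on with
    | zero => exact zero_mem _
    | add x y hx hy => exact add_mem hx hy
    | tmul a c =>
      have h1 : a ⊗ₜ[ℚ_[p]] c = a • ((1 : BreveQp p) ⊗ₜ[ℚ_[p]] c) := by
        rw [TensorProduct.smul_tmul', smul_eq_mul, mul_one]
      rw [h1]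
      apply Subalgebra.smul_mem
      clear h1
      induction c using CliffordAlgebra.induction with
      | algebraMap r =>
        rw [Algebra.algebraMap_eq_smul_one, TensorProduct.tmul_smul, TensorProduct.smul_tmul']
        have : ((r • (1 : BreveQp p)) ⊗ₜ[ℚ_[p]] (1 : CliffordAlgebra Q)) =
          algebraMap (BreveQp p) (CBreve Q) (r • 1) := rfl
        rw [this]
        exact Subalgebra.algebraMap_mem _ _
      | ι x => exact Algebra.subset_adjoin ⟨(1 : BreveQp p) ⊗ₜ x, rfl⟩
      | mul x y hx hy =>
        have := mul_mem hx hy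
        rwa [Algebra.TensorProduct.tmul_mul_tmul, one_mul] at this
      | add x y hx hy =>
        rw [TensorProduct.tmul_add]
        exact add_mem hx hy
  inv_ι x := by
    induction x using TensorProduct.induction_on with
    | zero => simp
    | add x y hx hy => rw [map_add, map_add, hx, hy, neg_add]
    | tmul a x =>
      rw [incl_tmul, gradeInv, Algebra.TensorProduct.map_tmul, CliffordAlgebra.involute_ι,
        TensorProduct.tmul_neg]
      rfl
  rev_ι x := by
    induction x using TensorProduct.induction_on with
    | zero => simp
    | add x y hx hy => rw [map_add, map_add, hx, hy]
    | tmul a x => rw [incl_tmul, rev, LinearMap.baseChange_tmul, CliffordAlgebra.reverse_ι]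
  rev_one := by
    rw [Algebra.TensorProduct.one_def, rev, LinearMap.baseChange_tmul, CliffordAlgebra.reverse.map_one]
  rev_mul x y := by
    induction x using TensorProduct.induction_on with
    | zero => simp
    | add x x' hx hx' => rw [add_mul, map_add, map_add, mul_add, hx, hx']
    | tmul a x =>
      induction y using TensorProduct.induction_on with
      | zero => simp
      | add y y' hy hy' => rw [mul_add, map_add, map_add, add_mul, hy, hy']
      | tmul b y =>
        rw [Algebra.TensorProduct.tmul_mul_tmul, rev, LinearMap.baseChange_tmul,
          LinearMap.baseChange_tmul, LinearMap.baseChange_tmul, CliffordAlgebra.reverse.map_mul,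
          Algebra.TensorProduct.tmul_mul_tmul, mul_comm]

theorem gradeInv_eq_of_even {x : CBreve Q}
    (hx : x ∈ (CliffordAlgebra.evenOdd Q 0).baseChange (BreveQp p)) :
    (cliffordModel Q).inv x = x := by
  obtain ⟨y, rfl⟩ := hx
  induction y using TensorProduct.induction_on with
  | zero => simp
  | add x y hx hy => rw [map_add, map_add, hx, hy]
  | tmul a x =>
    rw [LinearMap.baseChange_tmul]
    change gradeInv Q _ = _
    rw [gradeInv, Algebra.TensorProduct.map_tmul]
    congr 1
    exact CliffordAlgebra.involute_eq_of_mem_even x.2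

theorem sigmaC_tmul (a : BreveQp p) (x : CliffordAlgebra Q) :
    sigmaC Q (a ⊗ₜ x) = sigma p a ⊗ₜ x := by
  rw [sigmaC, Algebra.TensorProduct.map_tmul]; rfl

theorem sigmaC_smul (a : BreveQp p) (x : CBreve Q) :
    sigmaC Q (a • x) = sigma p a • sigmaC Q x := by
  rw [Algebra.smul_def, map_mul, Algebra.smul_def]
  congr 1

theorem sigmaC_algebraMap (a : BreveQp p) :
    sigmaC Q (algebraMap (BreveQp p) (CBreve Q) a) = algebraMap (BreveQp p) (CBreve Q) (sigma p a) :=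
  sigmaC_tmul Q a 1

/-- The Frobenius of `V_{ℚ̆_p}`. -/
def sigmaV (p : ℕ) [Fact p.Prime] (V : Type*) [AddCommGroup V] [Module ℚ_[p] V] :
    VBreve p V →ₗ[ℚ_[p]] VBreve p V :=
  (sigma p).toLinearMap.rTensor V

theorem sigmaV_tmul (a : BreveQp p) (x : V) : sigmaV p V (a ⊗ₜ x) = sigma p a ⊗ₜ x := rfl

theorem sigmaC_incl (u : VBreve p V) : sigmaC Q (incl Q u) = incl Q (sigmaV p V u) := by
  induction u using TensorProduct.induction_on with
  | zero => simp
  | add x y hx hy => simp only [map_add, hx, hy]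
  | tmul a x => rw [incl_tmul, sigmaC_tmul, sigmaV_tmul, incl_tmul]

theorem formBreve_sigmaV (x y : VBreve p V) :
    formBreve Q (sigmaV p V x) (sigmaV p V y) = sigma p (formBreve Q x y) := by
  induction x using TensorProduct.induction_on with
  | zero => simp
  | add x x' hx hx' => simp only [map_add, LinearMap.add_apply, hx, hx']
  | tmul a x =>
    induction y using TensorProduct.induction_on with
    | zero => simp
    | add y y' hy hy' => simp only [map_add, hy, hy']
    | tmul b y => rw [sigmaV_tmul, sigmaV_tmul, formBreve_tmul, formBreve_tmul, map_mul, map_mul,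
        AlgHom.commutes]

theorem rev_sigmaC (x : CBreve Q) : rev Q (sigmaC Q x) = sigmaC Q (rev Q x) := by
  induction x using TensorProduct.induction_on with
  | zero => simp
  | add x y hx hy => simp only [map_add, hx, hy]
  | tmul a x => rw [sigmaC_tmul, rev, LinearMap.baseChange_tmul, LinearMap.baseChange_tmul,
      sigmaC_tmul]

theorem gradeInv_sigmaC (x : CBreve Q) : gradeInv Q (sigmaC Q x) = sigmaC Q (gradeInv Q x) := by
  induction x using TensorProduct.induction_on with
  | zero => simp
  | add x y hx hy => simp only [map_add, hx, hy]
  | tmul a x =>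
    rw [sigmaC_tmul, gradeInv, Algebra.TensorProduct.map_tmul, Algebra.TensorProduct.map_tmul,
      sigmaC_tmul]
    rfl

end Model

section Frame

variable {K U C : Type*} [Field K] [AddCommGroup U] [Module K U] [Ring C]
  [Algebra K C] {M : CliffordModel K U C} {I : Type*} {e : I → U}

theorem CliffordModel.IsFrame.eq_zero [Finite I] (he : M.IsFrame e) {u : U}
    (h : ∀ i, M.form u (e i) = 0) : u = 0 := by
  classical
  cases nonempty_fintype I
  have hu : u ∈ Submodule.span K (Set.range e) := by rw [he.span]; trivial
  obtain ⟨c, rfl⟩ := (Submodule.mem_span_range_iff_exists_fun K).1 hu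
  apply Finset.sum_eq_zero
  intro i _
  have h1 := h i
  rw [map_sum, LinearMap.sum_apply, Finset.sum_eq_single i] at h1
  · rw [map_smul, LinearMap.smul_apply, smul_eq_mul] at h1
    rw [(mul_eq_zero.1 h1).resolve_right (he.norm_ne_zero i), zero_smul]
  · intro j _ hj
    rw [map_smul, LinearMap.smul_apply, he.ortho j i hj, smul_zero]
  · simp

theorem CliffordModel.IsFrame.ι_injective [CharZero K] [Nontrivial C] [Finite I] (he : M.IsFrame e) :
    Function.Injective M.ι :=
  M.ι_injective_of_nondegenerate fun _ h => he.eq_zero fun i => h (e i)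

end Frame

section Descent

variable {K U : Type*} [Field K] [AddCommGroup U] [Module K U] [FiniteDimensional K U]

/-- Coordinates compatible with a Frobenius give a basis of fixed vectors. -/
theorem exists_fixed_basis_of_functionals (s : K →+* K) (Φ : U → U) {J : Type*}
    (l : J → Dual K U) (hl : ∀ u, (∀ j, l j u = 0) → u = 0)
    (hΦ : ∀ j u, l j (Φ u) = s (l j u)) :
    Submodule.span K {u | Φ u = u} = ⊤ := by
  classical
  have hspan : ⊤ ≤ Submodule.span K (Set.range l) := by
    by_contra hne
    obtain ⟨f, hf, hle⟩ := Submodule.exists_le_ker_of_lt_top _ (lt_top_iff_ne_top.2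
      fun h => hne h.ge)
    apply hf
    obtain ⟨u, rfl⟩ := (Module.evalEquiv K U).surjective f
    rw [hl u, map_zero]
    intro j
    have := hle (Submodule.subset_span ⟨j, rfl⟩)
    simpa using this
  let β := Basis.ofSpan hspan
  have : Finite ((linearIndepOn_empty K id).extend (Set.empty_subset (Set.range l)) : Set (Dual K U)) :=
    Module.Finite.finite_basis β
  let v := β.dualBasis.map (Module.evalEquiv K U).symm
  have hv : ∀ i k, β i (v k) = if i = k then 1 else 0 := by
    intro i k
    have h1 : β i (v k) = Module.evalEquiv K U (v k) (β i) := by simp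
    rw [h1]
    simp only [v, Basis.map_apply, LinearEquiv.apply_symm_apply]
    rw [Basis.dualBasis_apply_self]
  have hβ : ∀ i u, β i (Φ u) = s (β i u) := by
    intro i u
    obtain ⟨j, hj⟩ := Basis.ofSpan_subset hspan ⟨i, rfl⟩
    change l j = β i at hj
    rw [← hj]
    exact hΦ j u
  have hsep : ∀ u w, (∀ i, β i u = β i w) → u = w := by
    intro u w h
    apply (Module.evalEquiv K U).injective
    refine β.ext fun i => ?_
    simpa using h i
  rw [eq_top_iff, ← v.span_eq]
  apply Submodule.span_mono
  rintro _ ⟨k, rfl⟩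
  apply hsep
  intro i
  rw [hβ, hv]
  split <;> simp

end Descent

section Isocrystal

variable {p : ℕ} [Fact p.Prime] {V : Type*} [AddCommGroup V] [Module ℚ_[p] V]
  {Q : QuadraticForm ℚ_[p] V}

/-- The operator `y ↦ b σ(y) b⁻¹` of `C(V_{ℚ̆_p})`. -/
def conjFrob (b : (CBreve Q)ˣ) (y : CBreve Q) : CBreve Q :=
  (b : CBreve Q) * sigmaC Q y * (↑b⁻¹ : CBreve Q)

theorem frobC_mul (b : (CBreve Q)ˣ) (x y : CBreve Q) :
    frobC Q b (x * y) = conjFrob b x * frobC Q b y := by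
  simp only [frobC, conjFrob, map_mul, mul_assoc, Units.inv_mul_cancel_left]

theorem frobC_iterate_mul (b : (CBreve Q)ˣ) (t : ℕ) (x y : CBreve Q) :
    (frobC Q b)^[t] (x * y) = (conjFrob b)^[t] x * (frobC Q b)^[t] y := by
  induction t generalizing x y with
  | zero => rfl
  | succ t ih => rw [Function.iterate_succ_apply, frobC_mul, ih]; rfl

theorem frobC_add (b : (CBreve Q)ˣ) (x y : CBreve Q) :
    frobC Q b (x + y) = frobC Q b x + frobC Q b y := by
  simp only [frobC, map_add, mul_add]

theorem frobC_smul (b : (CBreve Q)ˣ) (a : BreveQp p) (x : CBreve Q) :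
    frobC Q b (a • x) = sigma p a • frobC Q b x := by
  simp only [frobC, sigmaC_smul, mul_smul_comm]

theorem frobC_iterate_smul (b : (CBreve Q)ˣ) (t : ℕ) (a : BreveQp p) (x : CBreve Q) :
    (frobC Q b)^[t] (a • x) = (sigma p)^[t] a • (frobC Q b)^[t] x := by
  induction t generalizing a x with
  | zero => rfl
  | succ t ih => rw [Function.iterate_succ_apply, frobC_smul, ih]; rfl

theorem frobC_iterate_sum (b : (CBreve Q)ˣ) (t : ℕ) {J : Type*} (s : Finset J)
    (f : J → CBreve Q) :
    (frobC Q b)^[t] (∑ j ∈ s, f j) = ∑ j ∈ s, (frobC Q b)^[t] (f j) := by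
  let F : CBreve Q →+ CBreve Q := AddMonoidHom.mk' (frobC Q b) (frobC_add b)
  induction t generalizing f with
  | zero => rfl
  | succ t ih =>
    rw [Function.iterate_succ_apply, show frobC Q b (∑ j ∈ s, f j) = ∑ j ∈ s, frobC Q b (f j) from
      map_sum F f s, ih]
    rfl

variable {I : Type*} {e : I → VBreve p V}

/-- Products of two orthogonal anisotropic vectors of `V` lie in `GSpin`. -/
theorem isGSpin_mul {x y : V} (hx : formBreve Q (1 ⊗ₜ x) (1 ⊗ₜ x) ≠ 0)
    (hy : formBreve Q (1 ⊗ₜ y) (1 ⊗ₜ y) ≠ 0) :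
    IsGSpin Q (CliffordModel.vecUnit (M := cliffordModel Q) hx *
      CliffordModel.vecUnit (M := cliffordModel Q) hy) := by
  have hv := (CliffordModel.isVersor_vecUnit (M := cliffordModel Q) hx).mul
    (CliffordModel.isVersor_vecUnit (M := cliffordModel Q) hy)
  refine ⟨?_, ?_, ?_⟩
  · refine ⟨1 ⊗ₜ ⟨CliffordAlgebra.ι Q x * CliffordAlgebra.ι Q y,
      CliffordAlgebra.ι_mul_ι_mem_evenOdd_zero Q x y⟩, ?_⟩
    rw [LinearMap.baseChange_tmul]
    change _ = incl Q (1 ⊗ₜ x) * incl Q (1 ⊗ₜ y)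
    rw [incl_tmul, incl_tmul, Algebra.TensorProduct.tmul_mul_tmul, one_mul]
    rfl
  · intro z
    constructor
    · rintro ⟨u, hu⟩
      obtain ⟨u', hu'⟩ := hv.conj_inv u
      refine ⟨u', hu'.symm.trans ?_⟩
      change _ * incl Q u * _ = _
      rw [hu]
      simp only [mul_assoc, Units.inv_mul_cancel_left, Units.inv_mul, mul_one]
    · rintro ⟨u, rfl⟩
      obtain ⟨u', hu'⟩ := hv.conj u
      exact ⟨u', hu'.symm⟩
  · obtain ⟨r, hr, h1, -⟩ := hv.norm
    exact ⟨Units.mk0 r hr, h1⟩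

end Isocrystal

section FrameOfBasis

variable {p : ℕ} [Fact p.Prime] {V : Type*} [AddCommGroup V] [Module ℚ_[p] V]
  {Q : QuadraticForm ℚ_[p] V} {I : Type*}

/-- An orthogonal family of anisotropic vectors of `V` that spans gives a frame of `V_{ℚ̆_p}`. -/
theorem isFrame_tmul {e : I → V} (ho : ∀ i j, i ≠ j → QuadraticMap.polar Q (e i) (e j) = 0)
    (h0 : ∀ i, Q (e i) ≠ 0) (hs : Submodule.span ℚ_[p] (Set.range e) = ⊤) :
    (cliffordModel Q).IsFrame fun i => (1 : BreveQp p) ⊗ₜ[ℚ_[p]] e i where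
  ortho i j hij := by
    change formBreve Q _ _ = 0
    rw [formBreve_tmul, ho i j hij, map_zero, zero_mul]
  norm_ne_zero i := by
    change formBreve Q _ _ ≠ 0
    rw [formBreve_tmul, mul_one, mul_one, QuadraticMap.polar_self, Ne,
      FaithfulSMul.algebraMap_eq_zero_iff]
    simpa using h0 i
  span := by
    rw [eq_top_iff]
    rintro x -
    induction x using TensorProduct.induction_on with
    | zero => exact zero_mem _
    | add x y hx hy => exact add_mem hx hy
    | tmul a x =>
      have h1 : a ⊗ₜ[ℚ_[p]] x = a • ((1 : BreveQp p) ⊗ₜ[ℚ_[p]] x) := by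
        rw [TensorProduct.smul_tmul', smul_eq_mul, mul_one]
      rw [h1]
      apply Submodule.smul_mem
      have hx : x ∈ Submodule.span ℚ_[p] (Set.range e) := by rw [hs]; trivial
      clear h1
      induction hx using Submodule.span_induction with
      | mem x hx => obtain ⟨j, rfl⟩ := hx; exact Submodule.subset_span ⟨j, rfl⟩
      | zero => rw [TensorProduct.tmul_zero]; exact zero_mem _
      | add x y _ _ hx hy => rw [TensorProduct.tmul_add]; exact add_mem hx hy
      | smul r x _ hx =>
        rw [TensorProduct.tmul_smul, ← algebraMap_smul (BreveQp p) r]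
        exact Submodule.smul_mem _ _ hx

end FrameOfBasis

section Center

variable {p : ℕ} [Fact p.Prime] {V : Type*} [AddCommGroup V] [Module ℚ_[p] V]
  {Q : QuadraticForm ℚ_[p] V} {n : ℕ}

/-- For `n ≥ 3`, the square of an element of the centre of `GSpin(V)` commutes with `V`. -/
theorem commute_sq_of_commute_gspin (hn3 : 3 ≤ n) {e : Fin n → V}
    (he : (cliffordModel Q).IsFrame fun i => (1 : BreveQp p) ⊗ₜ[ℚ_[p]] e i)
    {g : (CBreve Q)ˣ} (hg : IsGSpin Q g) (hc : ∀ h, IsGSpin Q h → Commute g h)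
    (u : VBreve p V) : Commute ((g * g : (CBreve Q)ˣ) : CBreve Q) (incl Q u) := by
  classical
  set M := cliffordModel Q with hM
  set f : Fin n → VBreve p V := fun i => (1 : BreveQp p) ⊗ₜ[ℚ_[p]] e i with hf
  have hpair : ∀ j k, Commute (g : CBreve Q) (M.ι (f j) * M.ι (f k)) := by
    intro j k
    have := hc _ (isGSpin_mul (he.norm_ne_zero j) (he.norm_ne_zero k))
    exact congrArg Units.val this.eq
  have hconj : ∀ i, ∃ w, (g : CBreve Q) * M.ι (f i) * (↑g⁻¹ : CBreve Q) = M.ι w := by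
    intro i
    obtain ⟨w, hw⟩ := (hg.conj_mem (M.ι (f i))).2 ⟨f i, rfl⟩
    exact ⟨w, hw.symm⟩
  have hline : ∀ i, ∃ a : BreveQp p, a * a = 1 ∧
      (g : CBreve Q) * M.ι (f i) * (↑g⁻¹ : CBreve Q) = a • M.ι (f i) := by
    intro i
    obtain ⟨w, hw⟩ := hconj i
    have hwj : ∀ j, j ≠ i → M.form w (f j) = 0 := by
      intro j hji
      obtain ⟨k, hki, hkj⟩ : ∃ k : Fin n, k ≠ i ∧ k ≠ j := by
        have h1 : ({i, j} : Finset (Fin n)).card < Fintype.card (Fin n) := by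
          have := Finset.card_le_two (a := i) (b := j)
          rw [Fintype.card_fin]; omega
        obtain ⟨k, hk⟩ := Finset.exists_mem_notMem_of_card_lt_card (s := {i, j}) (t := Finset.univ) h1
        refine ⟨k, ?_, ?_⟩ <;> rintro rfl <;> simp at hk
      -- `w` commutes with `f j * f k`
      have hcomm0 : Commute (M.ι (f i)) (M.ι (f j) * M.ι (f k)) := by
        rw [Commute, SemiconjBy, ← mul_assoc, M.ι_anticomm (he.ortho i j hji.symm), neg_mul, mul_assoc,
          M.ι_anticomm (he.ortho i k hki.symm), mul_neg, neg_neg, mul_assoc]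
      have hcomm : Commute (M.ι w) (M.ι (f j) * M.ι (f k)) := by
        rw [← hw]
        refine ((hpair j k).mul_left hcomm0).mul_left ?_
        exact (hpair j k).units_inv_left
      have h1 : M.ι w * M.ι (f j) = algebraMap _ _ (M.form w (f j)) - M.ι (f j) * M.ι w :=
        eq_sub_of_add_eq (M.ι_swap _ _)
      have h2 : M.ι w * M.ι (f k) = algebraMap _ _ (M.form w (f k)) - M.ι (f k) * M.ι w :=
        eq_sub_of_add_eq (M.ι_swap _ _)
      have h3 := hcomm.eq
      rw [← mul_assoc, h1, sub_mul, mul_assoc (M.ι (f j)) (M.ι w), h2, mul_sub, ← mul_assoc (M.ι (f j)),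
        ← Algebra.commutes _ (M.ι (f j)), ← Algebra.smul_def, ← Algebra.smul_def, sub_sub_eq_add_sub,
        sub_eq_iff_eq_add, add_comm, add_left_cancel_iff, ← map_smul, ← map_smul] at h3
      have h4 := he.ι_injective h3
      have h5 := congrArg (fun z => M.form z (f k)) h4
      simp only [map_smul, LinearMap.smul_apply, he.ortho j k hkj.symm, smul_eq_mul, mul_zero] at h5
      exact (mul_eq_zero.1 h5).resolve_right (he.norm_ne_zero k)
    have hwi : w = (M.form w (f i) / M.form (f i) (f i)) • f i := by
      rw [← sub_eq_zero]
      apply he.eq_zero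
      intro j
      rw [map_sub, LinearMap.sub_apply, map_smul, LinearMap.smul_apply, smul_eq_mul]
      by_cases hji : j = i
      · subst hji
        rw [div_mul_cancel₀ _ (he.norm_ne_zero j), sub_self]
      · rw [hwj j hji]
        have := he.ortho i j (Ne.symm hji)
        rw [this, mul_zero, sub_zero]
    set a := M.form w (f i) / M.form (f i) (f i) with ha
    have hnorm : M.form w w = M.form (f i) (f i) := CliffordModel.form_eq_of_conj hw hw
    refine ⟨a, ?_, ?_⟩
    · rw [hwi, map_smul, map_smul, LinearMap.smul_apply, smul_eq_mul, smul_eq_mul,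
        ← mul_assoc] at hnorm
      exact mul_right_cancel₀ (he.norm_ne_zero i) (hnorm.trans (one_mul _).symm)
    · rw [hw]
      nth_rewrite 1 [hwi]
      rw [map_smul]
  have hcommf : ∀ i, ((g * g : (CBreve Q)ˣ) : CBreve Q) * M.ι (f i) =
      M.ι (f i) * ((g * g : (CBreve Q)ˣ) : CBreve Q) := by
    intro i
    obtain ⟨a, ha, h1⟩ := hline i
    have h2 : (g : CBreve Q) * M.ι (f i) = a • (M.ι (f i) * g) := by
      rw [← smul_mul_assoc, ← h1, mul_assoc, mul_assoc, Units.inv_mul, mul_one]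
    rw [Units.val_mul, mul_assoc, h2, mul_smul_comm, ← mul_assoc, h2, smul_mul_assoc, smul_smul, ha,
      one_smul, mul_assoc]
  exact CliffordModel.forall_of_span he.span (f := (LinearMap.mulLeft _ _).comp M.ι)
    (g := (LinearMap.mulRight _ _).comp M.ι) hcommf u

end Center

section FixedVectors

variable {p : ℕ} [Fact p.Prime] {V : Type*} [AddCommGroup V] [Module ℚ_[p] V]
  {Q : QuadraticForm ℚ_[p] V} {n : ℕ} {e : Fin n → V}

/-- The operator `Φ` on `V_{ℚ̆_p}`. -/
def frobV {b : (CBreve Q)ˣ} (hb : IsGSpin Q b) (u : VBreve p V) : VBreve p V :=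
  ((hb.conj_mem (sigmaC Q (incl Q u))).2 ⟨sigmaV p V u, (sigmaC_incl Q u).symm⟩).choose

theorem incl_frobV {b : (CBreve Q)ˣ} (hb : IsGSpin Q b) (u : VBreve p V) :
    incl Q (frobV hb u) = conjFrob b (incl Q u) :=
  ((hb.conj_mem (sigmaC Q (incl Q u))).2 ⟨sigmaV p V u, (sigmaC_incl Q u).symm⟩).choose_spec

theorem incl_frobV_iterate {b : (CBreve Q)ˣ} (hb : IsGSpin Q b) (t : ℕ) (u : VBreve p V) :
    incl Q ((frobV hb)^[t] u) = (conjFrob b)^[t] (incl Q u) := by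
  induction t generalizing u with
  | zero => rfl
  | succ t ih => rw [Function.iterate_succ_apply, ih, incl_frobV]; rfl

theorem incl_injective
    (he : (cliffordModel Q).IsFrame fun i => (1 : BreveQp p) ⊗ₜ[ℚ_[p]] e i)
    : Function.Injective (incl Q) := he.ι_injective

theorem frobV_add
    (he : (cliffordModel Q).IsFrame fun i => (1 : BreveQp p) ⊗ₜ[ℚ_[p]] e i)
    {b : (CBreve Q)ˣ} (hb : IsGSpin Q b) (u w : VBreve p V) :
    frobV hb (u + w) = frobV hb u + frobV hb w := by
  apply incl_injective he
  simp only [map_add, incl_frobV, conjFrob, mul_add, add_mul]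

theorem frobV_smul
    (he : (cliffordModel Q).IsFrame fun i => (1 : BreveQp p) ⊗ₜ[ℚ_[p]] e i)
    {b : (CBreve Q)ˣ} (hb : IsGSpin Q b) (a : BreveQp p) (u : VBreve p V) :
    frobV hb (a • u) = sigma p a • frobV hb u := by
  apply incl_injective he
  simp only [map_smul, incl_frobV, conjFrob, sigmaC_smul, mul_smul_comm, smul_mul_assoc]

theorem frobV_iterate_smul
    (he : (cliffordModel Q).IsFrame fun i => (1 : BreveQp p) ⊗ₜ[ℚ_[p]] e i)
    {b : (CBreve Q)ˣ} (hb : IsGSpin Q b) (k : ℕ) (a : BreveQp p)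
    (u : VBreve p V) : (frobV hb)^[k] (a • u) = (sigma p)^[k] a • (frobV hb)^[k] u := by
  induction k generalizing a u with
  | zero => rfl
  | succ k ih => rw [Function.iterate_succ_apply, frobV_smul he, ih]; rfl

theorem formBreve_frobV {b : (CBreve Q)ˣ} (hb : IsGSpin Q b) (u w : VBreve p V) :
    formBreve Q (frobV hb u) (frobV hb w) = sigma p (formBreve Q u w) := by
  rw [← formBreve_sigmaV]
  refine CliffordModel.form_eq_of_conj (M := cliffordModel Q) (h := b) ?_ ?_
  · change _ * incl Q _ * _ = incl Q _
    rw [incl_frobV, ← sigmaC_incl]; rfl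
  · change _ * incl Q _ * _ = incl Q _
    rw [incl_frobV, ← sigmaC_incl]; rfl

theorem mem_fixedSpace_iff
    (he : (cliffordModel Q).IsFrame fun i => (1 : BreveQp p) ⊗ₜ[ℚ_[p]] e i)
    {b : (CBreve Q)ˣ} (hb : IsGSpin Q b) (u : VBreve p V) :
    u ∈ fixedSpace Q b ↔ frobV hb u = u := by
  rw [← (incl_injective he).eq_iff, incl_frobV]
  rfl

variable [FiniteDimensional ℚ_[p] V]

/-- The isocrystal `(V_{ℚ̆_p}, Φ)` of a basic `b` has slope zero. -/
theorem span_iterate_fixed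
    (he : (cliffordModel Q).IsFrame fun i => (1 : BreveQp p) ⊗ₜ[ℚ_[p]] e i)
    (hn3 : 3 ≤ n) {b : (CBreve Q)ˣ} (hb : IsGSpin Q b)
    (hbasic : IsBasic Q b) :
    ∃ t, 0 < t ∧ Submodule.span (BreveQp p) {u | (frobV hb)^[t] u = u} = ⊤ := by
  classical
  obtain ⟨t, l, ⟨ht, ⟨hmem, c, hc⟩, hslope⟩, hcent⟩ := hbasic
  refine ⟨t, ht, ?_⟩
  have hpu := prime_cast_ne_zero p
  have hc' : ∀ z : (BreveQp p)ˣ, (l z : CBreve Q) =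
      ∑ i ∈ c.support, ((z ^ i : (BreveQp p)ˣ) : BreveQp p) • c i := hc
  -- the components of `l` are weight vectors
  have hweight : ∀ z i, (l z : CBreve Q) * c i = ((z ^ i : (BreveQp p)ˣ) : BreveQp p) • c i := by
    intro z i
    by_cases hi : i ∈ c.support
    · rw [← sub_eq_zero]
      refine eq_zero_of_zpow_sum_eq_zero (p := p) Function.injective_id c.support
        (fun i => (l z : CBreve Q) * c i - ((z ^ i : (BreveQp p)ˣ) : BreveQp p) • c i) ?_ hi
      intro w
      have h1 : (l (z * w) : CBreve Q) = l z * l w := by rw [map_mul, Units.val_mul]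
      rw [hc' (z * w), hc' w, Finset.mul_sum] at h1
      simp only [smul_sub, Finset.sum_sub_distrib, id]
      rw [sub_eq_zero, Finset.sum_congr rfl (fun i _ => (mul_smul_comm _ _ _).symm), ← h1]
      refine Finset.sum_congr rfl fun i _ => ?_
      rw [mul_zpow, Units.val_mul, smul_smul, mul_comm]
    · rw [Finsupp.notMem_support_iff.1 hi, mul_zero, smul_zero]
  -- they are central
  have hcV : ∀ i u, Commute (c i) (incl Q u) := by
    intro i u
    by_cases hi : i ∈ c.support
    · rw [Commute, SemiconjBy, ← sub_eq_zero]
      refine eq_zero_of_zpow_sum_eq_zero (p := p) (f := fun i => 2 * i)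
        (fun i j h => by simpa using h) c.support
        (fun i => c i * incl Q u - incl Q u * c i) ?_ hi
      intro z
      have h1 := commute_sq_of_commute_gspin hn3 he (hmem z) (hcent z) u
      rw [← map_mul, hc', Commute, SemiconjBy, Finset.sum_mul, Finset.mul_sum] at h1
      simp only [smul_sub, Finset.sum_sub_distrib]
      rw [sub_eq_zero]
      simp only [smul_mul_assoc, mul_smul_comm, mul_zpow, ← zpow_add] at h1
      simpa only [two_mul] using h1
    · rw [Finsupp.notMem_support_iff.1 hi]; exact Commute.zero_left _
  have hlV : ∀ z u, Commute (l z : CBreve Q) (incl Q u) := by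
    intro z u
    rw [hc']
    exact Commute.sum_left _ _ _ fun i _ => (hcV i u).smul_left _
  -- eigenvectors of Frobenius span
  have hspan : ⊤ ≤ Submodule.span (BreveQp p)
      {x | ∃ r : ℤ, (frobC Q b)^[t] x = ((p : BreveQp p) ^ r) • x} := by
    rintro x -
    have h1 : x = ∑ i ∈ c.support, c i * x := by
      have := hc' 1
      simp only [map_one, Units.val_one, one_zpow, one_smul] at this
      rw [← Finset.sum_mul, ← this, one_mul]
    rw [h1]
    refine Submodule.sum_mem _ fun i _ => ?_
    have h2 : c i * x ∈ slopePart Q b t i := by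
      rw [hslope]
      intro z
      rw [← mul_assoc, hweight, smul_mul_assoc]
    exact Submodule.span_mono (t := {x | ∃ r : ℤ, (frobC Q b)^[t] x = ((p : BreveQp p) ^ r) • x})
      (fun y hy => ⟨i, hy⟩) h2
  let s := Basis.ofSpan hspan
  have hr : ∀ j, ∃ r : ℤ, (frobC Q b)^[t] (s j) = ((p : BreveQp p) ^ r) • s j := fun j =>
    Basis.ofSpan_subset hspan ⟨j, rfl⟩
  choose r hr using hr
  have hls : ∀ z j, (l z : CBreve Q) * s j = ((z ^ r j : (BreveQp p)ˣ) : BreveQp p) • s j :=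
    fun z j => (hslope (r j) (s j)).1 (Submodule.subset_span (hr j)) z
  let J := ((linearIndepOn_empty (BreveQp p) id).extend (Set.empty_subset
    {x : CBreve Q | ∃ r : ℤ, (frobC Q b)^[t] x = ((p : BreveQp p) ^ r) • x}) : Set (CBreve Q))
  let ℓ : J × J → Dual (BreveQp p) (VBreve p V) := fun kj =>
    (s.coord kj.1).comp ((LinearMap.mulRight (BreveQp p) (s kj.2)).comp (incl Q))
  have hℓ : ∀ k j u, ℓ (k, j) u = s.repr (incl Q u * s j) k := fun _ _ _ => rfl
  have hexp : ∀ j u, incl Q u * s j = ∑ k ∈ (s.repr (incl Q u * s j)).support, ℓ (k, j) u • s k :=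
    fun j u => (s.linearCombination_repr (incl Q u * s j)).symm
  -- the matrix coefficients respect the weights
  have hzero : ∀ k j u, r k ≠ r j → ℓ (k, j) u = 0 := by
    intro k j u hkj
    let z : (BreveQp p)ˣ := Units.mk0 (p : BreveQp p) hpu
    have h1 : (l z : CBreve Q) * (incl Q u * s j) =
        ((z ^ r j : (BreveQp p)ˣ) : BreveQp p) • (incl Q u * s j) := by
      rw [← mul_assoc, (hlV z u).eq, mul_assoc, hls, mul_smul_comm]
    have h2 : (l z : CBreve Q) * (incl Q u * s j) =
        ∑ k ∈ (s.repr (incl Q u * s j)).support,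
          (((z ^ r k : (BreveQp p)ˣ) : BreveQp p) * ℓ (k, j) u) • s k := by
      conv_lhs => rw [hexp]
      rw [Finset.mul_sum]
      refine Finset.sum_congr rfl fun k _ => ?_
      rw [mul_smul_comm, hls, smul_smul, mul_comm]
    have h3 : s.repr ((l z : CBreve Q) * (incl Q u * s j)) k =
        ((z ^ r k : (BreveQp p)ˣ) : BreveQp p) * ℓ (k, j) u := by
      rw [h2, map_sum, Finsupp.finsetSum_apply]
      simp only [map_smul, Basis.repr_self, Finsupp.smul_apply, Finsupp.single_apply, smul_eq_mul]
      simp only [mul_ite, mul_one, mul_zero, Finset.sum_ite_eq', Finsupp.mem_support_iff]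
      split_ifs with h
      · rfl
      · rw [ne_eq, not_not] at h
        rw [hℓ, h, mul_zero]
    rw [h1, map_smul, Finsupp.smul_apply, smul_eq_mul, ← hℓ] at h3
    by_contra h0
    have h4 := mul_right_cancel₀ h0 h3
    simp only [Units.val_zpow_eq_zpow_val, z, Units.val_mk0] at h4
    exact hkj (HasVal.unique (x := (p : BreveQp p) ^ r k) ⟨1, by simp⟩ ⟨1, by simp [h4]⟩)
  let σt : BreveQp p →+* BreveQp p := (sigma p : BreveQp p →+* BreveQp p) ^ t
  have hσt : ∀ a, σt a = (sigma p)^[t] a := fun a => by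
    rw [RingHom.coe_pow]; rfl
  refine exists_fixed_basis_of_functionals σt _ ℓ ?_ ?_
  · intro u hu
    apply incl_injective he
    rw [map_zero]
    have h1 : LinearMap.mulLeft (BreveQp p) (incl Q u) = 0 := by
      refine s.ext fun j => ?_
      rw [LinearMap.mulLeft_apply, LinearMap.zero_apply, hexp]
      exact Finset.sum_eq_zero fun k _ => by rw [hu, zero_smul]
    have h2 := LinearMap.congr_fun h1 1
    rwa [LinearMap.mulLeft_apply, mul_one] at h2
  · rintro ⟨k, j⟩ u
    have h1 : (frobC Q b)^[t] (incl Q u * s j) =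
        ((p : BreveQp p) ^ r j) • (incl Q ((frobV hb)^[t] u) * s j) := by
      rw [frobC_iterate_mul, incl_frobV_iterate, hr, mul_smul_comm]
    have h2 : (frobC Q b)^[t] (incl Q u * s j) =
        ∑ k ∈ (s.repr (incl Q u * s j)).support,
          ((sigma p)^[t] (ℓ (k, j) u) * (p : BreveQp p) ^ r k) • s k := by
      conv_lhs => rw [hexp]
      rw [frobC_iterate_sum]
      refine Finset.sum_congr rfl fun k _ => ?_
      rw [frobC_iterate_smul, hr, smul_smul]
    have h3 : s.repr ((frobC Q b)^[t] (incl Q u * s j)) k =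
        (sigma p)^[t] (ℓ (k, j) u) * (p : BreveQp p) ^ r k := by
      rw [h2, map_sum, Finsupp.finsetSum_apply]
      simp only [map_smul, Basis.repr_self, Finsupp.smul_apply, Finsupp.single_apply, smul_eq_mul]
      simp only [mul_ite, mul_one, mul_zero, Finset.sum_ite_eq', Finsupp.mem_support_iff]
      split_ifs with h
      · rfl
      · rw [ne_eq, not_not] at h
        rw [hℓ, h, ← hσt, map_zero, zero_mul]
    rw [h1, map_smul, Finsupp.smul_apply, smul_eq_mul, ← hℓ, mul_comm] at h3
    rw [hσt]
    by_cases hkj : r k = r j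
    · rw [hkj] at h3
      exact mul_right_cancel₀ (zpow_ne_zero _ hpu) h3
    · rw [hzero k j _ hkj, hzero k j u hkj, ← hσt, map_zero]

/-- For basic `b`, `V_{ℚ̆_p}` is spanned by `𝕍`. -/
theorem span_fixedSpace
    (he : (cliffordModel Q).IsFrame fun i => (1 : BreveQp p) ⊗ₜ[ℚ_[p]] e i)
    (hn3 : 3 ≤ n) {b : (CBreve Q)ˣ} (hb : IsGSpin Q b)
    (hbasic : IsBasic Q b) :
    Submodule.span (BreveQp p) (fixedSpace Q b : Set (VBreve p V)) = ⊤ := by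
  obtain ⟨t, ht, hspan⟩ := span_iterate_fixed he hn3 hb hbasic
  by_contra hne
  obtain ⟨f, hf, hle⟩ := Submodule.exists_le_ker_of_lt_top _ (lt_top_iff_ne_top.2 hne)
  apply hf
  let Φ : VBreve p V →+ VBreve p V := AddMonoidHom.mk' (frobV hb) (frobV_add he hb)
  refine LinearMap.ext_on hspan fun w hw => ?_
  rw [LinearMap.zero_apply]
  refine eq_zero_of_sigma_sum_eq_zero (t := t) (fun k => f ((frobV hb)^[k] w)) ?_ ht
  intro a ha
  have haw : (frobV hb)^[t] (a • w) = a • w := by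
    rw [frobV_iterate_smul he, ha]
    rw [show (frobV hb)^[t] w = w from hw]
  have hfix : ∑ k ∈ Finset.range t, (frobV hb)^[k] (a • w) ∈ fixedSpace Q b := by
    rw [mem_fixedSpace_iff he hb]
    change Φ _ = _
    rw [map_sum]
    change ∑ k ∈ Finset.range t, frobV hb ((frobV hb)^[k] (a • w)) = _
    simp only [← Function.iterate_succ_apply' (frobV hb)]
    have h1 := Finset.sum_range_succ (fun k => (frobV hb)^[k] (a • w)) t
    have h2 := Finset.sum_range_succ' (fun k => (frobV hb)^[k] (a • w)) t
    rw [h1, haw] at h2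
    exact (add_right_cancel h2).symm
  have h3 : f (∑ k ∈ Finset.range t, (frobV hb)^[k] (a • w)) = 0 :=
    hle (Submodule.subset_span hfix)
  rw [map_sum] at h3
  rw [← h3]
  refine Finset.sum_congr rfl fun k _ => ?_
  rw [frobV_iterate_smul he, map_smul, smul_eq_mul, mul_comm]

/-- For basic `b`, a `ℚ_p`-basis of `𝕍` is a `ℚ̆_p`-basis of `V_{ℚ̆_p}`. -/
theorem exists_fixed_basis
    (he : (cliffordModel Q).IsFrame fun i => (1 : BreveQp p) ⊗ₜ[ℚ_[p]] e i)
    (hn3 : 3 ≤ n) (hn : finrank ℚ_[p] V = n) {b : (CBreve Q)ˣ}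
    (hb : IsGSpin Q b) (hbasic : IsBasic Q b) : Nonempty (Basis (Fin n) ℚ_[p] (FixedV Q b)) := by
  have hspan := (span_fixedSpace he hn3 hb hbasic).ge
  let β := Basis.ofSpan hspan
  have hfin := Module.Finite.finite_basis β
  have hcard : finrank (BreveQp p) (VBreve p V) = n := by
    rw [Module.finrank_baseChange, hn]
  let v := β.reindex ((Finite.equivFin _).trans (finCongr (by
    rw [← Module.finrank_eq_nat_card_basis β, hcard])))
  have hv : ∀ i, v i ∈ fixedSpace Q b := by
    intro i
    rw [Basis.reindex_apply]
    exact Basis.ofSpan_subset hspan ⟨_, rfl⟩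
  let v' : Fin n → fixedSpace Q b := fun i => ⟨v i, hv i⟩
  have hli : LinearIndependent ℚ_[p] v' := by
    have h1 : LinearIndependent ℚ_[p] v := v.linearIndependent.restrict_scalars
      (by
        intro x y hxy
        simpa [Algebra.smul_def] using hxy)
    exact LinearIndependent.of_comp (fixedSpace Q b).subtype h1
  have hsp : ⊤ ≤ Submodule.span ℚ_[p] (Set.range v') := by
    rintro ⟨x, hx⟩ -
    have hfx := (mem_fixedSpace_iff he hb x).1 hx
    have hrep : ∀ i, ∃ a : ℚ_[p], algebraMap ℚ_[p] (BreveQp p) a = v.repr x i := by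
      intro i
      apply exists_of_sigma_eq
      let Φ : VBreve p V →+ VBreve p V := AddMonoidHom.mk' (frobV hb) (frobV_add he hb)
      have h1 : frobV hb x = ∑ j, sigma p (v.repr x j) • v j := by
        conv_lhs => rw [← v.sum_repr x]
        change Φ _ = _
        rw [map_sum]
        refine Finset.sum_congr rfl fun j _ => ?_
        change frobV hb _ = _
        rw [frobV_smul he, (mem_fixedSpace_iff he hb _).1 (hv j)]
      rw [hfx] at h1
      have h2 : v.repr x i = v.repr (∑ j, sigma p (v.repr x j) • v j) i := by rw [← h1]
      rw [Basis.repr_sum_self] at h2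
      exact h2.symm
    choose a ha using hrep
    rw [Submodule.mem_span_range_iff_exists_fun]
    refine ⟨a, Subtype.ext ?_⟩
    rw [AddSubmonoidClass.coe_finsetSum]
    change ∑ i, a i • v i = x
    conv_rhs => rw [← v.sum_repr x]
    refine Finset.sum_congr rfl fun i _ => ?_
    rw [← ha, algebraMap_smul]
  exact ⟨Basis.mk hli hsp⟩

end FixedVectors

section OrthFrame

variable {F W : Type*} [Field F] [AddCommGroup W] [Module F W]

/-- An orthogonal family of anisotropic vectors that spans the quadratic space. -/
structure OrthFrame (Q : QuadraticForm F W) {I : Type*} (e : I → W) : Prop where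
  ortho : ∀ i j, i ≠ j → QuadraticMap.polar Q (e i) (e j) = 0
  ne_zero : ∀ i, Q (e i) ≠ 0
  span : Submodule.span F (Set.range e) = ⊤

end OrthFrame

section FixedForm

variable {p : ℕ} [Fact p.Prime] {V : Type*} [AddCommGroup V] [Module ℚ_[p] V]
  {Q : QuadraticForm ℚ_[p] V} {n : ℕ} {e : Fin n → V}

theorem OrthFrame.isFrame (he : OrthFrame Q e) :
    (cliffordModel Q).IsFrame fun i => (1 : BreveQp p) ⊗ₜ[ℚ_[p]] e i :=
  isFrame_tmul he.ortho he.ne_zero he.span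

theorem frobV_incl (he : OrthFrame Q e) {b : (CBreve Q)ˣ} (hb : IsGSpin Q b) (x : FixedV Q b) :
    frobV hb (FixedV.incl Q b x) = FixedV.incl Q b x :=
  (mem_fixedSpace_iff he.isFrame hb _).1 x.2

/-- The form of `V_{ℚ̆_p}` restricts to a `ℚ_p`-valued form on `𝕍`. -/
theorem exists_fixedForm (he : OrthFrame Q e) {b : (CBreve Q)ˣ} (hb : IsGSpin Q b) :
    ∃ q : QuadraticForm ℚ_[p] (FixedV Q b),
      ∀ x y, algebraMap ℚ_[p] (BreveQp p) (QuadraticMap.polar q x y) =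
        formBreve Q (FixedV.incl Q b x) (FixedV.incl Q b y) := by
  have h1 : ∀ x y : FixedV Q b, ∃ a : ℚ_[p], algebraMap ℚ_[p] (BreveQp p) a =
      formBreve Q (FixedV.incl Q b x) (FixedV.incl Q b y) := by
    intro x y
    apply exists_of_sigma_eq
    rw [← formBreve_frobV hb, frobV_incl he, frobV_incl he]
  choose B hB using h1
  have hinj := (algebraMap ℚ_[p] (BreveQp p)).injective
  have hsm : ∀ (c : ℚ_[p]) (x : FixedV Q b), FixedV.incl Q b (c • x) =
      algebraMap ℚ_[p] (BreveQp p) c • FixedV.incl Q b x := by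
    intro c x
    rw [map_smul, algebraMap_smul]
  let B' : LinearMap.BilinForm ℚ_[p] (FixedV Q b) := LinearMap.mk₂ ℚ_[p] B
    (fun x x' y => hinj (by simp only [map_add, hB, LinearMap.add_apply]))
    (fun c x y => hinj (by
      rw [hB, hsm, map_smul, LinearMap.smul_apply, smul_eq_mul, smul_eq_mul, map_mul, hB]))
    (fun x y y' => hinj (by simp only [map_add, hB]))
    (fun c x y => hinj (by rw [hB, hsm, map_smul, smul_eq_mul, smul_eq_mul, map_mul, hB]))
  have hsymm : ∀ x y, B x y = B y x := fun x y => hinj (by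
    rw [hB, hB]
    exact (cliffordModel Q).form_comm _ _)
  refine ⟨(2⁻¹ : ℚ_[p]) • LinearMap.BilinMap.toQuadraticMap B', fun x y => ?_⟩
  rw [← hB]
  congr 1
  rw [FunLike.coe_smul, QuadraticMap.polar_smul, LinearMap.BilinMap.polar_toQuadraticMap]
  change (2⁻¹ : ℚ_[p]) * (B x y + B y x) = _
  rw [hsymm y x, ← two_mul, inv_mul_cancel_left₀ two_ne_zero]

variable {b : (CBreve Q)ˣ} {q : QuadraticForm ℚ_[p] (FixedV Q b)}

theorem fixedFrame [FiniteDimensional ℚ_[p] V] (hn3 : 3 ≤ n) (he : OrthFrame Q e)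
    (hb : IsGSpin Q b) (hbasic : IsBasic Q b)
    (hq : ∀ x y, algebraMap ℚ_[p] (BreveQp p) (QuadraticMap.polar q x y) =
      formBreve Q (FixedV.incl Q b x) (FixedV.incl Q b y)) {I : Type*} {v : I → FixedV Q b}
    (hv : OrthFrame q v) : (cliffordModel Q).IsFrame fun i => FixedV.incl Q b (v i) where
  ortho i j hij := by
    change formBreve Q _ _ = 0
    rw [← hq, hv.ortho i j hij, map_zero]
  norm_ne_zero i := by
    change formBreve Q _ _ ≠ 0
    rw [← hq, QuadraticMap.polar_self, Ne, FaithfulSMul.algebraMap_eq_zero_iff]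
    simpa using hv.ne_zero i
  span := by
    rw [eq_top_iff, ← span_fixedSpace he.isFrame hn3 hb hbasic, Submodule.span_le]
    intro x hx
    have h1 : (⟨x, hx⟩ : fixedSpace Q b) ∈ Submodule.span ℚ_[p] (Set.range v) := by
      have := hv.span.ge
      exact this trivial
    have h2 := Submodule.mem_map_of_mem (f := FixedV.incl Q b) h1
    rw [Submodule.map_span, ← Set.range_comp] at h2
    exact Submodule.span_le_restrictScalars ℚ_[p] (BreveQp p) _ h2

theorem formBreve_incl_self (hq : ∀ x y, algebraMap ℚ_[p] (BreveQp p) (QuadraticMap.polar q x y) =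
      formBreve Q (FixedV.incl Q b x) (FixedV.incl Q b y)) (x : FixedV Q b) :
    formBreve Q (FixedV.incl Q b x) (FixedV.incl Q b x) / 2 =
      algebraMap ℚ_[p] (BreveQp p) (q x) := by
  rw [← hq, QuadraticMap.polar_self, nsmul_eq_mul, map_mul, Nat.cast_ofNat, map_ofNat,
    mul_div_cancel_left₀ _ two_ne_zero]

theorem formBreve_tmul_self (x : V) :
    formBreve Q ((1 : BreveQp p) ⊗ₜ[ℚ_[p]] x) ((1 : BreveQp p) ⊗ₜ[ℚ_[p]] x) / 2 =
      algebraMap ℚ_[p] (BreveQp p) (Q x) := by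
  rw [formBreve_tmul, QuadraticMap.polar_self, nsmul_eq_mul, map_mul, Nat.cast_ofNat, map_ofNat,
    mul_one, mul_one, mul_div_cancel_left₀ _ two_ne_zero]

theorem conjFrob_list_prod (b : (CBreve Q)ˣ) (l : List (CBreve Q))
    (hl : ∀ x ∈ l, conjFrob b x = x) : conjFrob b l.prod = l.prod := by
  induction l with
  | nil => simp [conjFrob]
  | cons x l ih =>
    have h1 : ∀ y z, conjFrob b (y * z) = conjFrob b y * conjFrob b z := by
      intro y z
      simp only [conjFrob, map_mul, mul_assoc, Units.inv_mul_cancel_left]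
    rw [List.prod_cons, h1, hl x (by simp), ih fun y hy => hl y (by simp [hy])]

/-- `V` and `𝕍` have the same discriminant. -/
theorem exists_prod_eq_sq_mul [FiniteDimensional ℚ_[p] V] (hn3 : 3 ≤ n) (he : OrthFrame Q e)
    (hb : IsGSpin Q b) (hbasic : IsBasic Q b)
    (hq : ∀ x y, algebraMap ℚ_[p] (BreveQp p) (QuadraticMap.polar q x y) =
      formBreve Q (FixedV.incl Q b x) (FixedV.incl Q b y)) {v : Fin n → FixedV Q b}
    (hv : OrthFrame q v) : ∃ r : ℚ_[p], ∏ i, q (v i) = r ^ 2 * ∏ i, Q (e i) := by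
  have hf := he.isFrame
  have hg := fixedFrame hn3 he hb hbasic hq hv
  obtain ⟨r, hr⟩ := CliffordModel.exists_volume_eq_smul hf hg
  set ωe := (cliffordModel Q).vol (fun i => (1 : BreveQp p) ⊗ₜ[ℚ_[p]] e i) (List.finRange n)
  set ωv := (cliffordModel Q).vol (fun i => FixedV.incl Q b (v i)) (List.finRange n)
  have h1 : conjFrob b ωv = ωv := by
    apply conjFrob_list_prod
    intro x hx
    obtain ⟨i, -, rfl⟩ := List.mem_map.1 hx
    exact (v i).2
  have h2 : sigmaC Q ωe = ωe := by
    change sigmaC Q (List.prod _) = List.prod _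
    rw [map_list_prod, List.map_map]
    congr 2
    ext i
    change sigmaC Q (incl Q _) = incl Q _
    rw [incl_tmul, sigmaC_tmul, map_one]
  have h3 : conjFrob b ωe = ωe := by
    rw [conjFrob, h2, (CliffordModel.volume_commute hf (gradeInv_eq_of_even Q hb.even)).symm.eq,
      mul_assoc, Units.mul_inv, mul_one]
  have h4 : conjFrob b ωv = sigma p r • ωe := by
    rw [hr, conjFrob, sigmaC_smul, mul_smul_comm, smul_mul_assoc]
    exact congrArg _ h3
  rw [h1, hr] at h4
  have h5 := smul_left_injective _ (CliffordModel.vol_ne_zero hf (List.finRange n)) h4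
  obtain ⟨a, ha⟩ := exists_of_sigma_eq h5.symm
  refine ⟨a, (algebraMap ℚ_[p] (BreveQp p)).injective ?_⟩
  have h6 := CliffordModel.rev_vol_mul (M := cliffordModel Q)
    (e := fun i => FixedV.incl Q b (v i)) (List.finRange n)
  have h7 := CliffordModel.rev_vol_mul (M := cliffordModel Q)
    (e := fun i => (1 : BreveQp p) ⊗ₜ[ℚ_[p]] e i) (List.finRange n)
  change (cliffordModel Q).rev ωv * ωv = _ at h6
  change (cliffordModel Q).rev ωe * ωe = _ at h7
  rw [hr, map_smul, smul_mul_smul_comm, h7, Algebra.smul_def, ← map_mul] at h6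
  have h8 := (algebraMap (BreveQp p) (CBreve Q)).injective h6
  rw [← Fin.prod_univ_def, ← Fin.prod_univ_def] at h8
  rw [map_mul, map_pow, map_prod, map_prod, ha, pow_two]
  calc _ = ∏ i, (cliffordModel Q).form (FixedV.incl Q b (v i)) (FixedV.incl Q b (v i)) / 2 :=
        Finset.prod_congr rfl fun i _ => (formBreve_incl_self hq (v i)).symm
    _ = _ := h8.symm
    _ = _ := by
      congr 1
      exact Finset.prod_congr rfl fun i _ => formBreve_tmul_self (e i)

/-- If `𝕍` is isometric to `V`, then the Kottwitz invariant of `b` is even. -/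
theorem even_of_isometric [FiniteDimensional ℚ_[p] V] (hn3 : 3 ≤ n) (he : OrthFrame Q e)
    (hb : IsGSpin Q b) (hbasic : IsBasic Q b)
    (hq : ∀ x y, algebraMap ℚ_[p] (BreveQp p) (QuadraticMap.polar q x y) =
      formBreve Q (FixedV.incl Q b x) (FixedV.incl Q b y)) {v : Fin n → FixedV Q b}
    (hv : OrthFrame q v) (heq : ∀ i, q (v i) = Q (e i)) {m : ℤ}
    (hκ : HasKottwitzInvariant Q b m) : Even m := by
  have hf := he.isFrame
  have hg := fixedFrame hn3 he hb hbasic hq hv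
  set f : Fin n → VBreve p V := fun i => (1 : BreveQp p) ⊗ₜ[ℚ_[p]] e i with hfdef
  obtain ⟨h, hh, hconj⟩ := CliffordModel.exists_versor_conj hf.ortho hg.ortho
    (fun i => by
      have h1 := formBreve_incl_self hq (v i)
      have h2 := formBreve_tmul_self (Q := Q) (e i)
      rw [heq, ← h2] at h1
      exact ((div_left_inj' two_ne_zero).1 h1).symm) hg.norm_ne_zero
  have hσf : ∀ i, sigmaC Q (incl Q (f i)) = incl Q (f i) := by
    intro i
    rw [hfdef, incl_tmul, sigmaC_tmul, map_one]
  let σh : (CBreve Q)ˣ := Units.map (sigmaC Q).toMonoidHom h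
  have hσh : (σh : CBreve Q) = sigmaC Q h := rfl
  have hσhi : (↑σh⁻¹ : CBreve Q) = sigmaC Q (↑h⁻¹ : CBreve Q) := rfl
  let z : (CBreve Q)ˣ := h⁻¹ * b * σh
  have hfix : ∀ i, conjFrob b ((h : CBreve Q) * incl Q (f i) * (↑h⁻¹ : CBreve Q)) =
      (h : CBreve Q) * incl Q (f i) * (↑h⁻¹ : CBreve Q) := by
    intro i
    have hvi : conjFrob b (incl Q (FixedV.incl Q b (v i))) = incl Q (FixedV.incl Q b (v i)) :=
      (v i).2
    rcases hconj i with h1 | h1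
    · change (h : CBreve Q) * incl Q (f i) * (↑h⁻¹ : CBreve Q) = incl Q _ at h1
      rw [h1, hvi]
    · change (h : CBreve Q) * incl Q (f i) * (↑h⁻¹ : CBreve Q) = -incl Q _ at h1
      rw [h1, ← map_neg]
      change _ * sigmaC Q (incl Q _) * _ = _
      rw [map_neg, map_neg, mul_neg, neg_mul]
      exact congrArg _ hvi
  have hcomm : ∀ i, Commute (z : CBreve Q) ((cliffordModel Q).ι (f i)) := by
    intro i
    change (z : CBreve Q) * incl Q (f i) = incl Q (f i) * z
    have h1 := hfix i
    rw [conjFrob, map_mul, map_mul, hσf, ← hσh, ← hσhi] at h1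
    have h2 := congrArg (fun y => (↑h⁻¹ : CBreve Q) * y * b * σh) h1
    simp only [mul_assoc, Units.inv_mul_cancel_left, Units.inv_mul, mul_one] at h2
    simp only [z, Units.val_mul, mul_assoc]
    exact h2
  have heven : (cliffordModel Q).inv z = z := by
    have hb' := gradeInv_eq_of_even Q hb.even
    have h1 : (cliffordModel Q).inv σh = sigmaC Q ((cliffordModel Q).inv h) :=
      gradeInv_sigmaC Q h
    have h2 : (cliffordModel Q).inv (↑h⁻¹ : CBreve Q) * (cliffordModel Q).inv h = 1 := by
      rw [← map_mul, Units.inv_mul, map_one]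
    have h3 : (z : CBreve Q) = (↑h⁻¹ : CBreve Q) * b * σh := rfl
    rw [h3, map_mul, map_mul, hb', h1]
    rcases hh.parity with h4 | h4
    · rw [h4] at h2 ⊢
      rw [← Units.inv_eq_of_mul_eq_one_left h2, hσh]
    · rw [h4] at h2 ⊢
      rw [mul_neg, ← neg_mul] at h2
      rw [← neg_eq_iff_eq_neg.2 (Units.inv_eq_of_mul_eq_one_left h2), map_neg, hσh]
      simp
  obtain ⟨ζ, hζ⟩ := CliffordModel.exists_algebraMap_eq hf heven hcomm
  obtain ⟨N, hN0, hN1, hN2⟩ := hh.norm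
  change rev Q h * h = _ at hN1
  change (h : CBreve Q) * rev Q h = _ at hN2
  obtain ⟨u, hu⟩ := hκ
  have hmain : (h : CBreve Q) * z = b * σh := by
    simp only [z, Units.val_mul, mul_assoc, Units.mul_inv_cancel_left]
  rw [hζ] at hmain
  have hrm : ∀ x y, rev Q (x * y) = rev Q y * rev Q x := (cliffordModel Q).rev_mul
  have hrev := congrArg (fun y => rev Q y * y) hmain
  have hra : rev Q (algebraMap (BreveQp p) (CBreve Q) ζ) = algebraMap (BreveQp p) (CBreve Q) ζ :=
    (cliffordModel Q).rev_algebraMap ζ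
  have hσN : rev Q σh * σh = algebraMap (BreveQp p) (CBreve Q) (sigma p N) := by
    rw [hσh, rev_sigmaC, ← map_mul, hN1, sigmaC_algebraMap]
  simp only [hrm, hra] at hrev
  rw [mul_assoc, ← mul_assoc (rev Q h), hN1, mul_assoc, ← mul_assoc (rev Q (b : CBreve Q)), hu,
    ← map_mul, ← map_mul, ← Algebra.smul_def, mul_smul_comm, hσN, Algebra.smul_def, ← map_mul] at hrev
  have hK := (algebraMap (BreveQp p) (CBreve Q)).injective hrev
  obtain ⟨k, hk⟩ := exists_hasVal hN0
  have hζ0 : ζ ≠ 0 := by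
    rintro rfl
    rw [map_zero] at hζ
    exact z.ne_zero hζ
  obtain ⟨j, hj⟩ := exists_hasVal hζ0
  have hm : HasVal p ((p : BreveQp p) ^ m * algebraMap (BreveZp p) (BreveQp p) u) m := ⟨u, rfl⟩
  have h9 := (hj.mul (hk.mul hj))
  rw [hK] at h9
  have := h9.unique (hm.mul hk.sigma)
  exact ⟨j, by omega⟩

/-- The class of `μ` in `π₁(GSpin(V))_Γ = ℤ` is `-1`. -/
theorem muClass_eq {x₁ x₂ : VBreve p V} (hx₁ : formBreve Q x₁ x₁ = 0)
    (hx₂ : formBreve Q x₂ x₂ = 0) (hx₁₂ : formBreve Q x₁ x₂ = 1) {m : ℤ}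
    (hμ : MuHasClass Q x₁ x₂ m) : m = -1 := by
  have h := hμ (Units.mk0 (p : BreveQp p) (prime_cast_ne_zero p))
  set M := cliffordModel Q
  have h11 : incl Q x₁ * incl Q x₁ = 0 := by
    have := M.ι_sq x₁
    rwa [show M.form x₁ x₁ = 0 from hx₁, zero_div, map_zero] at this
  have h22 : incl Q x₂ * incl Q x₂ = 0 := by
    have := M.ι_sq x₂
    rwa [show M.form x₂ x₂ = 0 from hx₂, zero_div, map_zero] at this
  have h12 : incl Q x₁ * incl Q x₂ + incl Q x₂ * incl Q x₁ = 1 := by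
    have := M.ι_swap x₁ x₂
    rwa [show M.form x₁ x₂ = 1 from hx₁₂, map_one] at this
  have hr : ∀ x y, rev Q (incl Q x * incl Q y) = incl Q y * incl Q x := by
    intro x y
    have h1 := M.rev_mul (incl Q x) (incl Q y)
    have h2 := M.rev_ι x
    have h3 := M.rev_ι y
    change rev Q (incl Q x * incl Q y) = rev Q (incl Q y) * rev Q (incl Q x) at h1
    change rev Q (incl Q x) = incl Q x at h2
    change rev Q (incl Q y) = incl Q y at h3
    rw [h1, h2, h3]
  set A := incl Q x₁
  set B := incl Q x₂
  have hABA : A * B * A = A := by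
    have : A * (A * B + B * A) = A := by rw [h12, mul_one]
    rwa [mul_add, ← mul_assoc, h11, zero_mul, zero_add, ← mul_assoc] at this
  have hBAB : B * A * B = B := by
    have : B * (A * B + B * A) = B := by rw [h12, mul_one]
    rwa [mul_add, ← mul_assoc B B, h22, zero_mul, add_zero, ← mul_assoc] at this
  rw [muC, map_add, map_smul, hr, hr] at h
  set s : BreveQp p := (((Units.mk0 (p : BreveQp p) (prime_cast_ne_zero p))⁻¹ : (BreveQp p)ˣ) :
    BreveQp p) with hs
  have h1 : (s • (B * A) + A * B) * (s • (A * B) + B * A) = algebraMap _ _ s := by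
    have e1 : B * A * (A * B) = 0 := by rw [mul_assoc, ← mul_assoc A, h11]; simp
    have e2 : A * B * (B * A) = 0 := by rw [mul_assoc, ← mul_assoc B, h22]; simp
    have e3 : B * A * (B * A) = B * A := by rw [← mul_assoc, hBAB]
    have e4 : A * B * (A * B) = A * B := by rw [← mul_assoc, hABA]
    rw [add_mul, mul_add, mul_add, smul_mul_smul_comm, e1, smul_mul_assoc, e3, mul_smul_comm, e4,
      e2, smul_zero, zero_add, add_zero, ← smul_add, add_comm (B * A), h12,
      Algebra.algebraMap_eq_smul_one]
  rw [h1] at h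
  have h2 := (algebraMap (BreveQp p) (CBreve Q)).injective h
  simp only [hs, Units.val_inv_eq_inv_val, Units.val_zpow_eq_zpow_val, Units.val_mk0] at h2
  exact (HasVal.unique (x := (p : BreveQp p) ^ m) ⟨1, by simp⟩ ⟨1, by simp [← h2]⟩)

end FixedForm

section SquareClasses

variable {p : ℕ} [Fact p.Prime]

/-- The quadratic residue symbol on `ℤ_p^×`. -/
def sgn : ℤ_[p]ˣ →* ℤˣ :=
  (Units.map ((quadraticChar (ZMod p)).toMonoidHom)).comp
    (Units.map (PadicInt.toZMod (p := p)).toMonoidHom)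

theorem coe_sgn (u : ℤ_[p]ˣ) : ((sgn u : ℤˣ) : ℤ) = chi (u : ℤ_[p]) := rfl

theorem sgn_mul_self (u : ℤ_[p]ˣ) : sgn u * sgn u = 1 := Int.units_mul_self _

theorem toZMod_unit_ne_zero (u : ℤ_[p]ˣ) : PadicInt.toZMod (u : ℤ_[p]) ≠ 0 :=
  (u.isUnit.map PadicInt.toZMod).ne_zero

theorem toZMod_eq_zero_iff {x : ℤ_[p]} : PadicInt.toZMod x = 0 ↔ ¬IsUnit x := by
  rw [← RingHom.mem_ker, PadicInt.ker_toZMod, IsLocalRing.mem_maximalIdeal, mem_nonunits_iff]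

theorem isUnit_of_toZMod_ne_zero {x : ℤ_[p]} (h : PadicInt.toZMod x ≠ 0) : IsUnit x := by
  by_contra h'
  exact h (toZMod_eq_zero_iff.2 h')

theorem toZMod_surjective : Function.Surjective (PadicInt.toZMod (p := p)) :=
  ZMod.ringHom_surjective _

theorem isUnit_two (hp : p ≠ 2) : IsUnit (2 : ℤ_[p]) := by
  apply isUnit_of_toZMod_ne_zero
  rw [map_ofNat]
  have : ((2 : ℕ) : ZMod p) ≠ 0 := by
    rw [Ne, ZMod.natCast_eq_zero_iff]
    intro h
    exact hp ((Nat.prime_dvd_prime_iff_eq Fact.out Nat.prime_two).1 h)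
  exact_mod_cast this

/-- A unit congruent to a square is a square. -/
theorem exists_sq_eq_of_isSquare (hp : p ≠ 2) (u : ℤ_[p]ˣ)
    (h : IsSquare (PadicInt.toZMod (u : ℤ_[p]))) : ∃ w : ℤ_[p]ˣ, (w : ℤ_[p]) ^ 2 = u := by
  obtain ⟨a, ha⟩ := h
  obtain ⟨a, rfl⟩ := toZMod_surjective a
  have ha0 : IsUnit a := by
    apply isUnit_of_toZMod_ne_zero
    intro h0
    rw [h0, mul_zero] at ha
    exact toZMod_unit_ne_zero u ha
  let F : Polynomial ℤ_[p] := Polynomial.X ^ 2 - Polynomial.C (u : ℤ_[p])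
  have h1 : ‖Polynomial.aeval a F‖ < ‖Polynomial.aeval a F.derivative‖ ^ 2 := by
    have h2 : Polynomial.aeval a F = a ^ 2 - u := by simp [F]
    have h3 : Polynomial.aeval a F.derivative = 2 * a := by
      simp only [F, Polynomial.derivative_sub, Polynomial.derivative_X_pow, Polynomial.derivative_C]
      simp
    rw [h2, h3, PadicInt.isUnit_iff.1 ((isUnit_two hp).mul ha0), one_pow,
      ← PadicInt.mem_nonunits, mem_nonunits_iff, ← toZMod_eq_zero_iff, map_sub, map_pow, ha]
    ring
  obtain ⟨z, hz, -⟩ := hensels_lemma h1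
  have hz' : z ^ 2 = u := by
    have : Polynomial.aeval z F = z ^ 2 - u := by simp [F]
    rw [this] at hz
    exact sub_eq_zero.1 hz
  have hzu : IsUnit z := by
    have : IsUnit (z ^ 2) := by rw [hz']; exact u.isUnit
    exact (isUnit_pow_iff two_ne_zero).1 this
  exact ⟨hzu.unit, hz'⟩

theorem sgn_eq_one_iff_isSquare (u : ℤ_[p]ˣ) :
    sgn u = 1 ↔ IsSquare (PadicInt.toZMod (u : ℤ_[p])) := by
  rw [← quadraticChar_one_iff_isSquare (toZMod_unit_ne_zero u), ← Units.val_inj, coe_sgn]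
  rfl

theorem exists_sq_eq (hp : p ≠ 2) {u : ℤ_[p]ˣ} (h : sgn u = 1) :
    ∃ w : ℤ_[p]ˣ, (w : ℤ_[p]) ^ 2 = u :=
  exists_sq_eq_of_isSquare hp u ((sgn_eq_one_iff_isSquare u).1 h)

theorem exists_sgn_eq (hp : p ≠ 2) (s : ℤˣ) : ∃ u : ℤ_[p]ˣ, sgn u = s := by
  rcases Int.units_eq_one_or s with rfl | rfl
  · exact ⟨1, map_one _⟩
  · obtain ⟨a, ha⟩ := quadraticChar_exists_neg_one (F := ZMod p) (by rwa [ZMod.ringChar_zmod_n])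
    obtain ⟨a, rfl⟩ := toZMod_surjective a
    have hu : IsUnit a := by
      apply isUnit_of_toZMod_ne_zero
      intro h0
      rw [h0] at ha
      simp at ha
    exact ⟨hu.unit, Units.ext ha⟩

theorem sgn_eq_of_sq_mul {u w : ℤ_[p]ˣ} {r : ℤ_[p]ˣ} (h : (u : ℤ_[p]) = (r : ℤ_[p]) ^ 2 * w) :
    sgn u = sgn w := by
  have : u = r ^ 2 * w := Units.ext (by simpa using h)
  rw [this, map_mul, map_pow, pow_two, sgn_mul_self, one_mul]

/-- A unimodular binary form over `ℤ_p` represents every unit. -/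
theorem exists_repr (hp : p ≠ 2) (u₁ u₂ w : ℤ_[p]ˣ) :
    ∃ x y : ℤ_[p], (u₁ : ℤ_[p]) * x ^ 2 + (u₂ : ℤ_[p]) * y ^ 2 = w := by
  have key : ∀ (u₁ u₂ : ℤ_[p]ˣ) (x y : ℤ_[p]), IsUnit x →
      PadicInt.toZMod ((u₁ : ℤ_[p]) * x ^ 2 + (u₂ : ℤ_[p]) * y ^ 2) = PadicInt.toZMod (w : ℤ_[p]) →
      ∃ x y : ℤ_[p], (u₁ : ℤ_[p]) * x ^ 2 + (u₂ : ℤ_[p]) * y ^ 2 = w := by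
    intro u₁ u₂ x y hx h
    have h1 : PadicInt.toZMod ((↑u₁⁻¹ : ℤ_[p]) * ((w : ℤ_[p]) - (u₂ : ℤ_[p]) * y ^ 2)) = PadicInt.toZMod x ^ 2 := by
      rw [map_mul, map_sub, ← h, ← map_sub, add_sub_cancel_right, ← map_mul, ← mul_assoc,
        Units.inv_mul, one_mul, map_pow]
    have hu : IsUnit ((↑u₁⁻¹ : ℤ_[p]) * ((w : ℤ_[p]) - (u₂ : ℤ_[p]) * y ^ 2)) := by
      apply isUnit_of_toZMod_ne_zero
      rw [h1]
      exact pow_ne_zero _ (hx.map PadicInt.toZMod).ne_zero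
    obtain ⟨r, hr⟩ := exists_sq_eq_of_isSquare hp hu.unit ⟨PadicInt.toZMod x, by
      rw [IsUnit.unit_spec, h1, pow_two]⟩
    refine ⟨r, y, ?_⟩
    rw [hr, IsUnit.unit_spec, ← mul_assoc, Units.mul_inv, one_mul]
    ring
  let f : Polynomial (ZMod p) := Polynomial.C (PadicInt.toZMod (u₁ : ℤ_[p])) * Polynomial.X ^ 2
  let g : Polynomial (ZMod p) := Polynomial.C (PadicInt.toZMod (u₂ : ℤ_[p])) * Polynomial.X ^ 2 -
    Polynomial.C (PadicInt.toZMod (w : ℤ_[p]))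
  have hodd : Fintype.card (ZMod p) % 2 = 1 := by
    rw [ZMod.card]
    exact (Nat.Prime.eq_two_or_odd Fact.out).resolve_left hp
  have hf : f.degree = 2 := Polynomial.degree_C_mul_X_pow 2 (toZMod_unit_ne_zero u₁)
  have hg : g.degree = 2 := by
    rw [Polynomial.degree_sub_eq_left_of_degree_lt]
    · exact Polynomial.degree_C_mul_X_pow 2 (toZMod_unit_ne_zero u₂)
    · rw [Polynomial.degree_C_mul_X_pow 2 (toZMod_unit_ne_zero u₂)]
      exact lt_of_le_of_lt Polynomial.degree_C_le (by norm_num)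
  obtain ⟨a, b, hab⟩ := FiniteField.exists_root_sum_quadratic hf hg hodd
  obtain ⟨x, rfl⟩ := toZMod_surjective a
  obtain ⟨y, rfl⟩ := toZMod_surjective b
  have h : PadicInt.toZMod ((u₁ : ℤ_[p]) * x ^ 2 + (u₂ : ℤ_[p]) * y ^ 2) = PadicInt.toZMod (w : ℤ_[p]) := by
    simp only [f, g, Polynomial.eval_mul, Polynomial.eval_C, Polynomial.eval_pow,
      Polynomial.eval_X, Polynomial.eval_sub] at hab
    simp only [map_add, map_mul, map_pow]
    linear_combination hab
  by_cases hx : IsUnit x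
  · exact key u₁ u₂ x y hx h
  · have hy : IsUnit y := by
      by_contra hy
      rw [map_add, map_mul, map_mul, map_pow, map_pow, toZMod_eq_zero_iff.2 hx,
        toZMod_eq_zero_iff.2 hy] at h
      apply toZMod_unit_ne_zero w
      rw [← h]
      ring
    obtain ⟨x', y', h'⟩ := key u₂ u₁ y x hy (by rw [add_comm]; exact h)
    exact ⟨y', x', by rw [add_comm]; exact h'⟩

/-- Nonzero elements of `ℚ_p` are `p ^ k` times a unit. -/
theorem exists_eq_zpow_mul {x : ℚ_[p]} (hx : x ≠ 0) :
    ∃ u : ℤ_[p]ˣ, x = (p : ℚ_[p]) ^ x.valuation * ((u : ℤ_[p]) : ℚ_[p]) := by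
  have hp0 : (p : ℚ_[p]) ≠ 0 := Nat.cast_ne_zero.2 (Fact.out : p.Prime).ne_zero
  have h1 : ‖x * (p : ℚ_[p]) ^ (-x.valuation)‖ = 1 := by
    have hpr : (p : ℝ) ≠ 0 := Nat.cast_ne_zero.2 (Fact.out : p.Prime).ne_zero
    rw [norm_mul, Padic.norm_eq_zpow_neg_valuation hx, Padic.norm_p_zpow, neg_neg, ← zpow_add₀ hpr]
    simp
  refine ⟨PadicInt.mkUnits h1, ?_⟩
  rw [PadicInt.mkUnits_eq, mul_left_comm, ← zpow_add₀ hp0]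
  simp

theorem valuation_unit (u : ℤ_[p]ˣ) : ((u : ℤ_[p]) : ℚ_[p]).valuation = 0 := by
  have h : ‖((u : ℤ_[p]) : ℚ_[p])‖ = 1 := by
    rw [← PadicInt.norm_def]; exact PadicInt.norm_units u
  have h0 : ((u : ℤ_[p]) : ℚ_[p]) ≠ 0 := by
    intro h0; rw [h0, norm_zero] at h; exact zero_ne_one h
  rw [Padic.norm_eq_zpow_neg_valuation h0] at h
  have hp1 : (1 : ℝ) < p := by exact_mod_cast (Fact.out : p.Prime).one_lt
  have := (zpow_eq_one_iff_right₀ (by positivity) hp1.ne').1 h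
  omega

theorem unit_ne_zero (u : ℤ_[p]ˣ) : ((u : ℤ_[p]) : ℚ_[p]) ≠ 0 := by
  rw [Ne, PadicInt.coe_eq_zero]
  exact u.ne_zero

theorem padic_p_ne_zero : (p : ℚ_[p]) ≠ 0 := Nat.cast_ne_zero.2 (Fact.out : p.Prime).ne_zero

theorem padicInt_of_valuation_nonneg {x : ℚ_[p]} (h : 0 ≤ x.valuation) :
    ∃ y : ℤ_[p], (y : ℚ_[p]) = x :=
  ⟨⟨x, (Padic.norm_le_one_iff_val_nonneg x).2 h⟩, rfl⟩

/-- The norm form of the unramified quadratic extension has even valuations. -/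
theorem even_valuation_of_sgn {d : ℤ_[p]ˣ} (hd : sgn d = -1) (t s : ℚ_[p]) :
    (t ^ 2 - ((d : ℤ_[p]) : ℚ_[p]) * s ^ 2 = 0 → t = 0 ∧ s = 0) ∧
      Even (t ^ 2 - ((d : ℤ_[p]) : ℚ_[p]) * s ^ 2).valuation := by
  have hns : ∀ a : ℤ_[p], IsUnit (a ^ 2 - d) := by
    intro a
    apply isUnit_of_toZMod_ne_zero
    rw [map_sub, map_pow, sub_ne_zero]
    intro h
    have h1 := (sgn_eq_one_iff_isSquare d).2 ⟨PadicInt.toZMod a, by rw [← h, pow_two]⟩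
    rw [hd] at h1
    exact absurd h1 (by decide)
  have hone : ∀ a : ℚ_[p], a ^ 2 - ((d : ℤ_[p]) : ℚ_[p]) ≠ 0 ∧
      Even (a ^ 2 - ((d : ℤ_[p]) : ℚ_[p])).valuation := by
    intro a
    by_cases ha : 0 ≤ a.valuation
    · obtain ⟨b, rfl⟩ := padicInt_of_valuation_nonneg ha
      have h1 : (b : ℚ_[p]) ^ 2 - ((d : ℤ_[p]) : ℚ_[p]) = (((hns b).unit : ℤ_[p]) : ℚ_[p]) := by
        rw [IsUnit.unit_spec]; push_cast; ring
      rw [h1, valuation_unit]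
      exact ⟨unit_ne_zero _, by simp⟩
    · have ha0 : a ≠ 0 := by rintro rfl; simp at ha
      obtain ⟨c, hc⟩ : ∃ c : ℤ_[p], (c : ℚ_[p]) = a⁻¹ :=
        padicInt_of_valuation_nonneg (by rw [Padic.valuation_inv]; omega)
      have hc0 : ¬IsUnit c := by
        intro hu
        have := valuation_unit hu.unit
        rw [IsUnit.unit_spec, hc, Padic.valuation_inv] at this
        omega
      have hu : IsUnit (1 - d * c ^ 2) := by
        apply isUnit_of_toZMod_ne_zero
        rw [map_sub, map_mul, map_pow, toZMod_eq_zero_iff.2 hc0, map_one]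
        simp
      have h1 : a ^ 2 - ((d : ℤ_[p]) : ℚ_[p]) = a ^ 2 * ((hu.unit : ℤ_[p]) : ℚ_[p]) := by
        rw [IsUnit.unit_spec]
        push_cast
        rw [hc]
        field_simp
      rw [h1, Padic.valuation_mul (pow_ne_zero _ ha0) (unit_ne_zero _), valuation_unit, add_zero,
        Padic.valuation_pow]
      exact ⟨mul_ne_zero (pow_ne_zero _ ha0) (unit_ne_zero _), by simp⟩
  by_cases hs : s = 0
  · subst hs
    rw [zero_pow two_ne_zero, mul_zero, sub_zero, Padic.valuation_pow]
    exact ⟨fun h => ⟨pow_eq_zero_iff two_ne_zero |>.1 h, rfl⟩, by simp⟩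
  · have h1 : t ^ 2 - ((d : ℤ_[p]) : ℚ_[p]) * s ^ 2 =
        ((t / s) ^ 2 - ((d : ℤ_[p]) : ℚ_[p])) * s ^ 2 := by
      field_simp
    obtain ⟨h2, h3⟩ := hone (t / s)
    have h4 := pow_ne_zero 2 hs
    rw [h1]
    refine ⟨fun h => absurd h (mul_ne_zero h2 h4), ?_⟩
    rw [Padic.valuation_mul h2 h4, Padic.valuation_pow]
    exact h3.add (by simp)

end SquareClasses

section Hilbert

variable {p : ℕ} [Fact p.Prime]

theorem hilbertSymbol_comm {F : Type*} [Field F] (a b : F) :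
    hilbertSymbol a b = hilbertSymbol b a := by
  unfold hilbertSymbol
  congr 1
  apply propext
  constructor
  all_goals
    rintro ⟨x, y, z, h, h'⟩
    exact ⟨y, x, z, by tauto, by rw [h']; ring⟩

theorem hilbertSymbol_mul_sq {F : Type*} [Field F] (a b : F) {c : F} (hc : c ≠ 0) :
    hilbertSymbol (c ^ 2 * a) b = hilbertSymbol a b := by
  unfold hilbertSymbol
  congr 1
  apply propext
  constructor
  · rintro ⟨x, y, z, h, h'⟩
    refine ⟨c * x, y, z, by simpa [hc] using h, by rw [h']; ring⟩
  · rintro ⟨x, y, z, h, h'⟩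
    refine ⟨x / c, y, z, by simpa [hc] using h, by rw [h']; field_simp⟩

theorem hilbertSymbol_unit_unit (hp : p ≠ 2) (u w : ℤ_[p]ˣ) :
    hilbertSymbol ((u : ℤ_[p]) : ℚ_[p]) ((w : ℤ_[p]) : ℚ_[p]) = 1 := by
  obtain ⟨x, y, h⟩ := exists_repr hp u w 1
  rw [hilbertSymbol, if_pos]
  refine ⟨x, y, 1, by simp, ?_⟩
  have := congrArg (fun z : ℤ_[p] => (z : ℚ_[p])) h
  push_cast at this
  rw [this]
  simp

theorem hilbertSymbol_unit_p (hp : p ≠ 2) (u w : ℤ_[p]ˣ) :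
    hilbertSymbol ((u : ℤ_[p]) : ℚ_[p]) ((p : ℚ_[p]) * ((w : ℤ_[p]) : ℚ_[p])) = sgn u := by
  rcases Int.units_eq_one_or (sgn u) with h | h
  · obtain ⟨r, hr⟩ := exists_sq_eq hp h
    rw [h, hilbertSymbol, if_pos]
    refine ⟨1, 0, r, by simp, ?_⟩
    rw [← hr]
    push_cast
    ring
  · rw [h, hilbertSymbol, if_neg]
    rintro ⟨x, y, z, hne, heq⟩
    obtain ⟨h1, h2⟩ := even_valuation_of_sgn h z x
    have h3 : z ^ 2 - ((u : ℤ_[p]) : ℚ_[p]) * x ^ 2 = p * ((w : ℤ_[p]) : ℚ_[p]) * y ^ 2 := by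
      rw [heq]; ring
    by_cases hy : y = 0
    · subst hy
      obtain ⟨rfl, rfl⟩ := h1 (by rw [h3]; ring)
      simp at hne
    · rw [h3, Padic.valuation_mul (mul_ne_zero padic_p_ne_zero (unit_ne_zero w))
        (pow_ne_zero _ hy), Padic.valuation_mul padic_p_ne_zero (unit_ne_zero w), valuation_unit,
        Padic.valuation_p, Padic.valuation_pow] at h2
      push_cast at h2
      obtain ⟨k, hk⟩ := h2
      omega

theorem hilbertSymbol_p_p (hp : p ≠ 2) (u w : ℤ_[p]ˣ) :
    hilbertSymbol ((p : ℚ_[p]) * ((u : ℤ_[p]) : ℚ_[p])) ((p : ℚ_[p]) * ((w : ℤ_[p]) : ℚ_[p])) =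
      sgn (-1 : ℤ_[p]ˣ) * sgn u * sgn w := by
  have hs : sgn (-1 : ℤ_[p]ˣ) * sgn u * sgn w = sgn (-(w * u⁻¹)) := by
    rw [← neg_one_mul (w * u⁻¹), map_mul, map_mul, map_inv, Int.units_inv_eq_self, mul_assoc,
      mul_comm (sgn u)]
  have hu0 := unit_ne_zero u
  have hv : (((-(w * u⁻¹) : ℤ_[p]ˣ) : ℤ_[p]) : ℚ_[p]) * ((u : ℤ_[p]) : ℚ_[p]) =
      -((w : ℤ_[p]) : ℚ_[p]) := by
    rw [← PadicInt.coe_mul, ← Units.val_mul]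
    simp
  rw [hs]
  rcases Int.units_eq_one_or (sgn (-(w * u⁻¹))) with h | h
  · obtain ⟨r, hr⟩ := exists_sq_eq hp h
    rw [h, hilbertSymbol, if_pos]
    refine ⟨r, 1, 0, by simp, ?_⟩
    rw [← hr, PadicInt.coe_pow] at hv
    linear_combination (-(p : ℚ_[p])) * hv
  · rw [h, hilbertSymbol, if_neg]
    rintro ⟨x, y, z, hne, heq⟩
    obtain ⟨h1, h2⟩ := even_valuation_of_sgn h x y
    set d := (((-(w * u⁻¹) : ℤ_[p]ˣ) : ℤ_[p]) : ℚ_[p])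
    have h3 : z ^ 2 = (p * ((u : ℤ_[p]) : ℚ_[p])) * (x ^ 2 - d * y ^ 2) := by
      rw [heq]
      linear_combination ((p : ℚ_[p]) * y ^ 2) * hv
    by_cases h0 : x ^ 2 - d * y ^ 2 = 0
    · obtain ⟨rfl, rfl⟩ := h1 h0
      rw [h0, mul_zero] at h3
      have := pow_eq_zero_iff two_ne_zero |>.1 h3
      subst this
      simp at hne
    · have h4 := congrArg Padic.valuation h3
      rw [Padic.valuation_mul (mul_ne_zero padic_p_ne_zero hu0) h0,
        Padic.valuation_mul padic_p_ne_zero hu0, valuation_unit, Padic.valuation_p,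
        Padic.valuation_pow] at h4
      obtain ⟨k, hk⟩ := h2
      push_cast at h4
      omega

end Hilbert

section Moves

variable {F W : Type*} [Field F] [AddCommGroup W] [Module F W] {Q : QuadraticForm F W}
  {I : Type*}

theorem quad_combo (v w : W) (h : QuadraticMap.polar Q v w = 0) (x y : F) :
    Q (x • v + y • w) = x ^ 2 * Q v + y ^ 2 * Q w := by
  rw [QuadraticMap.map_add ⇑Q, QuadraticMap.map_smul, QuadraticMap.map_smul,
    QuadraticMap.polar_smul_left, QuadraticMap.polar_smul_right, h]
  simp only [smul_eq_mul]
  ring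

/-- Replace two vectors of an orthogonal frame by an orthogonal frame of their span. -/
theorem OrthFrame.exists_move [DecidableEq I] {v : I → W} (hv : OrthFrame Q v) {i j : I}
    (hij : i ≠ j) {x y z : F} (hD : Q (v i) * x ^ 2 + Q (v j) * y ^ 2 ≠ 0) (hz : z ≠ 0) :
    ∃ v' : I → W, OrthFrame Q v' ∧ Q (v' i) = Q (v i) * x ^ 2 + Q (v j) * y ^ 2 ∧
      Q (v' j) = z ^ 2 * (Q (v i) * Q (v j) * (Q (v i) * x ^ 2 + Q (v j) * y ^ 2)) ∧
      ∀ k, k ≠ i → k ≠ j → v' k = v k := by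
  set A := Q (v i) with hA
  set B := Q (v j) with hB
  set D := A * x ^ 2 + B * y ^ 2 with hDdef
  let a := x • v i + y • v j
  let b := (z * -(B * y)) • v i + (z * (A * x)) • v j
  have hp := hv.ortho i j hij
  have hp' := hv.ortho j i hij.symm
  have hQa : Q a = D := by
    rw [quad_combo _ _ hp]; ring
  have hQb : Q b = z ^ 2 * (A * B * D) := by
    rw [quad_combo _ _ hp]; ring
  have hpii : QuadraticMap.polar Q (v i) (v i) = 2 * A := by
    rw [QuadraticMap.polar_self, two_smul, two_mul]
  have hpjj : QuadraticMap.polar Q (v j) (v j) = 2 * B := by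
    rw [QuadraticMap.polar_self, two_smul, two_mul]
  have hab : QuadraticMap.polar Q a b = 0 := by
    simp only [a, b, QuadraticMap.polar_add_left, QuadraticMap.polar_add_right,
      QuadraticMap.polar_smul_left, QuadraticMap.polar_smul_right, hp, hp', hpii, hpjj,
      smul_eq_mul]
    ring
  have hak : ∀ k, k ≠ i → k ≠ j → QuadraticMap.polar Q a (v k) = 0 := by
    intro k hi hj
    simp only [a, QuadraticMap.polar_add_left, QuadraticMap.polar_smul_left,
      hv.ortho i k hi.symm, hv.ortho j k hj.symm, smul_zero, add_zero]
  have hbk : ∀ k, k ≠ i → k ≠ j → QuadraticMap.polar Q b (v k) = 0 := by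
    intro k hi hj
    simp only [b, QuadraticMap.polar_add_left, QuadraticMap.polar_smul_left,
      hv.ortho i k hi.symm, hv.ortho j k hj.symm, smul_zero, add_zero]
  let v' : I → W := fun k => if k = i then a else if k = j then b else v k
  have hvi : v' i = a := by simp [v']
  have hvj : v' j = b := by simp [v', hij.symm]
  have hvk : ∀ k, k ≠ i → k ≠ j → v' k = v k := fun k hi hj => by simp [v', hi, hj]
  refine ⟨v', ⟨?_, ?_, ?_⟩, by rw [hvi, hQa], by rw [hvj, hQb], hvk⟩
  · have key : ∀ k l, k ≠ l → l ≠ i → (l = j → k = i) → QuadraticMap.polar Q (v' k) (v' l) = 0 := by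
      intro k l hkl hli hlj
      by_cases hl : l = j
      · rw [hl, hvj, hlj hl, hvi, hab]
      · rw [hvk l hli hl]
        by_cases hki : k = i
        · rw [hki, hvi, hak l hli hl]
        · by_cases hkj : k = j
          · rw [hkj, hvj, hbk l hli hl]
          · rw [hvk k hki hkj, hv.ortho k l hkl]
    intro k l hkl
    by_cases h1 : l ≠ i ∧ (l = j → k = i)
    · exact key k l hkl h1.1 h1.2
    · rw [QuadraticMap.polar_comm]
      apply key l k hkl.symm
      · rintro rfl
        exact h1 ⟨hkl.symm, fun _ => rfl⟩
      · intro hk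
        by_contra hli
        exact h1 ⟨hli, fun hlj => absurd (hk.trans hlj.symm) hkl⟩
  · intro k
    by_cases hki : k = i
    · rw [hki, hvi, hQa]; exact hD
    · by_cases hkj : k = j
      · rw [hkj, hvj, hQb]
        exact mul_ne_zero (pow_ne_zero _ hz)
          (mul_ne_zero (mul_ne_zero (hv.ne_zero i) (hv.ne_zero j)) hD)
      · rw [hvk k hki hkj]; exact hv.ne_zero k
  · rw [eq_top_iff, ← hv.span, Submodule.span_le]
    have ha : a ∈ Submodule.span F (Set.range v') := hvi ▸ Submodule.subset_span ⟨i, rfl⟩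
    have hb : b ∈ Submodule.span F (Set.range v') := hvj ▸ Submodule.subset_span ⟨j, rfl⟩
    rintro _ ⟨k, rfl⟩
    by_cases hki : k = i
    · have h1 : v i = (D⁻¹ * (A * x)) • a + (D⁻¹ * -(y / z)) • b := by
        have e1 : D⁻¹ * (A * x) * x + D⁻¹ * -(y / z) * (z * -(B * y)) = 1 := by
          field_simp; rw [hDdef]; ring
        have e2 : D⁻¹ * (A * x) * y + D⁻¹ * -(y / z) * (z * (A * x)) = 0 := by
          field_simp; ring
        simp only [a, b, smul_add, smul_smul]
        rw [add_add_add_comm, ← add_smul, ← add_smul, e1, e2, one_smul, zero_smul, add_zero]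
      rw [hki, h1]
      exact add_mem (Submodule.smul_mem _ _ ha) (Submodule.smul_mem _ _ hb)
    · by_cases hkj : k = j
      · have h1 : v j = (D⁻¹ * (B * y)) • a + (D⁻¹ * (x / z)) • b := by
          have e1 : D⁻¹ * (B * y) * x + D⁻¹ * (x / z) * (z * -(B * y)) = 0 := by
            field_simp; ring
          have e2 : D⁻¹ * (B * y) * y + D⁻¹ * (x / z) * (z * (A * x)) = 1 := by
            field_simp; rw [hDdef]; ring
          simp only [a, b, smul_add, smul_smul]
          rw [add_add_add_comm, ← add_smul, ← add_smul, e1, e2, one_smul, zero_smul, zero_add]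
        rw [hkj, h1]
        exact add_mem (Submodule.smul_mem _ _ ha) (Submodule.smul_mem _ _ hb)
      · rw [← hvk k hki hkj]
        exact Submodule.subset_span ⟨k, rfl⟩

theorem OrthFrame.smul {v : I → W} (hv : OrthFrame Q v) {c : I → F} (hc : ∀ i, c i ≠ 0) :
    OrthFrame Q fun i => c i • v i where
  ortho i j hij := by
    rw [QuadraticMap.polar_smul_left, QuadraticMap.polar_smul_right, hv.ortho i j hij]
    simp
  ne_zero i := by
    rw [QuadraticMap.map_smul, smul_eq_mul]
    exact mul_ne_zero (mul_ne_zero (hc i) (hc i)) (hv.ne_zero i)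
  span := by
    rw [eq_top_iff, ← hv.span, Submodule.span_le]
    rintro _ ⟨i, rfl⟩
    have h1 : v i = (c i)⁻¹ • c i • v i := by rw [inv_smul_smul₀ (hc i)]
    rw [h1]
    exact Submodule.smul_mem _ _ (Submodule.subset_span ⟨i, rfl⟩)

theorem OrthFrame.comp_equiv {J : Type*} {v : I → W} (hv : OrthFrame Q v) (σ : J ≃ I) :
    OrthFrame Q (v ∘ σ) where
  ortho i j hij := hv.ortho _ _ (σ.injective.ne hij)
  ne_zero i := hv.ne_zero _
  span := by rw [σ.surjective.range_comp, hv.span]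

end Moves

section Padic

variable {p : ℕ} [Fact p.Prime] {W : Type*} [AddCommGroup W] [Module ℚ_[p] W]
  {Q : QuadraticForm ℚ_[p] W} {I : Type*}

/-- The values of an orthogonal frame on a `ϖ`-modular part can be prescribed, up to their
discriminant. -/
theorem OrthFrame.exists_realize [DecidableEq I] (hp : p ≠ 2) {ϖ : ℚ_[p]} (hϖ : ϖ ≠ 0)
    (S : Finset I) (u' : I → ℤ_[p]ˣ) : ∀ (v : I → W) (u : I → ℤ_[p]ˣ), OrthFrame Q v →
      (∀ i ∈ S, Q (v i) = ϖ * ((u i : ℤ_[p]) : ℚ_[p])) →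
      ∏ i ∈ S, sgn (u i) = ∏ i ∈ S, sgn (u' i) →
      ∃ v' : I → W, OrthFrame Q v' ∧ (∀ i ∈ S, Q (v' i) = ϖ * ((u' i : ℤ_[p]) : ℚ_[p])) ∧
        ∀ i ∉ S, Q (v' i) = Q (v i) := by
  induction S using Finset.induction_on with
  | empty => exact fun v u hv _ _ => ⟨v, hv, by simp, fun _ _ => rfl⟩
  | insert i S hi ih =>
    intro v u hv hu hprod
    rw [Finset.prod_insert hi, Finset.prod_insert hi] at hprod
    rcases S.eq_empty_or_nonempty with rfl | ⟨j, hj⟩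
    · simp only [Finset.prod_empty, mul_one] at hprod
      obtain ⟨r, hr⟩ := exists_sq_eq hp (u := u' i * (u i)⁻¹) (by
        rw [map_mul, map_inv, hprod, mul_inv_cancel])
      refine ⟨fun k => (if k = i then ((r : ℤ_[p]) : ℚ_[p]) else 1) • v k, hv.smul ?_, ?_, ?_⟩
      · intro k
        split
        · exact unit_ne_zero r
        · exact one_ne_zero
      · intro k hk
        rw [Finset.mem_insert] at hk
        have hk : k = i := by simpa using hk
        subst hk
        simp only [if_pos]
        rw [QuadraticMap.map_smul, hu k (by simp), smul_eq_mul]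
        have h1 : ((u' k : ℤ_[p]) : ℚ_[p]) =
            ((r : ℤ_[p]) : ℚ_[p]) ^ 2 * ((u k : ℤ_[p]) : ℚ_[p]) := by
          rw [← PadicInt.coe_pow, hr, ← PadicInt.coe_mul, ← Units.val_mul, inv_mul_cancel_right]
        rw [h1]
        ring
      · intro k hk
        have hk : k ≠ i := by simpa using hk
        simp only [if_neg hk, one_smul]
    · have hij : i ≠ j := by rintro rfl; exact hi hj
      obtain ⟨x, y, hxy⟩ := exists_repr hp (u i) (u j) (u' i)
      have hxy' : Q (v i) * (x : ℚ_[p]) ^ 2 + Q (v j) * (y : ℚ_[p]) ^ 2 =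
          ϖ * ((u' i : ℤ_[p]) : ℚ_[p]) := by
        rw [hu i (by simp), hu j (by simp [hj]), ← hxy]
        push_cast
        ring
      obtain ⟨v₁, hv₁, h1, h2, h3⟩ := hv.exists_move hij (x := x) (y := y) (z := ϖ⁻¹)
        (by rw [hxy']; exact mul_ne_zero hϖ (unit_ne_zero _)) (inv_ne_zero hϖ)
      rw [hxy'] at h1 h2
      let u₁ : I → ℤ_[p]ˣ := Function.update u j (u i * u j * u' i)
      obtain ⟨v₂, hv₂, h4, h5⟩ := ih v₁ u₁ hv₁ (by
        intro k hk
        by_cases hkj : k = j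
        · subst hkj
          simp only [u₁, Function.update_self]
          rw [h2, hu i (by simp), hu k (by simp [hk])]
          push_cast
          field_simp
        · have hki : k ≠ i := by rintro rfl; exact hi hk
          simp only [u₁, Function.update_of_ne hkj]
          rw [h3 k hki hkj, hu k (by simp [hk])]) (by
        rw [← Finset.mul_prod_erase S _ hj] at hprod ⊢
        have h6 : ∏ k ∈ S.erase j, sgn (u₁ k) = ∏ k ∈ S.erase j, sgn (u k) :=
          Finset.prod_congr rfl fun k hk => by
            simp only [u₁, Function.update_of_ne (Finset.ne_of_mem_erase hk)]
        rw [h6]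
        simp only [u₁, Function.update_self, map_mul]
        have h7 := sgn_mul_self (u' i)
        calc _ = sgn (u' i) * (sgn (u i) * (sgn (u j) * ∏ x ∈ S.erase j, sgn (u x))) := by ac_rfl
          _ = _ := by rw [hprod, ← mul_assoc, h7, one_mul])
      refine ⟨v₂, hv₂, ?_, ?_⟩
      · intro k hk
        rcases Finset.mem_insert.1 hk with rfl | hk
        · rw [h5 k hi, h1]
        · exact h4 k hk
      · intro k hk
        rw [Finset.mem_insert, not_or] at hk
        rw [h5 k hk.2, h3 k hk.1 (by rintro rfl; exact hk.2 hj)]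

end Padic

section Signature

variable {p : ℕ} [Fact p.Prime] {W : Type*} [AddCommGroup W] [Module ℚ_[p] W]

/-- The residue symbol of `(-1)^{a(a-1)/2} 2^a`: the sign by which the discriminant of an orthogonal
sum of `a` lines differs from the product of the residue symbols of the values of the form. -/
def normSign (hp : p ≠ 2) (a : ℕ) : ℤˣ :=
  sgn (-1 : ℤ_[p]ˣ) ^ a.choose 2 * sgn (isUnit_two hp).unit ^ a

theorem normSign_add_two (hp : p ≠ 2) (a : ℕ) :
    normSign hp (a + 2) = sgn (-1 : ℤ_[p]ˣ) * normSign hp a := by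
  have h : (a + 2).choose 2 = a.choose 2 + 2 * a + 1 := by
    rw [Nat.choose_succ_succ' (a + 1) 1, Nat.choose_succ_succ' a 1]
    simp
    ring
  simp only [normSign, h, pow_add, pow_mul, Int.units_sq, one_pow, mul_one, pow_one]
  ac_rfl

theorem normSign_zero (hp : p ≠ 2) : normSign hp 0 = 1 := by simp [normSign]

/-- `Q` is the orthogonal sum of `n - c` lines with values in `ϖ' ℤ_p^×` and `c` lines with values
in `ϖ ℤ_p^×`, with normalised discriminants of residue symbols `s` and `s'`. -/
def HasSig (hp : p ≠ 2) (ϖ ϖ' : ℚ_[p]) (Q : QuadraticForm ℚ_[p] W) (n c : ℕ) (s s' : ℤˣ) : Prop :=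
  ∃ (v : Fin n → W) (u : Fin n → ℤ_[p]ˣ) (S : Finset (Fin n)), OrthFrame Q v ∧ S.card = c ∧
    (∀ i ∈ S, Q (v i) = ϖ * ((u i : ℤ_[p]) : ℚ_[p])) ∧
    (∀ i ∉ S, Q (v i) = ϖ' * ((u i : ℤ_[p]) : ℚ_[p])) ∧
    normSign hp (n - c) * ∏ i ∈ Sᶜ, sgn (u i) = s ∧ normSign hp c * ∏ i ∈ S, sgn (u i) = s'

variable {hp : p ≠ 2} {ϖ ϖ' : ℚ_[p]} {Q : QuadraticForm ℚ_[p] W} {n c : ℕ} {s s' : ℤˣ}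

theorem HasSig.le (h : HasSig hp ϖ ϖ' Q n c s s') : c ≤ n := by
  obtain ⟨v, u, S, hv, hS, -⟩ := h
  rw [← hS]
  exact (Finset.card_le_univ S).trans (by simp)

theorem HasSig.swap (h : HasSig hp ϖ ϖ' Q n c s s') : HasSig hp ϖ' ϖ Q n (n - c) s' s := by
  have hle := h.le
  obtain ⟨v, u, S, hv, hS, h1, h2, h3, h4⟩ := h
  refine ⟨v, u, Sᶜ, hv, ?_, ?_, ?_, ?_, h3⟩
  · rw [Finset.card_compl, Fintype.card_fin, hS]
  · intro i hi; exact h2 i (Finset.mem_compl.1 hi)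
  · intro i hi; exact h1 i (by simpa using hi)
  · rw [compl_compl, Nat.sub_sub_self hle, h4]

theorem HasSig.eq_one_of_zero (h : HasSig hp ϖ ϖ' Q n 0 s s') : s' = 1 := by
  obtain ⟨v, u, S, hv, hS, h1, h2, h3, h4⟩ := h
  rw [Finset.card_eq_zero] at hS
  rw [← h4, hS, normSign_zero]
  simp

/-- The values of the frame can be prescribed. -/
theorem HasSig.realize (h : HasSig hp ϖ ϖ' Q n c s s') (hϖ : ϖ ≠ 0) (hϖ' : ϖ' ≠ 0)
    {S₀ : Finset (Fin n)} (hS₀ : S₀.card = c) {u₀ : Fin n → ℤ_[p]ˣ}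
    (hs : normSign hp (n - c) * ∏ i ∈ S₀ᶜ, sgn (u₀ i) = s)
    (hs' : normSign hp c * ∏ i ∈ S₀, sgn (u₀ i) = s') :
    ∃ v : Fin n → W, OrthFrame Q v ∧ (∀ i ∈ S₀, Q (v i) = ϖ * ((u₀ i : ℤ_[p]) : ℚ_[p])) ∧
      ∀ i ∉ S₀, Q (v i) = ϖ' * ((u₀ i : ℤ_[p]) : ℚ_[p]) := by
  obtain ⟨v, u, S, hv, hS, h1, h2, h3, h4⟩ := h
  obtain ⟨σ, hσ⟩ : ∃ σ : Equiv.Perm (Fin n), ∀ i, σ i ∈ S ↔ i ∈ S₀ := by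
    have e1 : {i // i ∈ S₀} ≃ {i // i ∈ S} := Finset.equivOfCardEq (by rw [hS, hS₀])
    refine ⟨e1.extendSubtype, fun i => ?_⟩
    constructor
    · intro hi
      by_contra hn
      exact e1.extendSubtype_not_mem i hn hi
    · intro hi
      exact e1.extendSubtype_mem i hi
  have hSm : S₀.map σ.toEmbedding = S := by
    ext i
    simp only [Finset.mem_map_equiv]
    rw [← hσ, Equiv.apply_symm_apply]
  have hprod : ∀ f : Fin n → ℤˣ, ∏ i ∈ S₀, f (σ i) = ∏ i ∈ S, f i := by
    intro f
    rw [← hSm, Finset.prod_map]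
    rfl
  have hprod' : ∀ f : Fin n → ℤˣ, ∏ i ∈ S₀ᶜ, f (σ i) = ∏ i ∈ Sᶜ, f i := by
    intro f
    refine Finset.prod_equiv σ (fun i => ?_) fun _ _ => rfl
    rw [Finset.mem_compl, Finset.mem_compl, hσ]
  obtain ⟨v₁, hv₁, h5, h6⟩ := OrthFrame.exists_realize hp hϖ S₀ u₀ (v ∘ σ) (u ∘ σ)
    (hv.comp_equiv σ) (fun i hi => h1 _ ((hσ i).2 hi)) (by
      simp only [Function.comp_apply]
      rw [hprod (fun i => sgn (u i))]
      exact mul_left_cancel (h4.trans hs'.symm))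
  obtain ⟨v₂, hv₂, h7, h8⟩ := OrthFrame.exists_realize hp hϖ' S₀ᶜ u₀ v₁ (u ∘ σ)
    hv₁ (fun i hi => by
      rw [h6 i (Finset.mem_compl.1 hi)]
      exact h2 _ (by rw [hσ]; exact Finset.mem_compl.1 hi)) (by
      simp only [Function.comp_apply]
      rw [hprod' (fun i => sgn (u i))]
      exact mul_left_cancel (h3.trans hs.symm))
  refine ⟨v₂, hv₂, fun i hi => ?_, fun i hi => h7 i (Finset.mem_compl.2 hi)⟩
  rw [h8 i (by simpa using hi), h5 i hi]

theorem exists_prod_sgn (hp : p ≠ 2) {I : Type*} [DecidableEq I] {R : Finset I} (τ : ℤˣ)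
    (h : R.Nonempty ∨ τ = 1) : ∃ w : I → ℤ_[p]ˣ, ∏ i ∈ R, sgn (w i) = τ := by
  rcases R.eq_empty_or_nonempty with rfl | ⟨k, hk⟩
  · exact ⟨1, by simpa [eq_comm] using h⟩
  · obtain ⟨δ, hδ⟩ := exists_sgn_eq hp τ
    refine ⟨Function.update 1 k δ, ?_⟩
    rw [Finset.prod_eq_single k]
    · rw [Function.update_self, hδ]
    · intro i _ hi
      rw [Function.update_of_ne hi]
      exact map_one _
    · exact fun h => absurd hk h

/-- A hyperbolic plane can be moved from the `ϖ`-modular part to the `ϖ'`-modular part. -/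
theorem HasSig.down (h : HasSig hp ϖ ϖ' Q n (c + 2) s s') (hϖ : ϖ ≠ 0) (hϖ' : ϖ' ≠ 0)
    (hc : 1 ≤ c ∨ s' = 1) : HasSig hp ϖ ϖ' Q n c s s' := by
  have hle := h.le
  have h' := h
  obtain ⟨v, u, S, hv, hS, h1, h2, h3, h4⟩ := h'
  obtain ⟨i, hi, j, hj, hij⟩ := Finset.one_lt_card.1 (show 1 < S.card by omega)
  set R := (S.erase i).erase j with hR
  have hjS : j ∈ S.erase i := Finset.mem_erase.2 ⟨hij.symm, hj⟩
  have hRc : R.card = c := by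
    rw [hR, Finset.card_erase_of_mem hjS, Finset.card_erase_of_mem hi, hS]
    rfl
  have hiR : i ∉ R := by simp [hR]
  have hjR : j ∉ R := by simp [hR]
  obtain ⟨w, hw⟩ := exists_prod_sgn hp (R := R) (s' * normSign hp c) (by
    rcases hc with hc | hc
    · left
      rw [← Finset.card_pos]
      omega
    · rcases Nat.eq_zero_or_pos c with rfl | hc'
      · right; rw [hc, normSign_zero, one_mul]
      · left; rw [← Finset.card_pos]; omega)
  let u₀ : Fin n → ℤ_[p]ˣ := fun k => if k ∈ R then w k else if k = i then 1 else if k = j then -1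
    else u k
  have hu₀R : ∀ k ∈ R, u₀ k = w k := fun k hk => by simp [u₀, hk]
  have hu₀i : u₀ i = 1 := by simp [u₀, hiR]
  have hu₀j : u₀ j = -1 := by simp [u₀, hjR, hij.symm]
  have hu₀S : ∀ k ∉ S, u₀ k = u k := by
    intro k hk
    have hki : k ≠ i := by rintro rfl; exact hk hi
    have hkj : k ≠ j := by rintro rfl; exact hk hj
    have hkR : k ∉ R := fun h => hk (Finset.mem_of_mem_erase (Finset.mem_of_mem_erase h))
    simp [u₀, hki, hkj, hkR]
  have hprodR : ∏ k ∈ R, sgn (u₀ k) = s' * normSign hp c := by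
    rw [← hw]
    exact Finset.prod_congr rfl fun k hk => by rw [hu₀R k hk]
  have hprodS : ∏ k ∈ S, sgn (u₀ k) = sgn (-1 : ℤ_[p]ˣ) * (s' * normSign hp c) := by
    rw [← Finset.mul_prod_erase S _ hi, ← Finset.mul_prod_erase _ _ hjS, hprodR, hu₀i, hu₀j, map_one,
      one_mul]
  have hprodSc : ∏ k ∈ Sᶜ, sgn (u₀ k) = ∏ k ∈ Sᶜ, sgn (u k) :=
    Finset.prod_congr rfl fun k hk => by rw [hu₀S k (Finset.mem_compl.1 hk)]
  have hss := Int.units_mul_self (sgn (-1 : ℤ_[p]ˣ))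
  have hnn := Int.units_mul_self (normSign hp c)
  obtain ⟨v₁, hv₁, h5, h6⟩ := h.realize hϖ hϖ' (u₀ := u₀) hS (by rw [hprodSc, h3]) (by
    rw [hprodS, normSign_add_two]
    calc _ = (sgn (-1 : ℤ_[p]ˣ) * sgn (-1 : ℤ_[p]ˣ)) * (normSign hp c * normSign hp c) * s' := by
          ac_rfl
      _ = s' := by rw [hss, hnn, one_mul, one_mul])
  have hQi : Q (v₁ i) = ϖ := by rw [h5 i hi, hu₀i]; simp
  have hQj : Q (v₁ j) = -ϖ := by rw [h5 j hj, hu₀j]; simp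
  have hval : Q (v₁ i) * ((1 + ϖ' / ϖ) / 2) ^ 2 + Q (v₁ j) * ((1 - ϖ' / ϖ) / 2) ^ 2 = ϖ' := by
    rw [hQi, hQj]
    field_simp
    ring
  obtain ⟨v₂, hv₂, h7, h8, h9⟩ := hv₁.exists_move hij (z := ϖ⁻¹) (by rw [hval]; exact hϖ')
    (inv_ne_zero hϖ)
  rw [hval] at h7 h8
  rw [hQi, hQj] at h8
  refine ⟨v₂, u₀, R, hv₂, hRc, ?_, ?_, ?_, ?_⟩
  · intro k hk
    have hkS : k ∈ S := Finset.mem_of_mem_erase (Finset.mem_of_mem_erase hk)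
    rw [h9 k (by rintro rfl; exact hiR hk) (by rintro rfl; exact hjR hk), h5 k hkS]
  · intro k hk
    by_cases hki : k = i
    · rw [hki, h7, hu₀i]; simp
    · by_cases hkj : k = j
      · rw [hkj, h8, hu₀j]
        push_cast
        field_simp
      · have hkS : k ∉ S := fun h => hk (by simp [hR, h, hki, hkj])
        rw [h9 k hki hkj, h6 k hkS]
  · have hcompl : ∏ k ∈ Rᶜ, sgn (u₀ k) = sgn (-1 : ℤ_[p]ˣ) * ∏ k ∈ Sᶜ, sgn (u₀ k) := by
      have e1 : Rᶜ = insert i (insert j Sᶜ) := by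
        ext k
        simp only [hR, Finset.mem_compl, Finset.mem_erase, Finset.mem_insert]
        tauto
      rw [e1, Finset.prod_insert (by simp [hij, hi]), Finset.prod_insert (by simp [hj]), hu₀i, hu₀j,
        map_one, one_mul]
    have e2 : n - c = n - (c + 2) + 2 := by omega
    rw [hcompl, hprodSc, e2, normSign_add_two, ← h3]
    calc _ = (sgn (-1 : ℤ_[p]ˣ) * sgn (-1 : ℤ_[p]ˣ)) * (normSign hp (n - (c + 2)) *
          ∏ k ∈ Sᶜ, sgn (u k)) := by ac_rfl
      _ = _ := by rw [hss, one_mul]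
  · rw [hprodR, mul_left_comm, hnn, mul_one]

theorem HasSig.up (h : HasSig hp ϖ ϖ' Q n c s s') (hϖ : ϖ ≠ 0) (hϖ' : ϖ' ≠ 0)
    (hc : c + 3 ≤ n ∨ (c + 2 ≤ n ∧ s = 1)) : HasSig hp ϖ ϖ' Q n (c + 2) s s' := by
  have h1 := h.swap
  have e1 : n - c = n - (c + 2) + 2 := by omega
  rw [e1] at h1
  have h2 := (h1.down hϖ' hϖ (hc.imp (by omega) And.right)).swap
  rwa [Nat.sub_sub_self (by omega)] at h2

/-- In dimension at least three one of the types `1` and `2` occurs. -/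
theorem HasSig.normalize (hn3 : 3 ≤ n) (hϖ : ϖ ≠ 0) (hϖ' : ϖ' ≠ 0) :
    ∀ c, HasSig hp ϖ ϖ' Q n c s s' →
      HasSig hp ϖ ϖ' Q n (if Even c then 2 else 1) s s' := by
  intro c
  induction c using Nat.strong_induction_on with
  | _ c ih =>
    intro h
    match c, ih, h with
    | 0, _, h => simpa using h.up hϖ hϖ' (by omega)
    | 1, _, h => simpa using h
    | 2, _, h => simpa using h
    | c + 3, ih, h =>
      have h1 := ih (c + 1) (by omega) (HasSig.down (c := c + 1) h hϖ hϖ' (by omega))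
      have h2 : Even (c + 3) ↔ Even (c + 1) := by simp only [Nat.even_add_one]; tauto
      simpa only [h2] using h1

/-- The minimal type. -/
theorem HasSig.toMin (hn3 : 3 ≤ n) (hϖ : ϖ ≠ 0) (hϖ' : ϖ' ≠ 0)
    (h : HasSig hp ϖ ϖ' Q n c s s') :
    HasSig hp ϖ ϖ' Q n (if Even c then (if s' = 1 then 0 else 2) else 1) s s' := by
  have h1 := HasSig.normalize hn3 hϖ hϖ' c h
  by_cases hc : Even c
  · rw [if_pos hc] at h1 ⊢
    split
    · next hs => exact HasSig.down (c := 0) h1 hϖ hϖ' (Or.inr hs)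
    · exact h1
  · rw [if_neg hc] at h1 ⊢
    exact h1

theorem OrthFrame.hasSig {v : Fin n → W} (hv : OrthFrame Q v) {u : Fin n → ℤ_[p]ˣ} {k : Fin n → ℤ}
    (hk : ∀ i, Q (v i) = (p : ℚ_[p]) ^ k i * ((u i : ℤ_[p]) : ℚ_[p])) {S : Finset (Fin n)}
    (hS : ∀ i, i ∈ S ↔ Odd (k i)) :
    HasSig hp p 1 Q n S.card (normSign hp (n - S.card) * ∏ i ∈ Sᶜ, sgn (u i))
      (normSign hp S.card * ∏ i ∈ S, sgn (u i)) := by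
  have hp0 : (p : ℚ_[p]) ≠ 0 := padic_p_ne_zero
  refine ⟨fun i => ((p : ℚ_[p]) ^ (-(k i / 2))) • v i, u, S, hv.smul fun i => zpow_ne_zero _ hp0,
    rfl, ?_, ?_, rfl, rfl⟩
  · intro i hi
    obtain ⟨l, hl⟩ := (hS i).1 hi
    have e1 : k i / 2 = l := by omega
    rw [QuadraticMap.map_smul, hk, e1, hl, smul_eq_mul, ← mul_assoc, ← zpow_add₀ hp0,
      ← zpow_add₀ hp0]
    congr 1
    have : -l + -l + (2 * l + 1) = 1 := by ring
    rw [this, zpow_one]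
  · intro i hi
    rw [hS, Int.not_odd_iff_even] at hi
    obtain ⟨l, hl⟩ := hi
    have e1 : k i / 2 = l := by omega
    rw [QuadraticMap.map_smul, hk, e1, hl, smul_eq_mul, ← mul_assoc, ← zpow_add₀ hp0,
      ← zpow_add₀ hp0]
    congr 1
    have : -l + -l + (l + l) = 0 := by ring
    rw [this, zpow_zero]

theorem OrthFrame.exists_hasSig (hp : p ≠ 2) {v : Fin n → W} (hv : OrthFrame Q v) :
    ∃ c s s', HasSig hp p 1 Q n c s s' := by
  classical
  have h := fun i => exists_eq_zpow_mul (hv.ne_zero i)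
  choose u hu using h
  exact ⟨_, _, _, hv.hasSig (S := Finset.univ.filter fun i => Odd (Q (v i)).valuation) hu (by simp)⟩

/-- The product of the values of a frame. -/
theorem HasSig.exists_prod (h : HasSig hp p 1 Q n c s s') :
    ∃ (v : Fin n → W) (U : ℤ_[p]ˣ), OrthFrame Q v ∧
      ∏ i, Q (v i) = (p : ℚ_[p]) ^ c * ((U : ℤ_[p]) : ℚ_[p]) ∧
      sgn U = normSign hp (n - c) * normSign hp c * (s * s') := by
  obtain ⟨v, u, S, hv, hS, h1, h2, h3, h4⟩ := h
  refine ⟨v, ∏ i, u i, hv, ?_, ?_⟩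
  · rw [← Finset.prod_mul_prod_compl S, Finset.prod_congr rfl h1,
      Finset.prod_congr rfl fun i hi => h2 i (Finset.mem_compl.1 hi), Finset.prod_mul_distrib,
      Finset.prod_const, hS]
    simp only [one_mul]
    rw [mul_assoc, Finset.prod_mul_prod_compl S fun i => ((u i : ℤ_[p]) : ℚ_[p])]
    congr 1
    rw [Units.coe_prod]
    exact (map_prod PadicInt.Coe.ringHom _ _).symm
  · rw [map_prod, ← Finset.prod_mul_prod_compl S, ← h3, ← h4]
    have e1 := Int.units_mul_self (normSign hp c)
    have e2 := Int.units_mul_self (normSign hp (n - c))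
    calc _ = 1 * 1 * ((∏ i ∈ S, sgn (u i)) * ∏ i ∈ Sᶜ, sgn (u i)) := by rw [one_mul, one_mul]
      _ = _ := by rw [← e1]; nth_rewrite 2 [e1]; rw [← e2]; ac_rfl

variable {W' : Type*} [AddCommGroup W'] [Module ℚ_[p] W'] {q : QuadraticForm ℚ_[p] W'}

/-- Two spaces of the same dimension and discriminant that are not isometric have opposite
signatures. -/
theorem HasSig.opposite (hn3 : 3 ≤ n)
    (hdisc : ∀ (v : Fin n → W) (w : Fin n → W'), OrthFrame Q v → OrthFrame q w →
      ∃ r : ℚ_[p], ∏ i, q (w i) = r ^ 2 * ∏ i, Q (v i))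
    (hiso : ∀ (v : Fin n → W) (w : Fin n → W'), OrthFrame Q v → OrthFrame q w →
      ¬∀ i, q (w i) = Q (v i))
    {d : ℕ} {t t' : ℤˣ} (hQ : HasSig hp p 1 Q n c s s') (hq : HasSig hp p 1 q n d t t') :
    (Even d ↔ Even c) ∧ t = -s ∧ t' = -s' := by
  have hp0 : (p : ℚ_[p]) ≠ 0 := padic_p_ne_zero
  have hQ' := HasSig.normalize hn3 hp0 one_ne_zero c hQ
  have hq' := HasSig.normalize hn3 hp0 one_ne_zero d hq
  obtain ⟨v, U, hv, hvp, hU⟩ := hQ'.exists_prod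
  obtain ⟨w, U', hw, hwp, hU'⟩ := hq'.exists_prod
  obtain ⟨r, hr⟩ := hdisc v w hv hw
  rw [hvp, hwp] at hr
  have hr0 : r ≠ 0 := by
    rintro rfl
    rw [zero_pow two_ne_zero, zero_mul] at hr
    exact mul_ne_zero (pow_ne_zero _ hp0) (unit_ne_zero U') hr
  have hval := congrArg Padic.valuation hr
  rw [Padic.valuation_mul (pow_ne_zero _ hp0) (unit_ne_zero _), valuation_unit, Padic.valuation_pow,
    Padic.valuation_p, Padic.valuation_mul (pow_ne_zero _ hr0)
      (mul_ne_zero (pow_ne_zero _ hp0) (unit_ne_zero _)), Padic.valuation_pow,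
    Padic.valuation_mul (pow_ne_zero _ hp0) (unit_ne_zero _), valuation_unit, Padic.valuation_pow,
    Padic.valuation_p] at hval
  have hpar : Even d ↔ Even c := by
    by_cases h1 : Even d <;> by_cases h2 : Even c <;> simp only [h1, h2, if_true, if_false] at hval ⊢
    all_goals push_cast at hval; omega
  have hce : (if Even d then 2 else 1) = if Even c then 2 else 1 := by simp only [hpar]
  rw [hce] at hq' hr hval hU'
  set e := if Even c then 2 else 1 with he
  have hrv : r.valuation = 0 := by omega
  obtain ⟨r', hr'⟩ := exists_eq_zpow_mul hr0
  rw [hrv, zpow_zero, one_mul] at hr'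
  have hUU : ((U' : ℤ_[p]) : ℚ_[p]) = ((r' : ℤ_[p]) : ℚ_[p]) ^ 2 * ((U : ℤ_[p]) : ℚ_[p]) := by
    rw [hr', mul_left_comm] at hr
    exact mul_left_cancel₀ (pow_ne_zero _ hp0) hr
  have hUU' : (U' : ℤ_[p]) = (r' : ℤ_[p]) ^ 2 * U := by
    have h1 : ((U' : ℤ_[p]) : ℚ_[p]) = (((r' : ℤ_[p]) ^ 2 * U : ℤ_[p]) : ℚ_[p]) := by
      rw [hUU, PadicInt.coe_mul, PadicInt.coe_pow]
    exact PadicInt.ext h1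
  have hsg := sgn_eq_of_sq_mul hUU'
  rw [hU, hU'] at hsg
  have hprod : t * t' = s * s' := mul_left_cancel hsg
  refine ⟨hpar, ?_⟩
  by_cases hts : t = s
  · exfalso
    have hts' : t' = s' := by
      rw [hts] at hprod
      exact mul_left_cancel hprod
    rw [hts, hts'] at hq'
    obtain ⟨v, u, S, hv, hS, h1, h2, h3, h4⟩ := hQ'
    obtain ⟨w, hw, h5, h6⟩ := hq'.realize hp0 one_ne_zero hS h3 h4
    refine hiso v w hv hw fun i => ?_
    by_cases hi : i ∈ S
    · rw [h1 i hi, h5 i hi]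
    · rw [h2 i hi, h6 i hi]
  · have hts2 : t = -s := by
      rcases Int.units_eq_one_or t with rfl | rfl <;> rcases Int.units_eq_one_or s with rfl | rfl <;>
        simp_all
    refine ⟨hts2, ?_⟩
    rw [hts2, neg_mul] at hprod
    have h1 : s * (-t') = s * s' := by rw [mul_neg, hprod]
    rw [← mul_left_cancel h1, neg_neg]

end Signature

section Hasse

variable {p : ℕ} [Fact p.Prime] {W : Type*} [AddCommGroup W] [Module ℚ_[p] W]

theorem hilbertSymbol_zpow (hp : p ≠ 2) (k l : ℤ) (u w : ℤ_[p]ˣ) :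
    hilbertSymbol ((p : ℚ_[p]) ^ k * ((u : ℤ_[p]) : ℚ_[p]))
        ((p : ℚ_[p]) ^ l * ((w : ℤ_[p]) : ℚ_[p])) =
      sgn (-1 : ℤ_[p]ˣ) ^ ((if Odd k then 1 else 0) * (if Odd l then 1 else 0)) *
        (sgn u ^ (if Odd l then 1 else 0) * sgn w ^ (if Odd k then 1 else 0)) := by
  have hp0 : (p : ℚ_[p]) ≠ 0 := padic_p_ne_zero
  have red : ∀ (k : ℤ) (u : ℤ_[p]ˣ), ∃ c : ℚ_[p], c ≠ 0 ∧
      (p : ℚ_[p]) ^ k * ((u : ℤ_[p]) : ℚ_[p]) =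
        c ^ 2 * (if Odd k then p * ((u : ℤ_[p]) : ℚ_[p]) else ((u : ℤ_[p]) : ℚ_[p])) := by
    intro k u
    refine ⟨(p : ℚ_[p]) ^ (k / 2), zpow_ne_zero _ hp0, ?_⟩
    split
    · next h =>
      obtain ⟨m, hm⟩ := h
      have e1 : k / 2 = m := by omega
      rw [e1, hm, zpow_add₀ hp0, zpow_one, two_mul, zpow_add₀ hp0]
      ring
    · next h =>
      rw [Int.not_odd_iff_even] at h
      obtain ⟨m, hm⟩ := h
      have e1 : k / 2 = m := by omega
      rw [e1, hm, zpow_add₀ hp0]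
      ring
  obtain ⟨c, hc, h1⟩ := red k u
  obtain ⟨d, hd, h2⟩ := red l w
  rw [h1, h2, hilbertSymbol_mul_sq _ _ hc, hilbertSymbol_comm, hilbertSymbol_mul_sq _ _ hd,
    hilbertSymbol_comm]
  by_cases hk : Odd k <;> by_cases hl : Odd l <;> simp only [hk, hl, if_true, if_false]
  · rw [hilbertSymbol_p_p hp]; simp [mul_assoc]
  · rw [hilbertSymbol_comm, hilbertSymbol_unit_p hp]; simp
  · rw [hilbertSymbol_unit_p hp]; simp
  · rw [hilbertSymbol_unit_unit hp]; simp

theorem sum_pairs {n : ℕ} (S : Finset (Fin n)) :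
    ∑ i : Fin n, ∑ j ∈ Finset.Ioi i, (if i ∈ S then 1 else 0) * (if j ∈ S then 1 else 0) =
      S.card.choose 2 := by
  set α : Fin n → ℕ := fun i => if i ∈ S then 1 else 0 with hα
  have h0 : ∑ i, α i = S.card := by simp [hα]
  have h1 := Finset.sum_sum_Ioi_add_eq_sum_sum_off_diag fun i j => α i * α j
  have h2 : ∀ i, ∑ j ∈ ({i}ᶜ : Finset (Fin n)), α j * α i + α i = S.card * α i := by
    intro i
    have e1 : α i * α i = α i := by simp only [hα]; split <;> rfl
    have e2 := Finset.sum_add_sum_compl ({i} : Finset (Fin n)) fun j => α j * α i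
    rw [← Finset.sum_mul (Finset.univ), h0, Finset.sum_singleton, e1] at e2
    omega
  have h3 : ∑ i, (∑ j ∈ ({i}ᶜ : Finset (Fin n)), α j * α i) + S.card = S.card * S.card := by
    have := Finset.sum_congr rfl fun i (_ : i ∈ Finset.univ) => h2 i
    rw [Finset.sum_add_distrib, h0, ← Finset.mul_sum, h0] at this
    exact this
  have h4 : ∑ i, ∑ j ∈ Finset.Ioi i, (α j * α i + α i * α j) =
      2 * ∑ i, ∑ j ∈ Finset.Ioi i, α i * α j := by
    rw [Finset.mul_sum]
    refine Finset.sum_congr rfl fun i _ => ?_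
    rw [Finset.mul_sum]
    exact Finset.sum_congr rfl fun j _ => by ring
  rw [h4] at h1
  rw [← h1] at h3
  rw [Nat.choose_two_right]
  change ∑ i, ∑ j ∈ Finset.Ioi i, α i * α j = _
  have h5 : S.card * (S.card - 1) = 2 * ∑ i, ∑ j ∈ Finset.Ioi i, α i * α j := by
    rw [Nat.mul_sub, mul_one]
    omega
  rw [h5]
  simp

theorem prod_pairs {n : ℕ} (S : Finset (Fin n)) (χ : Fin n → ℤˣ) :
    ∏ i : Fin n, ∏ j ∈ Finset.Ioi i, (χ i ^ (if j ∈ S then 1 else 0) * χ j ^ (if i ∈ S then 1 else 0)) =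
      (∏ i, χ i) ^ S.card * ∏ i ∈ S, χ i := by
  have h1 := Finset.prod_prod_Ioi_mul_eq_prod_prod_off_diag
    fun i j => χ i ^ (if j ∈ S then 1 else 0)
  simp only [mul_comm] at h1 ⊢
  rw [h1]
  have h2 : ∀ i, ∏ j ∈ ({i}ᶜ : Finset (Fin n)), χ j ^ (if i ∈ S then 1 else 0) =
      (∏ j, χ j) ^ (if i ∈ S then 1 else 0) * χ i ^ (if i ∈ S then 1 else 0) := by
    intro i
    have e := Finset.prod_mul_prod_compl ({i} : Finset (Fin n))
      fun j => χ j ^ (if i ∈ S then 1 else 0)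
    rw [Finset.prod_singleton] at e
    rw [← Finset.prod_pow, ← e, mul_comm, ← mul_assoc, Int.units_mul_self, one_mul]
  rw [Finset.prod_congr rfl fun i _ => h2 i, Finset.prod_mul_distrib, Finset.prod_pow_eq_pow_sum]
  simp only [Finset.sum_boole, Finset.filter_univ_mem, Nat.cast_id, pow_ite, pow_one, pow_zero]
  rw [Finset.prod_ite_mem, Finset.univ_inter, mul_comm]

theorem normSign_sub_mul (hp : p ≠ 2) {n : ℕ} (k : ℕ) (h : 2 * k + 1 ≤ n) :
    normSign hp (n - (2 * k + 1)) * sgn (-1 : ℤ_[p]ˣ) ^ (2 * k + 1).choose 2 =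
      normSign hp (n - 1) := by
  induction k with
  | zero => simp
  | succ k ih =>
    rw [← ih (by omega)]
    have e1 : n - (2 * k + 1) = n - (2 * (k + 1) + 1) + 2 := by omega
    have e2 : (2 * (k + 1) + 1).choose 2 = (2 * k + 1).choose 2 + 2 * (2 * k + 1) + 1 := by
      rw [show 2 * (k + 1) + 1 = (2 * k + 1) + 2 by ring, Nat.choose_succ_succ' (2 * k + 1 + 1) 1,
        Nat.choose_succ_succ' (2 * k + 1) 1]
      simp
      ring
    rw [e1, normSign_add_two, e2]
    simp only [pow_add, pow_mul, Int.units_sq, one_pow, mul_one, pow_one]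
    ac_rfl

/-- The Hasse invariant of a space with given signature. -/
def sigHasse (hp : p ≠ 2) (n c : ℕ) (s s' : ℤˣ) : ℤˣ :=
  if Even c then s' else normSign hp (n - 1) * s

theorem OrthFrame.prod_hilbertSymbol (hp : p ≠ 2) {Q : QuadraticForm ℚ_[p] W} {n : ℕ}
    {v : Fin n → W} (hv : OrthFrame Q v) :
    ∃ c s s', HasSig hp p 1 Q n c s s' ∧
      ∏ i, ∏ j ∈ Finset.Ioi i, hilbertSymbol (Q (v i)) (Q (v j)) = sigHasse hp n c s s' := by
  classical
  have h := fun i => exists_eq_zpow_mul (hv.ne_zero i)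
  choose u hu using h
  set S : Finset (Fin n) := Finset.univ.filter fun i => Odd (Q (v i)).valuation with hSdef
  have hS : ∀ i, i ∈ S ↔ Odd (Q (v i)).valuation := by simp [hSdef]
  have hsig := hv.hasSig (hp := hp) hu hS
  refine ⟨_, _, _, hsig, ?_⟩
  have h1 : ∀ i j, hilbertSymbol (Q (v i)) (Q (v j)) =
      sgn (-1 : ℤ_[p]ˣ) ^ ((if i ∈ S then 1 else 0) * (if j ∈ S then 1 else 0)) *
        (sgn (u i) ^ (if j ∈ S then 1 else 0) * sgn (u j) ^ (if i ∈ S then 1 else 0)) := by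
    intro i j
    conv_lhs => rw [hu i, hu j]
    rw [hilbertSymbol_zpow hp]
    simp only [hS]
  simp only [h1, Finset.prod_mul_distrib, Finset.prod_pow_eq_pow_sum]
  rw [sum_pairs]
  have h2 := prod_pairs S fun i => sgn (u i)
  simp only [Finset.prod_mul_distrib, Finset.prod_pow_eq_pow_sum] at h2
  rw [h2, sigHasse, ← Finset.prod_mul_prod_compl S]
  set χo := ∏ i ∈ S, sgn (u i)
  set χe := ∏ i ∈ Sᶜ, sgn (u i)
  split
  · next hc =>
    obtain ⟨k, hk⟩ := hc
    rw [← two_mul] at hk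
    have e1 : (χo * χe) ^ S.card = 1 := by rw [hk, pow_mul, Int.units_sq, one_pow]
    have e2 : sgn (isUnit_two hp).unit ^ S.card = 1 := by rw [hk, pow_mul, Int.units_sq, one_pow]
    rw [e1, normSign, e2, one_mul, mul_one]
  · next hc =>
    rw [Nat.not_even_iff_odd] at hc
    obtain ⟨k, hk⟩ := hc
    have hle := hsig.le
    have e1 : (χo * χe) ^ S.card = χo * χe := by
      rw [hk, pow_succ, pow_mul, Int.units_sq, one_pow, one_mul]
    rw [e1, ← normSign_sub_mul hp k (by omega), ← hk]
    have e2 := Int.units_mul_self χo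
    have e3 := Int.units_mul_self (normSign hp (n - S.card))
    calc _ = sgn (-1 : ℤ_[p]ˣ) ^ S.card.choose 2 * (χe * (χo * χo)) := by ac_rfl
      _ = sgn (-1 : ℤ_[p]ˣ) ^ S.card.choose 2 * χe *
          (normSign hp (n - S.card) * normSign hp (n - S.card)) := by
        rw [e2, e3, mul_one, mul_one]
      _ = _ := by ac_rfl

end Hasse

section OrthogonalBases

variable {F W : Type*} [Field F] [AddCommGroup W] [Module F W] {Q : QuadraticForm F W}

theorem basis_orthFrame (hQ : (QuadraticMap.polarBilin Q).Nondegenerate) {I : Type*}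
    (v : Basis I F W) (hv : ∀ i j, i ≠ j → QuadraticMap.polar Q (v i) (v j) = 0) :
    OrthFrame Q v where
  ortho := hv
  ne_zero i h := by
    apply v.ne_zero i
    apply hQ.1
    intro y
    have hy : y ∈ Submodule.span F (Set.range v) := by rw [v.span_eq]; trivial
    induction hy using Submodule.span_induction with
    | mem x hx =>
      obtain ⟨j, rfl⟩ := hx
      by_cases hij : i = j
      · subst hij
        change QuadraticMap.polar Q _ _ = 0
        rw [QuadraticMap.polar_self, h, smul_zero]
      · exact hv i j hij
    | zero => simp
    | add x y _ _ hx hy => rw [map_add, hx, hy, add_zero]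
    | smul r x _ hx => rw [map_smul, hx, smul_zero]
  span := v.span_eq

theorem exists_orthFrame [Invertible (2 : F)] [FiniteDimensional F W]
    (hQ : (QuadraticMap.polarBilin Q).Nondegenerate) {n : ℕ} (hn : finrank F W = n) :
    ∃ v : Basis (Fin n) F W, OrthFrame Q v := by
  have hs : LinearMap.IsSymm (QuadraticMap.polarBilin Q) :=
    ⟨fun x y => QuadraticMap.polar_comm _ _ _⟩
  obtain ⟨v, hv⟩ := LinearMap.BilinForm.exists_orthogonal_basis hs
  have := basis_orthFrame hQ v fun i j hij => hv hij
  exact ⟨v.reindex (finCongr hn), by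
    rw [Basis.coe_reindex]
    exact this.comp_equiv _⟩

theorem linearIndependent_of_ortho [Invertible (2 : F)] {I : Type*} [Finite I] {v : I → W}
    (ho : ∀ i j, i ≠ j → QuadraticMap.polar Q (v i) (v j) = 0) (h0 : ∀ i, Q (v i) ≠ 0) :
    LinearIndependent F v := by
  classical
  cases nonempty_fintype I
  have h2 : (2 : F) ≠ 0 := Invertible.ne_zero 2
  rw [Fintype.linearIndependent_iff]
  intro c hc i
  have h1 : QuadraticMap.polarBilin Q (∑ j, c j • v j) (v i) = 0 := by rw [hc, map_zero]; rfl
  rw [map_sum, LinearMap.sum_apply, Finset.sum_eq_single i] at h1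
  · rw [map_smul, LinearMap.smul_apply, QuadraticMap.polarBilin_apply_apply,
      QuadraticMap.polar_self, two_smul, ← two_mul, smul_eq_mul] at h1
    exact (mul_eq_zero.1 h1).resolve_right (mul_ne_zero h2 (h0 i))
  · intro j _ hj
    rw [map_smul, LinearMap.smul_apply, QuadraticMap.polarBilin_apply_apply, ho j i hj,
      smul_zero]
  · simp

/-- The discriminant in terms of an orthogonal basis. -/
theorem discClass_eq [FiniteDimensional F W] (v : Basis (Fin (finrank F W)) F W)
    (hv : OrthFrame Q v) : discClass Q = {d | ∃ c : F, c ≠ 0 ∧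
      d = c ^ 2 * ((-1) ^ (finrank F W).choose 2 * (2 ^ finrank F W * ∏ i, Q (v i)))} := by
  have hG : ∀ x : Basis (Fin (finrank F W)) F W,
      (Matrix.of fun i j => QuadraticMap.polar Q (x i) (x j)) =
        LinearMap.BilinForm.toMatrix x (QuadraticMap.polarBilin Q) := by
    intro x; ext i j; rw [LinearMap.BilinForm.toMatrix_apply]; rfl
  have hv' : (Matrix.of fun i j => QuadraticMap.polar Q (v i) (v j)).det =
      2 ^ finrank F W * ∏ i, Q (v i) := by
    have : (Matrix.of fun i j => QuadraticMap.polar Q (v i) (v j)) =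
        Matrix.diagonal fun i => 2 * Q (v i) := by
      ext i j
      rw [Matrix.of_apply, Matrix.diagonal_apply]
      split
      · next h => rw [← h, QuadraticMap.polar_self, two_smul, two_mul]
      · next h => exact hv.ortho i j h
    rw [this, Matrix.det_diagonal, Finset.prod_mul_distrib, Finset.prod_const, Finset.card_univ,
      Fintype.card_fin]
  have hx : ∀ x : Basis (Fin (finrank F W)) F W, ∃ r : F, r ≠ 0 ∧
      (Matrix.of fun i j => QuadraticMap.polar Q (x i) (x j)).det =
        r ^ 2 * (2 ^ finrank F W * ∏ i, Q (v i)) := by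
    intro x
    refine ⟨(v.toMatrix x).det, ?_, ?_⟩
    · have : (v.toMatrix x).det * (x.toMatrix v).det = 1 := by
        rw [← Matrix.det_mul, Basis.toMatrix_mul_toMatrix_flip, Matrix.det_one]
      exact left_ne_zero_of_mul_eq_one this
    · rw [← hv', hG, hG, ← LinearMap.BilinForm.toMatrix_mul_basis_toMatrix v x]
      rw [Matrix.det_mul, Matrix.det_mul, Matrix.det_transpose]
      ring
  ext d
  constructor
  · rintro ⟨x, c, hc, rfl⟩
    obtain ⟨r, hr, h⟩ := hx x
    exact ⟨c * r, mul_ne_zero hc hr, by rw [h]; ring⟩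
  · rintro ⟨c, hc, rfl⟩
    exact ⟨v, c, hc, by rw [hv']⟩

end OrthogonalBases

section IntegralForms

variable {R : Type*} [CommRing R] [IsDomain R] [IsPrincipalIdealRing R] [ValuationRing R]

/-- A symmetric bilinear form over a discrete valuation ring in which `2` is invertible has an
orthogonal basis. -/
theorem exists_orthogonal_basis_of_isUnit_two (h2 : IsUnit (2 : R)) (n : ℕ) :
    ∀ {M : Type*} [AddCommGroup M] [Module R M] (_ : Basis (Fin n) R M)
      (B : LinearMap.BilinForm R M), (∀ x y, B x y = B y x) →
      ∃ v : Basis (Fin n) R M, ∀ i j, i ≠ j → B (v i) (v j) = 0 := by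
  induction n with
  | zero => exact fun b B _ => ⟨b, fun i => i.elim0⟩
  | succ n ih =>
    intro M _ _ b B hB
    have hpol : ∀ x y, 2 * B x y = B (x + y) (x + y) - B x x - B y y := by
      intro x y
      simp only [map_add, LinearMap.add_apply]
      rw [hB y x]
      ring
    by_cases h0 : ∀ x, B x x = 0
    · refine ⟨b, fun i j _ => ?_⟩
      have := hpol (b i) (b j)
      rw [h0, h0, h0, sub_zero, sub_zero] at this
      exact h2.mul_right_eq_zero.1 this
    push Not at h0
    obtain ⟨x₀, hx₀⟩ := h0
    obtain ⟨a, ⟨⟨x, rfl⟩, hx⟩, hmin⟩ :=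
      (wellFounded_dvdNotUnit (α := R)).has_min
        {a | (∃ x, B x x = a) ∧ a ≠ 0} ⟨_, ⟨x₀, rfl⟩, hx₀⟩
    have hdvd : ∀ y, B x x ∣ B y y := by
      intro y
      by_cases hy : B y y = 0
      · rw [hy]; exact dvd_zero _
      rcases ValuationRing.dvd_total (B x x) (B y y) with h | h
      · exact h
      · by_contra hn
        exact hmin _ ⟨⟨y, rfl⟩, hy⟩ (dvdNotUnit_of_dvd_of_not_dvd h hn)
    have hdvd' : ∀ y, B x x ∣ B x y := by
      intro y
      have : B x x ∣ 2 * B x y := by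
        rw [hpol]
        exact dvd_sub (dvd_sub (hdvd _) (hdvd _)) (hdvd _)
      exact (h2.dvd_mul_left).1 this
    let N : Submodule R M := LinearMap.ker (B x)
    have hfree : Module.Free R M := Module.Free.of_basis b
    have hfin : Module.Finite R M := Module.Finite.of_basis b
    let b' : Basis (Fin (finrank R N)) R N := finBasis R N
    have hli : ∀ (c : R), ∀ y ∈ N, c • x + y = 0 → c = 0 := by
      intro c y hy h
      have h1 : B x (c • x + y) = 0 := by rw [h, map_zero]
      rw [map_add, LinearMap.mem_ker.1 hy, add_zero, map_smul, smul_eq_mul] at h1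
      exact (mul_eq_zero.1 h1).resolve_right hx
    have hsp : ∀ z : M, ∃ c : R, z + c • x ∈ N := by
      intro z
      obtain ⟨c, hc⟩ := hdvd' z
      refine ⟨-c, ?_⟩
      rw [LinearMap.mem_ker, map_add, map_smul, hc, smul_eq_mul]
      ring
    have hm : finrank R N = n := by
      have h1 := finrank_eq_card_basis (b'.mkFinCons x hli hsp)
      rw [finrank_eq_card_basis b] at h1
      simpa using h1.symm
    obtain ⟨w, hw⟩ := ih (b'.reindex (finCongr hm)) (B.restrict N) fun y z => hB _ _
    refine ⟨w.mkFinCons x hli hsp, fun i j hij => ?_⟩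
    rw [Basis.coe_mkFinCons]
    have hk : ∀ k, B x (w k : M) = 0 := fun k => (w k).2
    induction i using Fin.cases with
    | zero =>
      induction j using Fin.cases with
      | zero => exact absurd rfl hij
      | succ j => exact hk j
    | succ i =>
      induction j using Fin.cases with
      | zero =>
        simp only [Fin.cons_succ, Fin.cons_zero, Function.comp_apply]
        rw [hB]
        exact hk i
      | succ j =>
        simp only [Fin.cons_succ, Function.comp_apply]
        exact hw i j fun h => hij (congrArg _ h)

end IntegralForms

section Lattices

variable {p : ℕ} [Fact p.Prime]

/-- Diagonalisation of unimodular symmetric matrices over `ℤ_p`. -/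
theorem exists_diagonal (hp : p ≠ 2) {a : ℕ} {A : Matrix (Fin a) (Fin a) ℤ_[p]} (hA : A.IsSymm)
    (hdet : IsUnit A.det) :
    ∃ (P : Matrix (Fin a) (Fin a) ℤ_[p]) (d : Fin a → ℤ_[p]ˣ), IsUnit P.det ∧
      P.transpose * A * P = Matrix.diagonal (fun i => (d i : ℤ_[p])) ∧
      ∏ i, sgn (d i) = sgn hdet.unit := by
  obtain ⟨v, hv⟩ := exists_orthogonal_basis_of_isUnit_two (isUnit_two hp) a
    (Pi.basisFun ℤ_[p] (Fin a)) (Matrix.toBilin (Pi.basisFun ℤ_[p] (Fin a)) A) (by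
      intro x y
      rw [Matrix.toBilin_apply, Matrix.toBilin_apply, Finset.sum_comm]
      refine Finset.sum_congr rfl fun i _ => Finset.sum_congr rfl fun j _ => ?_
      rw [← hA.apply i j]
      ring)
  set B := Matrix.toBilin (Pi.basisFun ℤ_[p] (Fin a)) A with hB
  set P := (Pi.basisFun ℤ_[p] (Fin a)).toMatrix v with hP
  have hPu : IsUnit P.det := by
    have : P.det * (v.toMatrix (Pi.basisFun ℤ_[p] (Fin a))).det = 1 := by
      rw [← Matrix.det_mul, Basis.toMatrix_mul_toMatrix_flip, Matrix.det_one]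
    exact IsUnit.of_mul_eq_one _ this
  have h1 : P.transpose * A * P = Matrix.diagonal (fun i => B (v i) (v i)) := by
    have := LinearMap.BilinForm.toMatrix_mul_basis_toMatrix (Pi.basisFun ℤ_[p] (Fin a)) v B
    rw [hB, LinearMap.BilinForm.toMatrix_toBilin, ← hB] at this
    rw [this]
    ext i j
    rw [LinearMap.BilinForm.toMatrix_apply, Matrix.diagonal_apply]
    split
    · next h => rw [h]
    · next h => exact hv i j h
  have h2 := congrArg Matrix.det h1
  rw [Matrix.det_mul, Matrix.det_mul, Matrix.det_transpose, Matrix.det_diagonal] at h2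
  have h3 : ∀ i, IsUnit (B (v i) (v i)) := by
    have h4 : IsUnit (∏ i, B (v i) (v i)) := by rw [← h2]; exact (hPu.mul hdet).mul hPu
    intro i
    exact isUnit_of_dvd_unit (Finset.dvd_prod_of_mem (fun i => B (v i) (v i)) (Finset.mem_univ i)) h4
  refine ⟨P, fun i => (h3 i).unit, hPu, h1, ?_⟩
  rw [← map_prod]
  refine sgn_eq_of_sq_mul (r := hPu.unit) ?_
  rw [Units.coe_prod]
  simp only [IsUnit.unit_spec]
  rw [← h2]
  ring

theorem polar_orthFrame {W : Type*} [AddCommGroup W] [Module ℚ_[p] W] {I : Type*} [Fintype I]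
    [DecidableEq I] {Q : QuadraticForm ℚ_[p] W}
    {v : Basis I ℚ_[p] W} (hv : OrthFrame Q v) (x : W) (i : I) :
    QuadraticMap.polar Q x (v i) = 2 * v.repr x i * Q (v i) := by
  conv_lhs => rw [← v.sum_repr x]
  change QuadraticMap.polarBilin Q _ _ = _
  rw [map_sum, LinearMap.sum_apply, Finset.sum_eq_single i]
  · rw [map_smul, LinearMap.smul_apply, QuadraticMap.polarBilin_apply_apply,
      QuadraticMap.polar_self, two_smul, smul_eq_mul]
    ring
  · intro j _ hj
    rw [map_smul, LinearMap.smul_apply, QuadraticMap.polarBilin_apply_apply, hv.ortho j i hj,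
      smul_zero]
  · simp

variable {W : Type*} [AddCommGroup W] [Module ℚ_[p] W]
  [Module ℤ_[p] W] [IsScalarTower ℤ_[p] ℚ_[p] W]

theorem mem_dualLattice_span {I : Type*} [Fintype I] {Q : QuadraticForm ℚ_[p] W}
    {v : Basis I ℚ_[p] W} {x : W} :
    x ∈ dualLattice Q (Submodule.span ℤ_[p] (Set.range v)) ↔
      ∀ i, ∃ z : ℤ_[p], (z : ℚ_[p]) = QuadraticMap.polar Q x (v i) := by
  rw [dualLattice, LinearMap.BilinForm.mem_dualSubmodule]
  constructor
  · intro h i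
    exact Submodule.mem_one.1 (h (v i) (Submodule.subset_span ⟨i, rfl⟩))
  · intro h y hy
    obtain ⟨f, rfl⟩ := (Submodule.mem_span_range_iff_exists_fun _).1 hy
    rw [map_sum]
    refine sum_mem fun i _ => ?_
    obtain ⟨z, hz⟩ := h i
    rw [← IsScalarTower.algebraMap_smul ℚ_[p] (f i), map_smul]
    change _ • QuadraticMap.polar Q x (v i) ∈ _
    rw [← hz]
    exact Submodule.mem_one.2 ⟨f i * z, by rw [map_mul]; rfl⟩

theorem exists_padicInt_two_mul (hp : p ≠ 2) {x : ℚ_[p]} :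
    (∃ z : ℤ_[p], (z : ℚ_[p]) = 2 * x) ↔ ‖x‖ ≤ 1 := by
  have h2 : ‖(2 : ℚ_[p])‖ = 1 := by
    have h := PadicInt.isUnit_iff.1 (isUnit_two hp)
    rwa [PadicInt.norm_def] at h
  constructor
  · rintro ⟨z, hz⟩
    have := z.2
    rw [hz, norm_mul, h2, one_mul] at this
    exact this
  · intro h
    exact ⟨⟨2 * x, by rw [norm_mul, h2, one_mul]; exact h⟩, rfl⟩

theorem mem_dualLattice_orthFrame (hp : p ≠ 2) {I : Type*} [Fintype I] [DecidableEq I]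
    {Q : QuadraticForm ℚ_[p] W} {v : Basis I ℚ_[p] W} (hv : OrthFrame Q v) {x : W} :
    x ∈ dualLattice Q (Submodule.span ℤ_[p] (Set.range v)) ↔
      ∀ i, ‖v.repr x i * Q (v i)‖ ≤ 1 := by
  rw [mem_dualLattice_span]
  refine forall_congr' fun i => ?_
  rw [polar_orthFrame hv, mul_assoc, exists_padicInt_two_mul hp]

theorem mem_span_iff_norm {I : Type*} {v : Basis I ℚ_[p] W} {x : W} :
    x ∈ Submodule.span ℤ_[p] (Set.range v) ↔ ∀ i, ‖v.repr x i‖ ≤ 1 := by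
  rw [Basis.mem_span_iff_repr_mem]
  refine forall_congr' fun i => ⟨?_, fun h => ⟨⟨_, h⟩, rfl⟩⟩
  rintro ⟨z, hz⟩
  rw [← hz]
  exact z.2

theorem isLattice_span {I : Type*} [Finite I] (v : Basis I ℚ_[p] W) :
    Submodule.IsLattice ℚ_[p] (Submodule.span ℤ_[p] (Set.range v)) where
  fg := Submodule.fg_span (Set.finite_range v)
  span_eq_top := by rw [Submodule.span_span_of_tower, v.span_eq]

theorem isVertexLattice_span (hp : p ≠ 2) {I : Type*} [Fintype I] [DecidableEq I]
    {Q : QuadraticForm ℚ_[p] W} {v : Basis I ℚ_[p] W} (hv : OrthFrame Q v) {S : Finset I}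
    {u : I → ℤ_[p]ˣ} (h1 : ∀ i ∈ S, Q (v i) = p * ((u i : ℤ_[p]) : ℚ_[p]))
    (h2 : ∀ i ∉ S, Q (v i) = ((u i : ℤ_[p]) : ℚ_[p])) :
    IsVertexLattice Q (Submodule.span ℤ_[p] (Set.range v)) S.card := by
  have hu : ∀ i, ‖((u i : ℤ_[p]) : ℚ_[p])‖ = 1 := fun i => by
    have h := PadicInt.isUnit_iff.1 (u i).isUnit
    rwa [PadicInt.norm_def] at h
  have hpn : ‖(p : ℚ_[p])‖ ≤ 1 := (p : ℤ_[p]).2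
  set L := Submodule.span ℤ_[p] (Set.range v) with hL
  have hmem : ∀ {x}, x ∈ dualLattice Q L ↔
      (∀ i ∈ S, ‖p * v.repr x i‖ ≤ 1) ∧ ∀ i ∉ S, ‖v.repr x i‖ ≤ 1 := by
    intro x
    rw [mem_dualLattice_orthFrame hp hv]
    constructor
    · intro h
      refine ⟨fun i hi => ?_, fun i hi => ?_⟩
      · have := h i
        rwa [h1 i hi, ← mul_assoc, norm_mul, hu, mul_one, mul_comm] at this
      · have := h i
        rwa [h2 i hi, norm_mul, hu, mul_one] at this
    · rintro ⟨ha, hb⟩ i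
      by_cases hi : i ∈ S
      · rw [h1 i hi, ← mul_assoc, norm_mul, hu, mul_one, mul_comm]
        exact ha i hi
      · rw [h2 i hi, norm_mul, hu, mul_one]
        exact hb i hi
  have hle : L ≤ dualLattice Q L := by
    intro x hx
    rw [hL, mem_span_iff_norm] at hx
    refine hmem.2 ⟨fun i _ => ?_, fun i _ => hx i⟩
    rw [norm_mul]
    exact mul_le_one₀ hpn (norm_nonneg _) (hx i)
  have hps : ∀ (x : W) i, v.repr ((p : ℤ_[p]) • x) i = p * v.repr x i := by
    intro x i
    rw [← IsScalarTower.algebraMap_smul ℚ_[p] (p : ℤ_[p]), map_smul, Finsupp.smul_apply,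
      smul_eq_mul]
    simp
  refine ⟨isLattice_span v, ?_, hle, ?_⟩
  · intro x hx
    rw [hL, mem_span_iff_norm]
    intro i
    rw [hps]
    by_cases hi : i ∈ S
    · exact (hmem.1 hx).1 i hi
    · rw [norm_mul]
      exact mul_le_one₀ hpn (norm_nonneg _) ((hmem.1 hx).2 i hi)
  · have hζ : ∀ (x : dualLattice Q L) (i : S), ∃ z : ℤ_[p], (z : ℚ_[p]) = p * v.repr x i :=
      fun x i => ⟨⟨_, (hmem.1 x.2).1 i i.2⟩, rfl⟩
    choose ζ hζ using hζ
    let φ : dualLattice Q L →+ (S → ZMod p) := AddMonoidHom.mk'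
      (fun x i => PadicInt.toZMod (ζ x i)) (by
        intro x y
        funext i
        have h3 : ζ (x + y) i = ζ x i + ζ y i := by
          apply PadicInt.ext
          rw [PadicInt.coe_add, hζ, hζ, hζ, Submodule.coe_add, map_add, Finsupp.add_apply, mul_add]
        rw [Pi.add_apply, ← map_add, h3])
    have hker : φ.ker = L.toAddSubgroup.addSubgroupOf (dualLattice Q L).toAddSubgroup := by
      ext x
      rw [AddMonoidHom.mem_ker, AddSubgroup.mem_addSubgroupOf]
      change _ ↔ (x : W) ∈ Submodule.span ℤ_[p] (Set.range v)
      rw [mem_span_iff_norm]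
      have hS : ∀ i : S, φ x i = 0 ↔ ‖v.repr x i‖ ≤ 1 := by
        intro i
        change PadicInt.toZMod (ζ x i) = 0 ↔ _
        rw [← RingHom.mem_ker, PadicInt.ker_toZMod, PadicInt.maximalIdeal_eq_span_p,
          Ideal.mem_span_singleton]
        constructor
        · rintro ⟨z, hz⟩
          have h3 := congrArg (fun t : ℤ_[p] => (t : ℚ_[p])) hz
          simp only [PadicInt.coe_mul, PadicInt.coe_natCast, hζ] at h3
          rw [mul_left_cancel₀ padic_p_ne_zero h3]
          exact z.2
        · intro h
          obtain ⟨z, hz⟩ : ∃ z : ℤ_[p], (z : ℚ_[p]) = v.repr x i := ⟨⟨_, h⟩, rfl⟩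
          exact ⟨z, PadicInt.ext (by rw [hζ, PadicInt.coe_mul, hz, PadicInt.coe_natCast])⟩
      constructor
      · intro h i
        by_cases hi : i ∈ S
        · exact (hS ⟨i, hi⟩).1 (congrFun h _)
        · exact (hmem.1 x.2).2 i hi
      · intro h
        funext i
        exact (hS i).2 (h i)
    have hsurj : Function.Surjective φ := by
      intro f
      choose z hz using fun i : S => toZMod_surjective (p := p) (f i)
      let x : W := ∑ i : S, ((p : ℚ_[p])⁻¹ * (z i : ℚ_[p])) • v i
      have hx : ∀ i : S, v.repr x i = (p : ℚ_[p])⁻¹ * (z i : ℚ_[p]) := by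
        intro i
        simp only [x, map_sum, map_smul, Basis.repr_self, Finsupp.coe_finsetSum,
          Finset.sum_apply, Finsupp.smul_apply, smul_eq_mul]
        rw [Finset.sum_eq_single i]
        · simp
        · intro j _ hj
          rw [Finsupp.single_eq_of_ne (fun h => hj (Subtype.ext h.symm)), mul_zero]
        · simp
      have hx' : ∀ i ∉ S, v.repr x i = 0 := by
        intro i hi
        simp only [x, map_sum, map_smul, Basis.repr_self, Finsupp.coe_finsetSum,
          Finset.sum_apply, Finsupp.smul_apply, smul_eq_mul]
        refine Finset.sum_eq_zero fun j _ => ?_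
        rw [Finsupp.single_eq_of_ne (by rintro rfl; exact hi j.2), mul_zero]
      have hpx : ∀ i : S, p * v.repr x i = z i := fun i => by
        rw [hx, mul_inv_cancel_left₀ padic_p_ne_zero]
      refine ⟨⟨x, hmem.2 ⟨fun i hi => ?_, fun i hi => ?_⟩⟩, ?_⟩
      · rw [hpx ⟨i, hi⟩]; exact (z ⟨i, hi⟩).2
      · rw [hx' i hi, norm_zero]; exact zero_le_one
      · funext i
        rw [← hz i]
        change PadicInt.toZMod (ζ _ i) = _
        congr 1
        exact PadicInt.ext ((hζ _ i).trans (hpx i))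
    rw [AddSubgroup.relIndex, ← hker]
    change φ.ker.index = _
    rw [AddSubgroup.index_ker, AddMonoidHom.range_eq_top.2 hsurj]
    simp
end Lattices
section Frames

variable {F W : Type*} [Field F] [AddCommGroup W] [Module F W] {Q : QuadraticForm F W}

theorem orthFrame_of_card [Invertible (2 : F)] [FiniteDimensional F W] {I : Type*} [Fintype I]
    {v : I → W} (ho : ∀ i j, i ≠ j → QuadraticMap.polar Q (v i) (v j) = 0)
    (h0 : ∀ i, Q (v i) ≠ 0) (hc : Fintype.card I = finrank F W) : OrthFrame Q v :=
  ⟨ho, h0, (linearIndependent_of_ortho ho h0).span_eq_top_of_card_eq_finrank' hc⟩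

/-- The basis given by an orthogonal frame. -/
def OrthFrame.basis [Invertible (2 : F)] {I : Type*} [Finite I] {v : I → W} (hv : OrthFrame Q v) :
    Basis I F W :=
  Basis.mk (linearIndependent_of_ortho hv.ortho hv.ne_zero) hv.span.ge

theorem OrthFrame.coe_basis [Invertible (2 : F)] {I : Type*} [Finite I] {v : I → W}
    (hv : OrthFrame Q v) : ⇑hv.basis = v := Basis.coe_mk _ _

end Frames

section MomentMatrices

variable {p : ℕ} [Fact p.Prime]

theorem isMomentH_iff {a : ℕ} {A : Matrix (Fin a) (Fin a) ℤ_[p]} {s : ℤˣ} :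
    IsMomentH A s ↔ A.IsSymm ∧ ∃ h : IsUnit A.det,
      sgn (-1 : ℤ_[p]ˣ) ^ a.choose 2 * sgn h.unit = s := by
  have key : ∀ h : IsUnit A.det, chi ((-1) ^ a.choose 2 * A.det) = s ↔
      sgn (-1 : ℤ_[p]ˣ) ^ a.choose 2 * sgn h.unit = s := by
    intro h
    rw [← map_pow, ← map_mul, ← Units.val_inj, coe_sgn]
    simp
  constructor
  · rintro ⟨h1, h2, h3⟩
    exact ⟨h1, h2, (key h2).1 h3⟩
  · rintro ⟨h1, h2, h3⟩
    exact ⟨h1, h2, (key h2).2 h3⟩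

theorem isMomentH_diagonal (hp : p ≠ 2) {a : ℕ} (u : Fin a → ℤ_[p]ˣ) :
    IsMomentH (Matrix.diagonal fun i => 2 * (u i : ℤ_[p])) (normSign hp a * ∏ i, sgn (u i)) := by
  have hdet : (Matrix.diagonal fun i => 2 * (u i : ℤ_[p])).det =
      (((isUnit_two hp).unit ^ a * ∏ i, u i : ℤ_[p]ˣ) : ℤ_[p]) := by
    rw [Matrix.det_diagonal, Finset.prod_mul_distrib, Finset.prod_const, Finset.card_univ,
      Fintype.card_fin]
    simp [Units.coe_prod]
  have hu : IsUnit (Matrix.diagonal fun i => 2 * (u i : ℤ_[p])).det := by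
    rw [hdet]; exact Units.isUnit _
  refine isMomentH_iff.2 ⟨Matrix.isSymm_diagonal _, hu, ?_⟩
  have : hu.unit = (isUnit_two hp).unit ^ a * ∏ i, u i := Units.ext hdet
  rw [this, map_mul, map_pow, map_prod, normSign, mul_assoc]

/-- A unimodular symmetric matrix is congruent to a diagonal one, with values `u i` of the
quadratic form. -/
theorem IsMomentH.exists_diagonal (hp : p ≠ 2) {a : ℕ} {A : Matrix (Fin a) (Fin a) ℤ_[p]} {s : ℤˣ}
    (h : IsMomentH A s) : ∃ (P : Matrix (Fin a) (Fin a) ℤ_[p]) (u : Fin a → ℤ_[p]ˣ),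
      P.transpose * A * P = Matrix.diagonal (fun i => 2 * (u i : ℤ_[p])) ∧
      normSign hp a * ∏ i, sgn (u i) = s := by
  obtain ⟨hs, hu, h3⟩ := isMomentH_iff.1 h
  obtain ⟨P, d, -, hP, hd⟩ := GSpinFixed.exists_diagonal hp hs hu
  refine ⟨P, fun i => (isUnit_two hp).unit⁻¹ * d i, ?_, ?_⟩
  · rw [hP]
    congr 1
    funext i
    change _ = ((isUnit_two hp).unit : ℤ_[p]) * (((isUnit_two hp).unit⁻¹ * d i : ℤ_[p]ˣ) : ℤ_[p])
    rw [← Units.val_mul, mul_inv_cancel_left]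
  · rw [← h3, normSign]
    simp only [map_mul, map_inv, Finset.prod_mul_distrib, Finset.prod_const, Finset.card_univ,
      Fintype.card_fin, hd]
    rw [inv_pow]
    group

end MomentMatrices

section HLambda

variable {p : ℕ} [Fact p.Prime] {W : Type*} [AddCommGroup W] [Module ℚ_[p] W]
  [Module ℤ_[p] W] [IsScalarTower ℤ_[p] ℚ_[p] W] {Q : QuadraticForm ℚ_[p] W}

theorem isHLambda_span (hp : p ≠ 2) {a c : ℕ} {v : Basis (Fin a ⊕ Fin c) ℚ_[p] W}
    (hv : OrthFrame Q v) {u : Fin a → ℤ_[p]ˣ} {u' : Fin c → ℤ_[p]ˣ}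
    (h : ∀ i, Q (v (Sum.inl i)) = ((u i : ℤ_[p]) : ℚ_[p]))
    (h' : ∀ i, Q (v (Sum.inr i)) = p * ((u' i : ℤ_[p]) : ℚ_[p])) :
    IsHLambda Q (Submodule.span ℤ_[p] (Set.range v)) a (normSign hp a * ∏ i, sgn (u i))
      c (normSign hp c * ∏ i, sgn (u' i)) := by
  refine ⟨v.restrictScalars ℤ_[p], _, _, isMomentH_diagonal hp u, isMomentH_diagonal hp u', ?_⟩
  intro i j
  have h2 : ((2 : ℤ_[p]) : ℚ_[p]) = 2 := rfl
  rw [Basis.restrictScalars_apply, Basis.restrictScalars_apply]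
  by_cases hij : i = j
  · subst hij
    rw [QuadraticMap.polar_self]
    rcases i with i | i
    · rw [h, Matrix.fromBlocks_apply₁₁, Matrix.diagonal_apply_eq]
      rw [PadicInt.coe_mul, h2, two_smul, two_mul]
    · rw [h', Matrix.fromBlocks_apply₂₂, Matrix.smul_apply, Matrix.diagonal_apply_eq, smul_eq_mul]
      rw [PadicInt.coe_mul, PadicInt.coe_mul, h2, two_smul, PadicInt.coe_natCast]
      ring
  · rw [hv.ortho i j hij]
    rcases i with i | i <;> rcases j with j | j
    · rw [Matrix.fromBlocks_apply₁₁, Matrix.diagonal_apply_ne _ (fun e => hij (by rw [e]))]; rfl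
    · rw [Matrix.fromBlocks_apply₁₂]; rfl
    · rw [Matrix.fromBlocks_apply₂₁]; rfl
    · rw [Matrix.fromBlocks_apply₂₂, Matrix.smul_apply,
        Matrix.diagonal_apply_ne _ (fun e => hij (by rw [e])), smul_zero]
      rfl

theorem OrthFrame.isHLambda_span (hp : p ≠ 2) {n : ℕ} {v : Basis (Fin n) ℚ_[p] W}
    (hv : OrthFrame Q v) {S : Finset (Fin n)}
    {u : Fin n → ℤ_[p]ˣ} (h1 : ∀ i ∈ S, Q (v i) = p * ((u i : ℤ_[p]) : ℚ_[p]))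
    (h2 : ∀ i ∉ S, Q (v i) = ((u i : ℤ_[p]) : ℚ_[p])) :
    IsHLambda Q (Submodule.span ℤ_[p] (Set.range v)) (n - S.card)
      (normSign hp (n - S.card) * ∏ i ∈ Sᶜ, sgn (u i)) S.card
      (normSign hp S.card * ∏ i ∈ S, sgn (u i)) := by
  have hc : Sᶜ.card = n - S.card := by rw [Finset.card_compl, Fintype.card_fin]
  let e : Fin (n - S.card) ⊕ Fin S.card ≃ Fin n :=
    (Equiv.sumComm _ _).trans (finSumEquivOfFinset rfl hc)
  have h3 := GSpinFixed.isHLambda_span hp (v := v.reindex e.symm) (Q := Q)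
    (u := fun i => u (Sᶜ.orderEmbOfFin hc i)) (u' := fun i => u (S.orderEmbOfFin rfl i))
    (by rw [Basis.coe_reindex]; exact hv.comp_equiv _)
    (fun i => by
      rw [Basis.reindex_apply]
      exact h2 _ (Finset.mem_compl.1 (Finset.orderEmbOfFin_mem Sᶜ hc i)))
    (fun i => by
      rw [Basis.reindex_apply]
      exact h1 _ (Finset.orderEmbOfFin_mem S rfl i))
  rw [Basis.range_reindex] at h3
  have e1 : ∏ i, sgn (u (Sᶜ.orderEmbOfFin hc i)) = ∏ i ∈ Sᶜ, sgn (u i) := by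
    conv_rhs => rw [← Finset.map_orderEmbOfFin_univ Sᶜ hc, Finset.prod_map]
    rfl
  have e2 : ∏ i, sgn (u (S.orderEmbOfFin rfl i)) = ∏ i ∈ S, sgn (u i) := by
    conv_rhs => rw [← Finset.map_orderEmbOfFin_univ S rfl, Finset.prod_map]
    rfl
  rwa [e1, e2] at h3

/-- A signature is realised by a vertex lattice. -/
theorem HasSig.exists_isVertexLattice {hp : p ≠ 2} {n c : ℕ} {s s' : ℤˣ}
    (h : HasSig hp p 1 Q n c s s') : ∃ L, IsVertexLattice Q L c ∧ IsHLambda Q L (n - c) s c s' := by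
  obtain ⟨v, u, S, hv, rfl, h1, h2, rfl, rfl⟩ := h
  have hv' : OrthFrame Q hv.basis := by rwa [hv.coe_basis]
  have h1' : ∀ i ∈ S, Q (hv.basis i) = p * ((u i : ℤ_[p]) : ℚ_[p]) := by rwa [hv.coe_basis]
  have h2' : ∀ i ∉ S, Q (hv.basis i) = ((u i : ℤ_[p]) : ℚ_[p]) := by
    rw [hv.coe_basis]; intro i hi; rw [h2 i hi, one_mul]
  exact ⟨_, isVertexLattice_span hp hv' h1' h2', hv'.isHLambda_span hp h1' h2'⟩

/-- The signature attached to a frame indexed by any finite type. -/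
theorem OrthFrame.hasSig_of_card (hp : p ≠ 2) {W : Type*} [AddCommGroup W] [Module ℚ_[p] W]
    {Q : QuadraticForm ℚ_[p] W} {a c : ℕ} {v : Fin a ⊕ Fin c → W}
    (hv : OrthFrame Q v) {u : Fin a → ℤ_[p]ˣ} {u' : Fin c → ℤ_[p]ˣ}
    (h : ∀ i, Q (v (Sum.inl i)) = ((u i : ℤ_[p]) : ℚ_[p]))
    (h' : ∀ i, Q (v (Sum.inr i)) = p * ((u' i : ℤ_[p]) : ℚ_[p])) :
    HasSig hp p 1 Q (a + c) c (normSign hp a * ∏ i, sgn (u i))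
      (normSign hp c * ∏ i, sgn (u' i)) := by
  let S : Finset (Fin (a + c)) := Finset.univ.map (Fin.natAddEmb a)
  have hS : ∀ i, i ∈ S ↔ ∃ j, Fin.natAdd a j = i := by intro i; simp [S]
  have hS' : Sᶜ = Finset.univ.map (Fin.castAddEmb c) := by
    ext i
    rw [Finset.mem_compl, hS]
    induction i using Fin.addCases with
    | left i =>
      simp only [Finset.mem_map, Finset.mem_univ, true_and, Fin.castAddEmb_apply,
        Fin.castAdd_inj, exists_eq, iff_true, not_exists]
      intro j hj
      have := congrArg Fin.val hj
      simp at this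
      omega
    | right i =>
      simp only [Finset.mem_map, Finset.mem_univ, true_and, Fin.castAddEmb_apply,
        Fin.natAdd_inj, exists_eq, not_true, false_iff, not_exists]
      intro j hj
      have := congrArg Fin.val hj
      simp at this
      omega
  refine ⟨v ∘ finSumFinEquiv.symm, Fin.addCases u u', S, hv.comp_equiv _, by simp [S], ?_, ?_,
    ?_, ?_⟩
  · intro i hi
    obtain ⟨j, rfl⟩ := (hS i).1 hi
    simp [h']
  · intro i hi
    rw [← Finset.mem_compl, hS'] at hi
    obtain ⟨j, -, rfl⟩ := Finset.mem_map.1 hi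
    simp [h]
  · rw [hS', Finset.prod_map, Nat.add_sub_cancel]
    simp
  · rw [Finset.prod_map]
    simp

theorem IsHLambda.hasSig (hp : p ≠ 2) {L : Submodule ℤ_[p] W} (hL : Submodule.IsLattice ℚ_[p] L)
    {a c : ℕ} {s s' : ℤˣ} (h : IsHLambda Q L a s c s') : HasSig hp p 1 Q (a + c) c s s' := by
  obtain ⟨x, A, C, hA, hC, hx⟩ := h
  obtain ⟨P, u, hP, rfl⟩ := hA.exists_diagonal hp
  obtain ⟨P', u', hP', rfl⟩ := hC.exists_diagonal hp
  let y := x.extendOfIsLattice ℚ_[p]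
  have hfd : FiniteDimensional ℚ_[p] W := Module.Finite.of_basis y
  set G := Matrix.fromBlocks A 0 0 ((p : ℤ_[p]) • C) with hG
  let T := Matrix.fromBlocks P 0 0 P'
  have hT : T.transpose * G * T = Matrix.fromBlocks (Matrix.diagonal fun i => 2 * (u i : ℤ_[p])) 0 0
      ((p : ℤ_[p]) • Matrix.diagonal fun i => 2 * (u' i : ℤ_[p])) := by
    rw [Matrix.fromBlocks_transpose, Matrix.fromBlocks_multiply, Matrix.fromBlocks_multiply]
    simp [hP, ← hP']
  let w : Fin a ⊕ Fin c → W := fun i => ∑ k, ((T k i : ℤ_[p]) : ℚ_[p]) • (x k : W)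
  have hw : ∀ i j, QuadraticMap.polar Q (w i) (w j) =
      (((T.transpose * G * T) i j : ℤ_[p]) : ℚ_[p]) := by
    intro i j
    change QuadraticMap.polarBilin Q (∑ k, _) (∑ k, _) = _
    rw [map_sum, Matrix.mul_apply]
    rw [show ((∑ k, (T.transpose * G) i k * T k j : ℤ_[p]) : ℚ_[p]) =
      ∑ k, (((T.transpose * G) i k * T k j : ℤ_[p]) : ℚ_[p]) from
      map_sum PadicInt.Coe.ringHom _ _]
    refine Finset.sum_congr rfl fun k _ => ?_
    rw [map_smul, map_sum, LinearMap.sum_apply, Matrix.mul_apply, PadicInt.coe_mul, smul_eq_mul,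
      mul_comm]
    congr 1
    rw [show ((∑ l, T.transpose i l * G l k : ℤ_[p]) : ℚ_[p]) =
      ∑ l, ((T.transpose i l * G l k : ℤ_[p]) : ℚ_[p]) from
      map_sum PadicInt.Coe.ringHom _ _]
    refine Finset.sum_congr rfl fun l _ => ?_
    rw [map_smul, LinearMap.smul_apply, QuadraticMap.polarBilin_apply_apply, hx, PadicInt.coe_mul,
      smul_eq_mul, Matrix.transpose_apply]
  have h2 : (2 : ℚ_[p]) ≠ 0 := two_ne_zero
  have hw1 : ∀ i, Q (w (Sum.inl i)) = ((u i : ℤ_[p]) : ℚ_[p]) := by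
    intro i
    have := hw (Sum.inl i) (Sum.inl i)
    rw [hT, QuadraticMap.polar_self, Matrix.fromBlocks_apply₁₁, Matrix.diagonal_apply_eq] at this
    push_cast at this
    rw [two_smul, ← two_mul] at this
    exact mul_left_cancel₀ h2 this
  have hw2 : ∀ i, Q (w (Sum.inr i)) = p * ((u' i : ℤ_[p]) : ℚ_[p]) := by
    intro i
    have := hw (Sum.inr i) (Sum.inr i)
    rw [hT, QuadraticMap.polar_self, Matrix.fromBlocks_apply₂₂, Matrix.smul_apply,
      Matrix.diagonal_apply_eq, smul_eq_mul] at this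
    push_cast at this
    rw [two_smul, ← two_mul, mul_left_comm] at this
    exact mul_left_cancel₀ h2 this
  refine OrthFrame.hasSig_of_card hp (orthFrame_of_card ?_ ?_ ?_) hw1 hw2
  · intro i j hij
    rw [hw, hT]
    rcases i with i | i <;> rcases j with j | j
    · rw [Matrix.fromBlocks_apply₁₁, Matrix.diagonal_apply_ne _ (fun e => hij (by rw [e]))]; rfl
    · rw [Matrix.fromBlocks_apply₁₂]; rfl
    · rw [Matrix.fromBlocks_apply₂₁]; rfl
    · rw [Matrix.fromBlocks_apply₂₂, Matrix.smul_apply,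
        Matrix.diagonal_apply_ne _ (fun e => hij (by rw [e])), smul_zero]
      rfl
  · rintro (i | i)
    · rw [hw1]; exact unit_ne_zero _
    · rw [hw2]; exact mul_ne_zero padic_p_ne_zero (unit_ne_zero _)
  · rw [finrank_eq_card_basis y]

theorem SpaceIsHLambda.hasSig (hp : p ≠ 2) {n a c : ℕ} {s s' : ℤˣ} (h : SpaceIsHLambda Q a s c s')
    (hn : a + c = n) : HasSig hp p 1 Q n c s s' := by
  obtain ⟨L, hL, h⟩ := h
  subst hn
  exact h.hasSig hp hL

theorem HasSig.spaceIsHLambda {hp : p ≠ 2} {n c : ℕ} {s s' : ℤˣ} (h : HasSig hp p 1 Q n c s s') :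
    SpaceIsHLambda Q (n - c) s c s' := by
  obtain ⟨L, hL, h⟩ := h.exists_isVertexLattice
  exact ⟨L, hL.isLattice, h⟩

end HLambda

section VertexLattices

variable {p : ℕ} [Fact p.Prime] {W : Type*} [AddCommGroup W] [Module ℚ_[p] W]
  [Module ℤ_[p] W] [IsScalarTower ℤ_[p] ℚ_[p] W] {Q : QuadraticForm ℚ_[p] W}

theorem norm_coe_unit (u : ℤ_[p]ˣ) : ‖((u : ℤ_[p]) : ℚ_[p])‖ = 1 := by
  have h := PadicInt.isUnit_iff.1 u.isUnit
  rwa [PadicInt.norm_def] at h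

/-- A lattice on which the form is integral has an orthogonal basis. -/
theorem exists_orthFrame_of_le_dual (hp : p ≠ 2) (hQ : (QuadraticMap.polarBilin Q).Nondegenerate)
    {n : ℕ} (hn : finrank ℚ_[p] W = n) {L : Submodule ℤ_[p] W}
    (hL : Submodule.IsLattice ℚ_[p] L) (hle : L ≤ dualLattice Q L) :
    ∃ v : Basis (Fin n) ℚ_[p] W, OrthFrame Q v ∧ Submodule.span ℤ_[p] (Set.range v) = L := by
  have hfree : Module.Free ℤ_[p] L := Submodule.IsLattice.free ℚ_[p] L
  let b₀ := finBasis ℤ_[p] L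
  have hr : finrank ℤ_[p] L = n := by
    rw [← hn, finrank_eq_card_basis (b₀.extendOfIsLattice ℚ_[p]), Fintype.card_fin]
  have hB : ∀ x y : L, ∃ z : ℤ_[p], (z : ℚ_[p]) = QuadraticMap.polar Q (x : W) (y : W) :=
    fun x y => Submodule.mem_one.1 (hle x.2 y y.2)
  choose β hβ using hB
  have hsm : ∀ (c : ℤ_[p]) (x : W), c • x = (c : ℚ_[p]) • x := fun c x =>
    (IsScalarTower.algebraMap_smul ℚ_[p] c x).symm
  let B : LinearMap.BilinForm ℤ_[p] L := LinearMap.mk₂ ℤ_[p] β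
    (fun x y z => PadicInt.ext (by
      rw [PadicInt.coe_add, hβ, hβ, hβ, Submodule.coe_add, QuadraticMap.polar_add_left]))
    (fun c x y => PadicInt.ext (by
      rw [smul_eq_mul, PadicInt.coe_mul, hβ, hβ, Submodule.coe_smul, hsm,
        QuadraticMap.polar_smul_left, smul_eq_mul]))
    (fun x y z => PadicInt.ext (by
      rw [PadicInt.coe_add, hβ, hβ, hβ, Submodule.coe_add, QuadraticMap.polar_add_right]))
    (fun c x y => PadicInt.ext (by
      rw [smul_eq_mul, PadicInt.coe_mul, hβ, hβ, Submodule.coe_smul, hsm,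
        QuadraticMap.polar_smul_right, smul_eq_mul]))
  obtain ⟨v, hv⟩ := exists_orthogonal_basis_of_isUnit_two (isUnit_two hp) n
    (b₀.reindex (finCongr hr)) B (fun x y => PadicInt.ext (by
      change ((β x y : ℤ_[p]) : ℚ_[p]) = (β y x : ℤ_[p])
      rw [hβ, hβ, QuadraticMap.polar_comm]))
  refine ⟨v.extendOfIsLattice ℚ_[p], basis_orthFrame hQ _ fun i j hij => ?_, ?_⟩
  · rw [Basis.extendOfIsLattice_apply, Basis.extendOfIsLattice_apply, ← hβ]
    have := hv i j hij
    change β _ _ = 0 at this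
    rw [this]
    rfl
  · have h1 : Set.range (v.extendOfIsLattice ℚ_[p]) = Set.image L.subtype (Set.range v) := by
      rw [← Set.range_comp]
      congr 1
      funext i
      rw [Basis.extendOfIsLattice_apply]
      rfl
    rw [h1, Submodule.span_image, v.span_eq, Submodule.map_subtype_top]

theorem IsVertexLattice.exists_hasSig (hp : p ≠ 2)
    (hQ : (QuadraticMap.polarBilin Q).Nondegenerate)
    {n : ℕ} (hn : finrank ℚ_[p] W = n) {L : Submodule ℤ_[p] W} {t : ℕ}
    (h : IsVertexLattice Q L t) :
    ∃ s s', HasSig hp p 1 Q n t s s' ∧ IsHLambda Q L (n - t) s t s' := by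
  obtain ⟨v, hv, hvL⟩ := exists_orthFrame_of_le_dual hp hQ hn h.isLattice h.le_dual
  have hk := fun i => exists_eq_zpow_mul (hv.ne_zero i)
  choose u hu using hk
  set k := fun i => (Q (v i)).valuation with hkdef
  have hnorm : ∀ i, ‖Q (v i)‖ = (p : ℝ) ^ (-(k i)) := fun i => by
    rw [hu, norm_mul, norm_coe_unit, mul_one, Padic.norm_p_zpow]
  have hp1 : (1 : ℝ) < p := by exact_mod_cast (Fact.out : p.Prime).one_lt
  have hk0 : ∀ i, 0 ≤ k i := by
    intro i
    have h1 : v i ∈ dualLattice Q L := h.le_dual (by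
      rw [← hvL]; exact Submodule.subset_span ⟨i, rfl⟩)
    rw [← hvL, mem_dualLattice_orthFrame hp hv] at h1
    have h2 := h1 i
    rw [Basis.repr_self, Finsupp.single_eq_same, one_mul, hnorm, ← zpow_zero (p : ℝ),
      zpow_le_zpow_iff_right₀ hp1] at h2
    omega
  have hk1 : ∀ i, k i ≤ 1 := by
    intro i
    have h1 : (Q (v i))⁻¹ • v i ∈ dualLattice Q L := by
      rw [← hvL, mem_dualLattice_orthFrame hp hv]
      intro j
      rw [map_smul, Basis.repr_self, Finsupp.smul_apply]
      by_cases hij : j = i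
      · subst hij
        rw [Finsupp.single_eq_same, smul_eq_mul, mul_one, inv_mul_cancel₀ (hv.ne_zero j), norm_one]
      · rw [Finsupp.single_eq_of_ne hij, smul_zero, zero_mul, norm_zero]
        exact zero_le_one
    have h2 := h.p_smul_dual_le _ h1
    rw [← hvL, mem_span_iff_norm] at h2
    have h3 := h2 i
    rw [← IsScalarTower.algebraMap_smul ℚ_[p] (p : ℤ_[p]), map_smul, map_smul, Basis.repr_self,
      Finsupp.smul_apply, Finsupp.smul_apply, Finsupp.single_eq_same, smul_eq_mul, smul_eq_mul,
      mul_one, norm_mul, norm_inv, hnorm, map_natCast, Padic.norm_p, ← zpow_neg_one,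
      ← zpow_neg, ← zpow_add₀ (by positivity), ← zpow_zero (p : ℝ),
      zpow_le_zpow_iff_right₀ hp1] at h3
    omega
  let S : Finset (Fin n) := Finset.univ.filter fun i => k i = 1
  have h1 : ∀ i ∈ S, Q (v i) = p * ((u i : ℤ_[p]) : ℚ_[p]) := by
    intro i hi
    have : k i = 1 := by simpa [S] using hi
    have h2 := hu i
    rwa [show (Q (v i)).valuation = 1 from this, zpow_one] at h2
  have h2 : ∀ i ∉ S, Q (v i) = ((u i : ℤ_[p]) : ℚ_[p]) := by
    intro i hi
    have h3 : k i ≠ 1 := by simpa [S] using hi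
    have h4 : k i = 0 := by have := hk0 i; have := hk1 i; omega
    have h2 := hu i
    rwa [show (Q (v i)).valuation = 0 from h4, zpow_zero, one_mul] at h2
  have hV := isVertexLattice_span hp hv h1 h2
  rw [hvL] at hV
  have ht : t = S.card :=
    Nat.pow_right_injective (Fact.out : p.Prime).two_le (h.index.symm.trans hV.index)
  have hH := hv.isHLambda_span hp h1 h2
  rw [hvL] at hH
  subst ht
  exact ⟨_, _, ⟨v, u, S, hv, rfl, h1, fun i hi => by rw [h2 i hi, one_mul], rfl, rfl⟩, hH⟩

theorem HasSig.maxIs {hp : p ≠ 2} (hQ : (QuadraticMap.polarBilin Q).Nondegenerate)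
    {n : ℕ} (hn : finrank ℚ_[p] W = n) {t : ℕ} {s s' : ℤˣ} (h : HasSig hp p 1 Q n t s s')
    (huniq : ∀ t₁ s₁ s₁', HasSig hp p 1 Q n t₁ s₁ s₁' → t₁ ≤ t ∧ s₁ = s ∧ s₁' = s') :
    MaxIs Q (n - t) s t s' := by
  have hmax : ∀ L' t', IsVertexLattice Q L' t' → t' ≤ t := by
    intro L' t' h'
    obtain ⟨s₁, s₁', h1, -⟩ := h'.exists_hasSig hp hQ hn
    exact (huniq _ _ _ h1).1
  obtain ⟨L₀, hL₀, -⟩ := h.exists_isVertexLattice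
  refine ⟨⟨L₀, t, hL₀, hmax⟩, ?_⟩
  rintro L ⟨t₁, hL, hm⟩
  have ht : t₁ = t := le_antisymm (hmax _ _ hL) (hm _ _ hL₀)
  subst ht
  obtain ⟨s₁, s₁', h1, h2⟩ := hL.exists_hasSig hp hQ hn
  obtain ⟨-, rfl, rfl⟩ := huniq _ _ _ h1
  exact h2

theorem HasSig.minIs {hp : p ≠ 2} (hQ : (QuadraticMap.polarBilin Q).Nondegenerate)
    {n : ℕ} (hn : finrank ℚ_[p] W = n) {t : ℕ} {s s' : ℤˣ} (h : HasSig hp p 1 Q n t s s')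
    (huniq : ∀ t₁ s₁ s₁', HasSig hp p 1 Q n t₁ s₁ s₁' → t ≤ t₁ ∧ s₁ = s ∧ s₁' = s') :
    MinIs Q (n - t) s t s' := by
  have hmin : ∀ L' t', IsVertexLattice Q L' t' → t ≤ t' := by
    intro L' t' h'
    obtain ⟨s₁, s₁', h1, -⟩ := h'.exists_hasSig hp hQ hn
    exact (huniq _ _ _ h1).1
  obtain ⟨L₀, hL₀, -⟩ := h.exists_isVertexLattice
  refine ⟨⟨L₀, t, hL₀, hmin⟩, ?_⟩
  rintro L ⟨t₁, hL, hm⟩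
  have ht : t₁ = t := le_antisymm (hm _ _ hL₀) (hmin _ _ hL)
  subst ht
  obtain ⟨s₁, s₁', h1, h2⟩ := hL.exists_hasSig hp hQ hn
  obtain ⟨-, rfl, rfl⟩ := huniq _ _ _ h1
  exact h2

end VertexLattices
section Anisotropic

variable {p : ℕ} [Fact p.Prime] {W : Type*} [AddCommGroup W] [Module ℚ_[p] W]
  {Q : QuadraticForm ℚ_[p] W}

/-- The `ϖ`-modular part of an anisotropic form has rank at most two, and is the norm form of the
unramified quadratic extension if the rank is two. -/
theorem HasSig.of_anisotropic {hp : p ≠ 2} {ϖ ϖ' : ℚ_[p]} {d c : ℕ} {s s' : ℤˣ}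
    (hQ : ∀ x, Q x = 0 → x = 0) (h : HasSig hp ϖ ϖ' Q d c s s') :
    c ≤ 2 ∧ (c = 2 → s' = -1) := by
  obtain ⟨v, u, S, hv, hS, h1, h2, h3, h4⟩ := h
  constructor
  · by_contra hc
    obtain ⟨i, j, k, hi, hj, hk, hij, hik, hjk⟩ := Finset.two_lt_card_iff.1 (by omega : 2 < S.card)
    obtain ⟨x, y, hxy⟩ := exists_repr hp (u i) (u j) (-u k)
    have ho : QuadraticMap.polar Q ((x : ℚ_[p]) • v i + (y : ℚ_[p]) • v j) (v k) = 0 := by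
      rw [QuadraticMap.polar_add_left, QuadraticMap.polar_smul_left, QuadraticMap.polar_smul_left,
        hv.ortho i k hik, hv.ortho j k hjk, smul_zero, smul_zero, add_zero]
    have h5 := hQ (((x : ℚ_[p]) • v i + (y : ℚ_[p]) • v j) + v k) (by
      have h6 := congrArg (fun z : ℤ_[p] => (z : ℚ_[p])) hxy
      simp only [PadicInt.coe_add, PadicInt.coe_mul, PadicInt.coe_pow, Units.val_neg,
        PadicInt.coe_neg] at h6
      rw [QuadraticMap.map_add Q, ho, quad_combo _ _ (hv.ortho i j hij), h1 i hi, h1 j hj, h1 k hk]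
      linear_combination ϖ * h6)
    rw [eq_neg_of_add_eq_zero_left h5, QuadraticMap.polar_neg_left, QuadraticMap.polar_self,
      two_smul, ← two_mul, neg_eq_zero] at ho
    exact mul_ne_zero two_ne_zero (hv.ne_zero k) ho
  · rintro rfl
    obtain ⟨i, j, hij, hSe⟩ := Finset.card_eq_two.1 hS
    have hi : i ∈ S := by rw [hSe]; simp
    have hj : j ∈ S := by rw [hSe]; simp
    rw [hSe, Finset.prod_pair hij] at h4
    have hs : s' = sgn (-(u i * u j)) := by
      rw [← h4, normSign_add_two hp 0, normSign_zero, mul_one, ← map_mul, ← map_mul, neg_one_mul]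
    by_contra hne
    have h5 : s' = 1 := (Int.units_eq_one_or s').resolve_right hne
    obtain ⟨w, hw⟩ := exists_sq_eq hp (hs.symm.trans h5)
    have h6 := congrArg (fun z : ℤ_[p] => (z : ℚ_[p])) hw
    simp only [PadicInt.coe_pow, Units.val_neg, Units.val_mul, PadicInt.coe_mul,
      PadicInt.coe_neg] at h6
    have h7 := hQ ((w : ℚ_[p]) • v i + ((u i : ℤ_[p]) : ℚ_[p]) • v j) (by
      rw [quad_combo _ _ (hv.ortho i j hij), h1 i hi, h1 j hj]
      linear_combination ϖ * ((u i : ℤ_[p]) : ℚ_[p]) * h6)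
    have ho : QuadraticMap.polar Q ((w : ℚ_[p]) • v i + ((u i : ℤ_[p]) : ℚ_[p]) • v j) (v j) = 0 := by
      rw [h7, QuadraticMap.polar_zero_left]
    rw [QuadraticMap.polar_add_left, QuadraticMap.polar_smul_left, QuadraticMap.polar_smul_left,
      hv.ortho i j hij, smul_zero, zero_add, QuadraticMap.polar_self, two_smul, ← two_mul,
      smul_eq_mul] at ho
    exact mul_ne_zero (unit_ne_zero _) (mul_ne_zero two_ne_zero (hv.ne_zero j)) ho

/-- All the constraints on the signature of an anisotropic form. -/
theorem HasSig.anisotropic_cases {hp : p ≠ 2} {d c : ℕ} {s s' : ℤˣ}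
    (hQ : ∀ x, Q x = 0 → x = 0) (h : HasSig hp p 1 Q d c s s') :
    c ≤ 2 ∧ d - c ≤ 2 ∧ c ≤ d ∧ (c = 0 → s' = 1) ∧ (c = 2 → s' = -1) ∧ (d - c = 0 → s = 1) ∧
      (d - c = 2 → s = -1) := by
  have h1 := h.of_anisotropic hQ
  have h2 := h.swap.of_anisotropic hQ
  refine ⟨h1.1, h2.1, h.le, ?_, h1.2, ?_, h2.2⟩
  · rintro rfl; exact h.eq_one_of_zero
  · intro h3
    have h4 := h.swap
    rw [h3] at h4
    exact h4.eq_one_of_zero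

theorem normSign_add_two_mul (hp : p ≠ 2) (a r : ℕ) :
    normSign hp (a + 2 * r) = sgn (-1 : ℤ_[p]ˣ) ^ r * normSign hp a := by
  induction r with
  | zero => simp
  | succ r ih => rw [mul_add, mul_one, ← add_assoc, normSign_add_two, ih, pow_succ, mul_assoc,
      mul_left_comm]

/-- Adding hyperbolic planes does not change the signature. -/
theorem HasAnisotropicDim.exists_hasSig (hp : p ≠ 2) [FiniteDimensional ℚ_[p] W] {n : ℕ}
    (hn : finrank ℚ_[p] W = n) {d : ℕ} (h : HasAnisotropicDim Q d) :
    ∃ r c s s', n = 2 * r + d ∧ HasSig hp p 1 Q n c s s' ∧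
      c ≤ 2 ∧ d - c ≤ 2 ∧ c ≤ d ∧ (c = 0 → s' = 1) ∧ (c = 2 → s' = -1) ∧ (d - c = 0 → s = 1) ∧
      (d - c = 2 → s = -1) := by
  obtain ⟨r, e, f, A, he, hf, hee, hff, hef, hA, hani, hspan, hd⟩ := h
  let QA : QuadraticForm ℚ_[p] A := Q.comp A.subtype
  have hQA : ∀ x : A, QA x = Q (x : W) := fun x => rfl
  have hpA : ∀ x y : A, QuadraticMap.polar QA x y = QuadraticMap.polar Q (x : W) (y : W) :=
    fun x y => rfl
  have hani' : ∀ x : A, QA x = 0 → x = 0 := fun x hx => Subtype.ext (hani x x.2 hx)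
  have hnd : (QuadraticMap.polarBilin QA).Nondegenerate := by
    have key : ∀ x : A, QuadraticMap.polar QA x x = 0 → x = 0 := by
      intro x hx
      rw [QuadraticMap.polar_self, two_smul, ← two_mul] at hx
      exact hani' x ((mul_eq_zero.1 hx).resolve_left two_ne_zero)
    exact ⟨fun x hx => key x (hx x), fun x hx => key x (hx x)⟩
  obtain ⟨v₀, hv₀⟩ := exists_orthFrame hnd hd
  obtain ⟨c, s, s', hsig⟩ := hv₀.exists_hasSig hp
  obtain ⟨v, u, S, hv, hS, h1, h2, h3, h4⟩ := id hsig
  let w : (Fin r ⊕ Fin r) ⊕ Fin d → W :=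
    Sum.elim (Sum.elim (fun i => e i + f i) (fun i => e i - f i)) (fun i => (v i : W))
  have hfe : ∀ i j, QuadraticMap.polar Q (f i) (e j) = if i = j then 1 else 0 := by
    intro i j
    rw [QuadraticMap.polar_comm, hef]
    simp only [eq_comm]
  have hQ1 : ∀ i, Q (e i + f i) = 1 := by
    intro i
    rw [QuadraticMap.map_add Q, he, hf, hef, if_pos rfl, zero_add, zero_add]
  have hQ2 : ∀ i, Q (e i - f i) = -1 := by
    intro i
    rw [sub_eq_add_neg, QuadraticMap.map_add Q, QuadraticMap.map_neg, QuadraticMap.polar_neg_right,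
      he, hf, hef, if_pos rfl, zero_add, zero_add]
  have hortho : ∀ i j, i ≠ j → QuadraticMap.polar Q (w i) (w j) = 0 := by
    rintro ((i | i) | i) ((j | j) | j) hij
    · have : i ≠ j := fun h => hij (by rw [h])
      simp [w, QuadraticMap.polar_add_left, QuadraticMap.polar_add_right, hee, hff, hef, hfe, this]
    · simp only [w, Sum.elim_inl, Sum.elim_inr, sub_eq_add_neg, QuadraticMap.polar_add_left,
        QuadraticMap.polar_add_right, QuadraticMap.polar_neg_right, hee, hff, hef, hfe]
      ring
    · simp only [w, Sum.elim_inl, Sum.elim_inr, QuadraticMap.polar_add_left,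
        (hA i _ (v j).2).1, (hA i _ (v j).2).2, add_zero]
    · simp only [w, Sum.elim_inl, Sum.elim_inr, sub_eq_add_neg, QuadraticMap.polar_add_left,
        QuadraticMap.polar_add_right, QuadraticMap.polar_neg_left, hee, hff, hef, hfe]
      ring
    · have : i ≠ j := fun h => hij (by rw [h])
      simp [w, sub_eq_add_neg, QuadraticMap.polar_add_left, QuadraticMap.polar_add_right, hee, hff,
        hef, hfe, this, QuadraticMap.polar_neg_left, QuadraticMap.polar_neg_right]
    · simp only [w, Sum.elim_inl, Sum.elim_inr, sub_eq_add_neg, QuadraticMap.polar_add_left,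
        QuadraticMap.polar_neg_left, (hA i _ (v j).2).1, (hA i _ (v j).2).2, add_zero, neg_zero]
    · simp only [w, Sum.elim_inl, Sum.elim_inr]
      rw [QuadraticMap.polar_comm]
      simp only [QuadraticMap.polar_add_left,
        (hA j _ (v i).2).1, (hA j _ (v i).2).2, add_zero]
    · simp only [w, Sum.elim_inl, Sum.elim_inr]
      rw [QuadraticMap.polar_comm]
      simp only [sub_eq_add_neg, QuadraticMap.polar_add_left,
        QuadraticMap.polar_neg_left, (hA j _ (v i).2).1, (hA j _ (v i).2).2, add_zero, neg_zero]
    · simp only [w, Sum.elim_inr]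
      rw [← hpA]
      exact hv.ortho i j fun h => hij (by rw [h])
  have hne : ∀ i, Q (w i) ≠ 0 := by
    rintro ((i | i) | i)
    · simp only [w, Sum.elim_inl, hQ1]; exact one_ne_zero
    · simp only [w, Sum.elim_inl, Sum.elim_inr, hQ2]; exact neg_ne_zero.2 one_ne_zero
    · simp only [w, Sum.elim_inr]; rw [← hQA]; exact hv.ne_zero i
  have hsp : Submodule.span ℚ_[p] (Set.range w) = ⊤ := by
    rw [eq_top_iff, ← hspan]
    have hw1 : ∀ i, e i + f i ∈ Submodule.span ℚ_[p] (Set.range w) := fun i =>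
      Submodule.subset_span ⟨Sum.inl (Sum.inl i), rfl⟩
    have hw2 : ∀ i, e i - f i ∈ Submodule.span ℚ_[p] (Set.range w) := fun i =>
      Submodule.subset_span ⟨Sum.inl (Sum.inr i), rfl⟩
    have h2e : ∀ x ∈ Submodule.span ℚ_[p] (Set.range w), (2 : ℚ_[p])⁻¹ • x ∈
      Submodule.span ℚ_[p] (Set.range w) := fun x hx => Submodule.smul_mem _ _ hx
    refine sup_le (Submodule.span_le.2 ?_) ?_
    · rintro _ (⟨i, rfl⟩ | ⟨i, rfl⟩)
      · have := h2e _ (add_mem (hw1 i) (hw2 i))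
        rwa [add_add_sub_cancel, ← two_smul ℚ_[p], smul_smul, inv_mul_cancel₀ two_ne_zero,
          one_smul] at this
      · have := h2e _ (sub_mem (hw1 i) (hw2 i))
        rwa [add_sub_sub_cancel, ← two_smul ℚ_[p], smul_smul, inv_mul_cancel₀ two_ne_zero,
          one_smul] at this
    · have : A = (Submodule.span ℚ_[p] (Set.range v)).map A.subtype := by
        rw [hv.span, Submodule.map_subtype_top]
      rw [this, ← Submodule.span_image, Submodule.span_le]
      rintro _ ⟨_, ⟨i, rfl⟩, rfl⟩
      exact Submodule.subset_span ⟨Sum.inr i, rfl⟩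
  have hw : OrthFrame Q w := ⟨hortho, hne, hsp⟩
  have hcard : n = 2 * r + d := by
    rw [← hn, finrank_eq_card_basis hw.basis]
    simp
    ring
  let σ : Fin n ≃ (Fin r ⊕ Fin r) ⊕ Fin d := Fintype.equivOfCardEq (by simp; omega)
  let S' : Finset ((Fin r ⊕ Fin r) ⊕ Fin d) := S.map Function.Embedding.inr
  let u' : (Fin r ⊕ Fin r) ⊕ Fin d → ℤ_[p]ˣ :=
    Sum.elim (Sum.elim (fun _ => 1) (fun _ => -1)) u
  have hcd : c ≤ d := hsig.le
  refine ⟨r, c, s, s', hcard, ?_, hsig.anisotropic_cases hani'⟩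
  have hmem : ∀ i, σ i ∈ S' ↔ i ∈ S'.map σ.symm.toEmbedding := by
    intro i
    rw [Finset.mem_map_equiv, Equiv.symm_symm]
  refine ⟨w ∘ σ, u' ∘ σ, S'.map σ.symm.toEmbedding, hw.comp_equiv σ, by simp [S', hS], ?_, ?_,
    ?_, ?_⟩
  · intro i hi
    rw [← hmem] at hi
    obtain ⟨j, hj, hji⟩ := Finset.mem_map.1 hi
    simp only [Function.comp_apply]
    rw [← hji]
    exact h1 j hj
  · intro i hi
    rw [← hmem] at hi
    simp only [Function.comp_apply]
    generalize σ i = k at hi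
    rcases k with (k | k) | k
    · simp only [w, u', Sum.elim_inl, hQ1]; simp
    · simp only [w, u', Sum.elim_inl, Sum.elim_inr, hQ2]; simp
    · exact h2 k fun hk => hi (Finset.mem_map.2 ⟨k, hk, rfl⟩)
  · have e1 : ∏ i ∈ (S'.map σ.symm.toEmbedding)ᶜ, sgn ((u' ∘ σ) i) = ∏ i ∈ S'ᶜ, sgn (u' i) := by
      refine Finset.prod_equiv σ (fun i => ?_) fun _ _ => rfl
      rw [Finset.mem_compl, Finset.mem_compl, hmem]
    have e2 : ∏ i ∈ S'ᶜ, sgn (u' i) = sgn (-1 : ℤ_[p]ˣ) ^ r * ∏ i ∈ Sᶜ, sgn (u i) := by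
      have e3 : S'ᶜ = (Finset.univ : Finset (Fin r ⊕ Fin r)).disjSum Sᶜ := by
        ext ((i | i) | i) <;> simp [S']
      rw [e3, Finset.prod_disjSum]
      simp [u']
    have e3 : n - c = (d - c) + 2 * r := by omega
    rw [e1, e2, e3, normSign_add_two_mul, ← h3]
    have := Int.units_mul_self (sgn (-1 : ℤ_[p]ˣ) ^ r)
    rw [mul_mul_mul_comm, this, one_mul]
  · rw [Finset.prod_map]
    simp only [Function.comp_apply, Equiv.coe_toEmbedding, Equiv.apply_symm_apply, S',
      Finset.prod_map, Function.Embedding.inr_apply, u', Sum.elim_inr]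
    exact h4

end Anisotropic

section Extremal

variable {p : ℕ} [Fact p.Prime] {W : Type*} [AddCommGroup W] [Module ℚ_[p] W]
  [Module ℤ_[p] W] [IsScalarTower ℤ_[p] ℚ_[p] W] {q : QuadraticForm ℚ_[p] W}

/-- The vertex lattices of extremal type, if the signature is unique up to the parity of the
type. -/
theorem HasSig.extremal {hp : p ≠ 2} (hq : (QuadraticMap.polarBilin q).Nondegenerate)
    {n : ℕ} (hn : finrank ℚ_[p] W = n) (hn3 : 3 ≤ n) {c : ℕ} {t t' : ℤˣ}
    (h : ∃ d, HasSig hp p 1 q n d t t')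
    (huniq : ∀ c₁ t₁ t₁', HasSig hp p 1 q n c₁ t₁ t₁' → (Even c₁ ↔ Even c) ∧ t₁ = t ∧ t₁' = t')
    {k l : ℕ} (hk : k = if Even (n - c) then (if t = 1 then 0 else 2) else 1) (hc : c ≤ n)
    (hl : l = if Even c then (if t' = 1 then 0 else 2) else 1) :
    MaxIs q k t (n - k) t' ∧ MinIs q (n - l) t l t' := by
  obtain ⟨d, h⟩ := h
  have hdc := (huniq _ _ _ h).1
  have hdn := h.le
  have hpar : ∀ x ≤ n, (Even x ↔ Even c) → (Even (n - x) ↔ Even (n - c)) := by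
    intro x hx hxc
    rw [Nat.even_sub hx, Nat.even_sub hc, hxc]
  constructor
  · have h1 := h.swap.toMin hn3 one_ne_zero padic_p_ne_zero
    simp only [hpar d hdn hdc] at h1
    rw [← hk] at h1
    have hkn := h1.le
    have h2 := h1.swap.maxIs hq hn (by
      intro c₁ t₁ t₁' h3
      obtain ⟨h4, rfl, rfl⟩ := huniq _ _ _ h3
      refine ⟨?_, rfl, rfl⟩
      have hle := h3.le
      have h5 := hpar _ hle h4
      have h6 : n - c₁ = 0 → t₁ = 1 := by
        intro h7
        have h8 := h3.swap
        rw [h7] at h8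
        exact h8.eq_one_of_zero
      have : k ≤ n - c₁ := by
        rw [hk]
        split_ifs with ha hb
        · exact Nat.zero_le _
        · have h9 : n - c₁ ≠ 0 := fun h => hb (h6 h)
          obtain ⟨z, hz⟩ := h5.2 ha
          omega
        · rcases Nat.eq_zero_or_pos (n - c₁) with h0 | h0
          · exact absurd (h5.1 (by rw [h0]; exact Even.zero)) ha
          · exact h0
      omega)
    rwa [Nat.sub_sub_self hkn] at h2
  · have h1 := h.toMin hn3 padic_p_ne_zero one_ne_zero
    simp only [hdc] at h1
    rw [← hl] at h1
    refine h1.minIs hq hn ?_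
    intro c₁ t₁ t₁' h3
    obtain ⟨h4, rfl, rfl⟩ := huniq _ _ _ h3
    refine ⟨?_, rfl, rfl⟩
    rw [hl]
    split_ifs with ha hb
    · exact Nat.zero_le _
    · have h9 : c₁ ≠ 0 := by
        rintro rfl
        exact hb h3.eq_one_of_zero
      obtain ⟨z, hz⟩ := h4.2 ha
      omega
    · rcases Nat.eq_zero_or_pos c₁ with rfl | h0
      · exact absurd (h4.1 Even.zero) ha
      · exact h0

end Extremal

section Invariants

variable {p : ℕ} [Fact p.Prime] {W W' : Type*} [AddCommGroup W] [Module ℚ_[p] W]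
  [FiniteDimensional ℚ_[p] W] [AddCommGroup W'] [Module ℚ_[p] W']
  [FiniteDimensional ℚ_[p] W'] {Q : QuadraticForm ℚ_[p] W} {q : QuadraticForm ℚ_[p] W'}

theorem discClass_eq_of_prod (hQ : (QuadraticMap.polarBilin Q).Nondegenerate)
    (hq : (QuadraticMap.polarBilin q).Nondegenerate) {n : ℕ} (hn : finrank ℚ_[p] W = n)
    (hn' : finrank ℚ_[p] W' = n)
    (hdisc : ∀ (v : Fin n → W) (w : Fin n → W'), OrthFrame Q v → OrthFrame q w →
      ∃ r : ℚ_[p], ∏ i, q (w i) = r ^ 2 * ∏ i, Q (v i)) :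
    discClass q = discClass Q := by
  obtain ⟨v, hv⟩ := exists_orthFrame hQ rfl
  obtain ⟨w, hw⟩ := exists_orthFrame hq rfl
  rw [discClass_eq v hv, discClass_eq w hw]
  have hprod : ∃ r : ℚ_[p], ∏ i, q (w i) = r ^ 2 * ∏ i, Q (v i) := by
    obtain ⟨r, hr⟩ := hdisc (v ∘ finCongr hn.symm) (w ∘ finCongr hn'.symm)
      (hv.comp_equiv _) (hw.comp_equiv _)
    refine ⟨r, ?_⟩
    simp only [Function.comp_apply] at hr
    rw [Equiv.prod_comp (finCongr hn'.symm) fun i => q (w i),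
      Equiv.prod_comp (finCongr hn.symm) fun i => Q (v i)] at hr
    exact hr
  obtain ⟨r, hr⟩ := hprod
  have hr0 : r ≠ 0 := by
    rintro rfl
    rw [zero_pow two_ne_zero, zero_mul] at hr
    exact Finset.prod_ne_zero_iff.2 (fun i _ => hw.ne_zero i) hr
  rw [hr, hn'.trans hn.symm]
  ext d
  constructor
  · rintro ⟨c, hc, rfl⟩
    exact ⟨c * r, mul_ne_zero hc hr0, by ring⟩
  · rintro ⟨c, hc, rfl⟩
    refine ⟨c * r⁻¹, mul_ne_zero hc (inv_ne_zero hr0), ?_⟩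
    field_simp

theorem hasHasseInvariant_of_hasSig (hp : p ≠ 2) (hQ : (QuadraticMap.polarBilin Q).Nondegenerate)
    {n : ℕ} (hn : finrank ℚ_[p] W = n) {e : ℤˣ}
    (h : ∀ c s s', HasSig hp p 1 Q n c s s' → sigHasse hp n c s s' = e) :
    HasHasseInvariant Q e := by
  subst hn
  constructor
  · obtain ⟨v, hv⟩ := exists_orthFrame hQ rfl
    exact ⟨v, hv.ortho⟩
  · intro v hv
    obtain ⟨c, s, s', h1, h2⟩ := (basis_orthFrame hQ v hv).prod_hilbertSymbol hp
    exact h2.trans (h _ _ _ h1)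

end Invariants

section FixedSpace

variable {p : ℕ} [Fact p.Prime] {V : Type*} [AddCommGroup V] [Module ℚ_[p] V]
  {Q : QuadraticForm ℚ_[p] V} {n : ℕ} {e : Fin n → V} {b : (CBreve Q)ˣ}
  {q : QuadraticForm ℚ_[p] (FixedV Q b)}

theorem fixedForm_nondegenerate [FiniteDimensional ℚ_[p] V] (hn3 : 3 ≤ n) (he : OrthFrame Q e)
    (hb : IsGSpin Q b) (hbasic : IsBasic Q b)
    (hq : ∀ x y, algebraMap ℚ_[p] (BreveQp p) (QuadraticMap.polar q x y) =
      formBreve Q (FixedV.incl Q b x) (FixedV.incl Q b y)) :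
    (QuadraticMap.polarBilin q).Nondegenerate := by
  have key : ∀ x, (∀ y, QuadraticMap.polar q x y = 0) → x = 0 := by
    intro x hx
    have h1 : ∀ z, formBreve Q (FixedV.incl Q b x) z = 0 := by
      intro z
      have hz : z ∈ Submodule.span (BreveQp p) (fixedSpace Q b : Set (VBreve p V)) := by
        rw [span_fixedSpace he.isFrame hn3 hb hbasic]; trivial
      induction hz using Submodule.span_induction with
      | mem y hy =>
        let y' : FixedV Q b := ⟨y, hy⟩
        have h2 := hq x y'
        rw [hx, map_zero] at h2
        exact h2.symm
      | zero => rw [map_zero]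
      | add y z _ _ hy hz => rw [map_add, hy, hz, add_zero]
      | smul c y _ hy => rw [map_smul, hy, smul_zero]
    exact Subtype.ext (he.isFrame.eq_zero fun i => h1 _)
  refine ⟨key, fun y hy => key y fun x => ?_⟩
  rw [QuadraticMap.polar_comm]
  exact hy x

end FixedSpace

end GSpinFixed
end

open GSpinFixed in
theorem mainTheorem11 (p : ℕ) [Fact p.Prime] (hp : p ≠ 2)
    {V : Type*} [AddCommGroup V] [Module ℚ_[p] V] [FiniteDimensional ℚ_[p] V]
    [Module ℤ_[p] V] [IsScalarTower ℤ_[p] ℚ_[p] V]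
    (n : ℕ) (hn : Module.finrank ℚ_[p] V = n) (hn3 : 3 ≤ n)
    (Q : QuadraticForm ℚ_[p] V) (hQ : (QuadraticMap.polarBilin Q).Nondegenerate)
    -- the hyperbolic pair that defines `μ`
    (x₁ x₂ : VBreve p V)
    (hx₁ : formBreve Q x₁ x₁ = 0)
    (hx₂ : formBreve Q x₂ x₂ = 0)
    (hx₁₂ : formBreve Q x₁ x₂ = 1)
    -- `b` is basic, with `κ(b) = κ(μ)`
    (b : (CBreve Q)ˣ) (hb : IsGSpin Q b) (hbasic : IsBasic Q b)
    (m : ℤ) (hμ : MuHasClass Q x₁ x₂ m) (hκ : HasKottwitzInvariant Q b m) :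
    -- the form of `V_{ℚ̆_p}` restricts to a `ℚ_p`-valued form `q` on `𝕍 = FixedV Q b`
    ∃ q : QuadraticForm ℚ_[p] (FixedV Q b),
      (∀ x y, algebraMap ℚ_[p] (BreveQp p) (QuadraticMap.polar q x y) =
        formBreve Q (FixedV.incl Q b x) (FixedV.incl Q b y)) ∧
      FiniteDimensional ℚ_[p] (FixedV Q b) ∧
      Module.finrank ℚ_[p] (FixedV Q b) = n ∧
      discClass q = discClass Q ∧
      (∃ e : ℤˣ, HasHasseInvariant Q e ∧ HasHasseInvariant q (-e)) ∧
      (HasAnisotropicDim Q 0 →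
        MaxIs q 2 (-1) (n - 2) (-1) ∧ MinIs q (n - 2) (-1) 2 (-1)) ∧
      (HasAnisotropicDim Q 1 →
        ((∃ χ, SpaceIsHLambda Q n χ 0 1) ∨ (∃ χ, SpaceIsHLambda Q (n - 1) 1 1 χ)) ∧
        (∀ χ, SpaceIsHLambda Q n χ 0 1 →
          MaxIs q 1 (-χ) (n - 1) (-1) ∧ MinIs q (n - 2) (-χ) 2 (-1)) ∧
        (∀ χ, SpaceIsHLambda Q (n - 1) 1 1 χ →
          MaxIs q 2 (-1) (n - 2) (-χ) ∧ MinIs q (n - 1) (-1) 1 (-χ))) ∧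
      (HasAnisotropicDim Q 2 →
        (SpaceIsHLambda Q n (-1) 0 1 ∨ SpaceIsHLambda Q (n - 2) 1 2 (-1) ∨
          (∃ χ₁ χ₂, SpaceIsHLambda Q (n - 1) χ₂ 1 χ₁)) ∧
        (SpaceIsHLambda Q n (-1) 0 1 →
          MaxIs q 0 1 n (-1) ∧ MinIs q (n - 2) 1 2 (-1)) ∧
        (SpaceIsHLambda Q (n - 2) 1 2 (-1) →
          MaxIs q 2 (-1) (n - 2) 1 ∧ MinIs q n (-1) 0 1) ∧
        (∀ χ₁ χ₂, SpaceIsHLambda Q (n - 1) χ₂ 1 χ₁ →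
          MaxIs q 1 (-χ₂) (n - 1) (-χ₁) ∧ MinIs q (n - 1) (-χ₂) 1 (-χ₁))) ∧
      (HasAnisotropicDim Q 3 →
        ((∃ χ, SpaceIsHLambda Q (n - 2) (-χ) 2 (-1)) ∨
          (∃ χ, SpaceIsHLambda Q (n - 1) (-1) 1 (-χ))) ∧
        (∀ χ, SpaceIsHLambda Q (n - 2) (-χ) 2 (-1) →
          MaxIs q 1 χ (n - 1) 1 ∧ MinIs q n χ 0 1) ∧
        (∀ χ, SpaceIsHLambda Q (n - 1) (-1) 1 (-χ) →
          MaxIs q 0 1 n χ ∧ MinIs q (n - 1) 1 1 χ)) ∧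
      (HasAnisotropicDim Q 4 →
        MaxIs q 0 1 n 1 ∧ MinIs q n 1 0 1) := by
  obtain ⟨e, he⟩ := exists_orthFrame hQ hn
  obtain ⟨q, hq⟩ := exists_fixedForm he hb
  obtain ⟨β⟩ := exists_fixed_basis he.isFrame hn3 hn hb hbasic
  have hfin : FiniteDimensional ℚ_[p] (FixedV Q b) := Module.Finite.of_basis β
  have hrank : Module.finrank ℚ_[p] (FixedV Q b) = n := by
    rw [Module.finrank_eq_card_basis β, Fintype.card_fin]
  have hqn := fixedForm_nondegenerate hn3 he hb hbasic hq
  have hdisc : ∀ (v : Fin n → V) (w : Fin n → FixedV Q b), OrthFrame Q v → OrthFrame q w →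
      ∃ r : ℚ_[p], ∏ i, q (w i) = r ^ 2 * ∏ i, Q (v i) := fun v w hv hw =>
    exists_prod_eq_sq_mul hn3 hv hb hbasic hq hw
  have hiso : ∀ (v : Fin n → V) (w : Fin n → FixedV Q b), OrthFrame Q v → OrthFrame q w →
      ¬∀ i, q (w i) = Q (v i) := by
    intro v w hv hw h
    have h1 := even_of_isometric hn3 hv hb hbasic hq hw h hκ
    rw [muClass_eq hx₁ hx₂ hx₁₂ hμ] at h1
    exact absurd h1 (by decide)
  have hopp : ∀ {c s s' d t t'}, HasSig hp p 1 Q n c s s' → HasSig hp p 1 q n d t t' →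
      (Even d ↔ Even c) ∧ t = -s ∧ t' = -s' := fun h h' => h.opposite hn3 hdisc hiso h'
  obtain ⟨w, hw⟩ := exists_orthFrame hqn hrank
  obtain ⟨d₀, t₀, t₀', hsig₀⟩ := hw.exists_hasSig hp
  obtain ⟨c₀, s₀, s₀', hSig₀⟩ := he.exists_hasSig hp
  have hext : ∀ {c s s'} (k l : ℕ), HasSig hp p 1 Q n c s s' →
      k = (if Even (n - c) then (if -s = 1 then 0 else 2) else 1) →
      l = (if Even c then (if -s' = 1 then 0 else 2) else 1) →
      MaxIs q k (-s) (n - k) (-s') ∧ MinIs q (n - l) (-s) l (-s') := by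
    intro c s s' k l h hk hl
    obtain ⟨h1, rfl, rfl⟩ := hopp h hsig₀
    exact HasSig.extremal hqn hrank hn3 ⟨d₀, hsig₀⟩ (fun c₁ t₁ t₁' h' => hopp h h') hk h.le hl
  have h1ne : (-1 : ℤˣ) ≠ 1 := by decide
  have hHasse : ∀ c c' s s', (Even c' ↔ Even c) →
      sigHasse hp n c' (-s) (-s') = -sigHasse hp n c s s' := by
    intro c c' s s' h
    simp only [sigHasse, h]
    split <;> simp
  refine ⟨q, hq, hfin, hrank, discClass_eq_of_prod hQ hqn hn hrank hdisc,
    ⟨sigHasse hp n c₀ s₀ s₀', hasHasseInvariant_of_hasSig hp hQ hn ?_,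
      hasHasseInvariant_of_hasSig hp hqn hrank ?_⟩, ?_, ?_, ?_, ?_, ?_⟩
  · intro c s s' h
    obtain ⟨h1, h2, h3⟩ := hopp h hsig₀
    have h4 := hHasse c d₀ s s' h1
    obtain ⟨h5, h6, h7⟩ := hopp hSig₀ hsig₀
    have h8 := hHasse c₀ d₀ s₀ s₀' h5
    rw [← h2, ← h3] at h4
    rw [← h6, ← h7, h4] at h8
    exact neg_injective h8
  · intro c s s' h
    obtain ⟨h1, rfl, rfl⟩ := hopp hSig₀ h
    exact hHasse _ _ _ _ h1
  · intro h
    obtain ⟨r, c, s, s', hnr, h, hcases⟩ := h.exists_hasSig hp hn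
    obtain ⟨-, -, hc, h0, -, h0', -⟩ := hcases
    obtain rfl : c = 0 := by omega
    rw [h0 rfl, h0' rfl] at h
    have hev : Even n := ⟨r, by omega⟩
    exact hext 2 2 h (by simp [hev, h1ne]) (by simp [h1ne])
  · intro h
    obtain ⟨r, c, s, s', hnr, h, hcases⟩ := h.exists_hasSig hp hn
    obtain ⟨-, -, hc, h0, -, h0', -⟩ := hcases
    have hodd : ¬Even n := by rw [Nat.not_even_iff_odd]; exact ⟨r, by omega⟩
    have hev : Even (n - 1) := ⟨r, by omega⟩
    refine ⟨?_, fun χ hχ => ?_, fun χ hχ => ?_⟩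
    · rcases (by omega : c = 0 ∨ c = 1) with rfl | rfl
      · rw [h0 rfl] at h
        exact Or.inl ⟨s, h.spaceIsHLambda⟩
      · rw [h0' rfl] at h
        exact Or.inr ⟨s', h.spaceIsHLambda⟩
    · exact hext 1 2 (hχ.hasSig hp (by omega)) (by simp [hodd]) (by simp [h1ne])
    · exact hext 2 1 (hχ.hasSig hp (by omega)) (by simp [hev, h1ne]) (by simp)
  · intro h
    obtain ⟨r, c, s, s', hnr, h, hcases⟩ := h.exists_hasSig hp hn
    obtain ⟨-, -, hc, h0, h2, h0', h2'⟩ := hcases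
    have hev : Even n := ⟨r + 1, by omega⟩
    have hodd : ¬Even (n - 1) := by rw [Nat.not_even_iff_odd]; exact ⟨r, by omega⟩
    have hev' : Even (n - 2) := ⟨r, by omega⟩
    refine ⟨?_, fun hχ => ?_, fun hχ => ?_, fun χ₁ χ₂ hχ => ?_⟩
    · rcases (by omega : c = 0 ∨ c = 1 ∨ c = 2) with rfl | rfl | rfl
      · rw [h0 rfl, h2' rfl] at h
        exact Or.inl h.spaceIsHLambda
      · exact Or.inr (Or.inr ⟨s', s, h.spaceIsHLambda⟩)
      · rw [h2 rfl, h0' rfl] at h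
        exact Or.inr (Or.inl h.spaceIsHLambda)
    · simpa using hext 0 2 (hχ.hasSig hp (by omega)) (by simp [hev]) (by simp [h1ne])
    · simpa using hext 2 0 (hχ.hasSig hp (by omega)) (by simp [hev', h1ne]) (by simp)
    · exact hext 1 1 (hχ.hasSig hp (by omega)) (by simp [hodd]) (by simp)
  · intro h
    obtain ⟨r, c, s, s', hnr, h, hcases⟩ := h.exists_hasSig hp hn
    obtain ⟨hc2, hc2', hc, -, h2, -, h2'⟩ := hcases
    have hev : Even (n - 1) := ⟨r + 1, by omega⟩
    have hodd : ¬Even (n - 2) := by rw [Nat.not_even_iff_odd]; exact ⟨r, by omega⟩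
    refine ⟨?_, fun χ hχ => ?_, fun χ hχ => ?_⟩
    · rcases (by omega : c = 1 ∨ c = 2) with rfl | rfl
      · rw [h2' rfl] at h
        exact Or.inr ⟨-s', by rw [neg_neg]; exact h.spaceIsHLambda⟩
      · rw [h2 rfl] at h
        exact Or.inl ⟨-s, by rw [neg_neg]; exact h.spaceIsHLambda⟩
    · simpa using hext 1 0 (hχ.hasSig hp (by omega)) (by simp [hodd]) (by simp)
    · simpa using hext 0 1 (hχ.hasSig hp (by omega)) (by simp [hev]) (by simp)
  · intro h
    obtain ⟨r, c, s, s', hnr, h, hcases⟩ := h.exists_hasSig hp hn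
    obtain ⟨hc2, hc2', hc, -, h2, -, h2'⟩ := hcases
    obtain rfl : c = 2 := by omega
    rw [h2 rfl, h2' rfl] at h
    have hev : Even (n - 2) := ⟨r + 1, by omega⟩
    simpa using hext 0 0 h (by simp [hev]) (by simp)
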